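/- Let $\lambda,\gamma,C>0$ and let $\mathbf m=(m_x)_{x\in\mathbb Z}$ be i.i.d. with values in $[C^{-1},C]$, with law $\mathbb P$ on $[C^{-1},C]^{\mathbb Z}$. Let $\mu_1$ be the law on $\mathbb R^{\mathbb Z}$ of i.i.d. standard Gaussian variables $\omega=(\omega_x)_{x\in\mathbb Z}$, and write $\mathbb E^\star$ for the expectation with respect to $\mathbb P\otimes\mu_1$. Let $\tau_x$ denote the translation by $x$ of $\mathbf m$ and $\omega$. Consider the generator $\mathcal L^{\mathbf m}=\mathcal A^{\mathbf m}+\gamma\mathcal S^{\rm flip}+\lambda\mathcal S^{\rm exch}$ with $$\mathcal A^{\mathbf m}=\sum_{x\in\mathbb Z}\Big(\frac{\omega_{x+1}}{\sqrt{m_xm_{x+1}}}-\frac{\omega_{x-1}}{\sqrt{m_{x-1}m_x}}\Big)\frac{\partial}{\partial\omega_x},\qquad \mathcal S^{\rm flip}f=\sum_x\{f(\mathbf m,\omega^x)-f(\mathbf m,\omega)\},\qquad \mathcal S^{\rm exch}f=\sum_x\{f(\mathbf m,\omega^{x,x+1})-f(\mathbf m,\omega)\},$$ where $\omega^x$ is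 $\omega$ with $\omega_x$ replaced by $-\omega_x$, and $\omega^{x,x+1}$ is $\omega$ with $\omega_x,\omega_{x+1}$ exchanged. Let $j^A_{0,1}=2\omega_0\omega_1/\sqrt{m_0m_1}$. Let $\mathcal C$ be the space of measurable cylinder functions $f(\mathbf m,\omega)$ that are continuous in $\mathbf m$ for each $\omega$, square integrable with mean zero under $\mu_1$ for each $\mathbf m$, and square integrable under $\mathbb P\otimes\mu_1$; let $\ll f,g\gg_\star=\sum_{x\in\mathbb Z}\mathbb E^\star[f\,\tau_xg]$, let $\mathbf L^2_\star$ be the Hilbert space generated by $\mathcal C$ and this semi-inner product, and let $\mathcal L^{\mathbf m}$ act in $\mathbf L^2_\star$ as the closure of its restriction to those $f\in\mathcal C$ that are continuously differentiable in $\omega$ (as functions of finitely many $\omega_x$, for each $\mathbf m$) and satisfy $\mathcal L^{\mathbf m}f\in\mathcal C$. Then for every $z>0$ the resolvent equation $(z-\mathcal L^{\mathbf m})h_z=j^A_{0,1}$ has exactly one solution $h_z\in\mathbf L^2_\star$. The homogenized infinite-volume Green--Kubo formula $$\overline\kappa(z)=\lambda+\frac12\int_0^\infty e^{-zt}\sum_{x\in\mathbb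 Z}\mathbb E\big[j^A_{0,1}(\mathbf m,\omega(t))\;\tau_xj^A_{0,1}(\mathbf m,\omega(0))\big]\,dt ,$$ where $(\mathbf m,\omega(t))_{t\ge0}$ is any equilibrium process of the chain (its law at each time is $\mathbb P\otimes\mu_1$ and it solves the martingale problem for $\mathcal L^{\mathbf m}$ on the above functions), is well defined for every $z>0$ (the series is summable for every $t\ge0$ and the integrand is integrable) and $$\overline\kappa(z)=\lambda+\frac12\ll j^A_{0,1},h_z\gg_\star .$$ Moreover the limit $$\overline D=\lim_{z\to0,\ z>0}\overline\kappa(z)$$ exists, is finite, and satisfies $\overline D\ge\lambda>0$. -/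

import Mathlib

open MeasureTheory ProbabilityTheory Filter Topology
open scoped NNReal ENNReal

noncomputable section

namespace DisorderedChain

/-- Disorder fields `m = (m_x)` with values in `[C⁻¹, C]`. -/
abbrev Disorder (C : ℝ) : Type := ℤ → Set.Icc C⁻¹ C

/-- Configurations `ω = (ω_x)` of the infinite chain. -/
abbrev Config : Type := ℤ → ℝ

variable {C : ℝ}

/-- The Gibbs measure at inverse temperature one: i.i.d. standard Gaussians. -/
def gibbs : Measure Config := Measure.infinitePi (fun _ : ℤ => gaussianReal 0 1)

instance : IsProbabilityMeasure gibbs := by unfold gibbs; infer_instance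

/-- The law of the disorder: i.i.d. with one-site law `ν`. -/
def disorderLaw (ν : Measure (Set.Icc C⁻¹ C)) [IsProbabilityMeasure ν] :
    Measure (Disorder C) := Measure.infinitePi (fun _ : ℤ => ν)

instance (ν : Measure (Set.Icc C⁻¹ C)) [IsProbabilityMeasure ν] :
    IsProbabilityMeasure (disorderLaw ν) := by unfold disorderLaw; infer_instance

/-- The annealed equilibrium measure, product of the disorder law and the Gibbs measure. -/
def annealed (ν : Measure (Set.Icc C⁻¹ C)) [IsProbabilityMeasure ν] :
    Measure (Disorder C × Config) := (disorderLaw ν).prod gibbs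

instance (ν : Measure (Set.Icc C⁻¹ C)) [IsProbabilityMeasure ν] :
    IsProbabilityMeasure (annealed ν) := by unfold annealed; infer_instance

/-- Translation by `x` of disorder and configuration. -/
def shift (x : ℤ) (p : Disorder C × Config) : Disorder C × Config :=
  (fun z => p.1 (x + z), fun z => p.2 (x + z))

/-- The configuration with the sign of the value at `x` flipped. -/
def flip (x : ℤ) (ω : Config) : Config := Function.update ω x (-ω x)

/-- The configuration with the values at `x` and `x + 1` exchanged. -/
def exch (x : ℤ) (ω : Config) : Config := fun z => ω (Equiv.swap x (x + 1) z)

/-- The function `f` depends on finitely many of the coordinates `m_x, ω_x` only. -/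
def IsCylinder (f : Disorder C × Config → ℝ) : Prop :=
  ∃ Λ : Finset ℤ, ∀ p q : Disorder C × Config,
    (∀ x ∈ Λ, p.1 x = q.1 x ∧ p.2 x = q.2 x) → f p = f q

/-- Measurable cylinder functions which are continuous in the disorder, square integrable and
centred with respect to the Gibbs measure for every disorder, and square integrable with respect
to the annealed measure. -/
structure IsLocal (ν : Measure (Set.Icc C⁻¹ C)) [IsProbabilityMeasure ν]
    (f : Disorder C × Config → ℝ) : Prop where
  measurable : Measurable f
  cylinder : IsCylinder f
  continuous_disorder : ∀ ω : Config, Continuous (fun m : Disorder C => f (m, ω))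
  memLp_gibbs : ∀ m : Disorder C, MemLp (fun ω => f (m, ω)) 2 gibbs
  centred : ∀ m : Disorder C, ∫ ω, f (m, ω) ∂gibbs = 0
  memLp : MemLp f 2 (annealed ν)

section Space

variable (ν : Measure (Set.Icc C⁻¹ C)) [IsProbabilityMeasure ν]

/-- The vector space of the functions satisfying `IsLocal`. -/
def localSubmodule : Submodule ℝ (Disorder C × Config → ℝ) where
  carrier := {f | IsLocal ν f}
  zero_mem' :=
    { measurable := measurable_const
      cylinder := ⟨∅, fun _ _ _ => rfl⟩
      continuous_disorder := fun _ => continuous_const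
      memLp_gibbs := fun _ => MemLp.zero
      centred := fun _ => by simp
      memLp := MemLp.zero }
  add_mem' := by
    classical
    rintro f g hf hg
    refine ⟨hf.measurable.add hg.measurable, ?_,
      fun ω => (hf.continuous_disorder ω).add (hg.continuous_disorder ω),
      fun m => (hf.memLp_gibbs m).add (hg.memLp_gibbs m), fun m => ?_, hf.memLp.add hg.memLp⟩
    · obtain ⟨Λ, h⟩ := hf.cylinder
      obtain ⟨Λ', h'⟩ := hg.cylinder
      refine ⟨Λ ∪ Λ', fun p q hpq => ?_⟩
      simp only [Pi.add_apply]
      rw [h p q fun x hx => hpq x (Finset.mem_union_left _ hx),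
        h' p q fun x hx => hpq x (Finset.mem_union_right _ hx)]
    · simp only [Pi.add_apply]
      rw [integral_add ((hf.memLp_gibbs m).integrable (by norm_num))
        ((hg.memLp_gibbs m).integrable (by norm_num)), hf.centred, hg.centred, add_zero]
  smul_mem' := by
    rintro c f hf
    refine ⟨hf.measurable.const_smul c, ?_, fun ω => (hf.continuous_disorder ω).const_smul c,
      fun m => (hf.memLp_gibbs m).const_smul c, fun m => ?_, hf.memLp.const_smul c⟩
    · obtain ⟨Λ, h⟩ := hf.cylinder
      exact ⟨Λ, fun p q hpq => by simp only [Pi.smul_apply, h p q hpq]⟩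
    · simp only [Pi.smul_apply, smul_eq_mul]
      rw [integral_const_mul, hf.centred, mul_zero]

/-- The type of the functions satisfying `IsLocal`. -/
def LocalFun : Type := localSubmodule ν

instance : AddCommGroup (LocalFun ν) := inferInstanceAs (AddCommGroup (localSubmodule ν))

instance : Module ℝ (LocalFun ν) := inferInstanceAs (Module ℝ (localSubmodule ν))

variable {ν}

/-- The underlying function. -/
def LocalFun.toFun (f : LocalFun ν) : Disorder C × Config → ℝ :=
  (show localSubmodule ν from f).1

instance : CoeFun (LocalFun ν) (fun _ => Disorder C × Config → ℝ) := ⟨LocalFun.toFun⟩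

theorem LocalFun.isLocal (f : LocalFun ν) : IsLocal ν f := (show localSubmodule ν from f).2

/-- The semi-inner product `∑_x E[g τ_x h]`. -/
def semiInner (g h : LocalFun ν) : ℝ :=
  ∑' x : ℤ, ∫ p, g p * h (shift x p) ∂annealed ν

theorem shift_shift (x y : ℤ) (p : Disorder C × Config) :
    shift x (shift y p) = shift (x + y) p := by
  have h : ∀ z : ℤ, y + (x + z) = x + y + z := fun z => by ring
  simp only [shift, h]

theorem measurePreserving_shift (x : ℤ) :
    MeasurePreserving (shift (C := C) x) (annealed ν) (annealed ν) := by
  have h1 : MeasurePreserving (fun (m : Disorder C) z => m (x + z))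
      (disorderLaw ν) (disorderLaw ν) :=
    ⟨by fun_prop, Measure.map_infinitePi_infinitePi_of_inj (P := fun _ : ℤ => ν)
      (add_right_injective x)⟩
  have h2 : MeasurePreserving (fun (ω : Config) z => ω (x + z)) gibbs gibbs :=
    ⟨by fun_prop, Measure.map_infinitePi_infinitePi_of_inj
      (P := fun _ : ℤ => gaussianReal 0 1) (add_right_injective x)⟩
  exact h1.prod h2

theorem LocalFun.memLp_shift (f : LocalFun ν) (x : ℤ) :
    MemLp (fun p => f (shift x p)) 2 (annealed ν) :=
  f.isLocal.memLp.comp_measurePreserving (measurePreserving_shift x)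

theorem integrable_mul_shift (f g : LocalFun ν) (x y : ℤ) :
    Integrable (fun p => f (shift x p) * g (shift y p)) (annealed ν) :=
  (f.memLp_shift x).integrable_mul (g.memLp_shift y)

theorem integrable_mul_shift_right (f g : LocalFun ν) (y : ℤ) :
    Integrable (fun p => f p * g (shift y p)) (annealed ν) :=
  f.isLocal.memLp.integrable_mul (g.memLp_shift y)

/-- Two functions which depend on disjoint sets of coordinates are uncorrelated. -/
theorem integral_gibbs_mul_eq_zero {f g : Config → ℝ} {Λ Λ' : Finset ℤ} (hd : Disjoint Λ Λ')
    (hf : Measurable f) (hg : Measurable g)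
    (hfΛ : ∀ ω ω' : Config, (∀ x ∈ Λ, ω x = ω' x) → f ω = f ω')
    (hgΛ : ∀ ω ω' : Config, (∀ x ∈ Λ', ω x = ω' x) → g ω = g ω')
    (h0 : ∫ ω, f ω ∂gibbs = 0) : ∫ ω, f ω * g ω ∂gibbs = 0 := by
  classical
  have hind : iIndepFun (fun (i : ℤ) (ω : Config) => ω i) gibbs :=
    iIndepFun_infinitePi (P := fun _ : ℤ => gaussianReal 0 1) (X := fun _ ω => ω)
      (fun _ => measurable_id)
  have h := hind.indepFun_finset Λ Λ' hd (fun i => measurable_pi_apply i)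
  let e : ∀ S : Finset ℤ, (S → ℝ) → Config := fun S y i => if hi : i ∈ S then y ⟨i, hi⟩ else 0
  have he : ∀ S, Measurable (e S) := by
    intro S
    refine measurable_pi_lambda _ fun i => ?_
    by_cases hi : i ∈ S
    · simpa [e, hi] using measurable_pi_apply _
    · simp [e, hi]
  have h' := h.comp (hf.comp (he Λ)) (hg.comp (he Λ'))
  have e1 : (f ∘ e Λ) ∘ (fun (a : Config) (i : Λ) => a i) = f := by
    funext ω
    exact hfΛ _ _ fun x hx => by simp [e, hx]
  have e2 : (g ∘ e Λ') ∘ (fun (a : Config) (i : Λ') => a i) = g := by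
    funext ω
    exact hgΛ _ _ fun x hx => by simp [e, hx]
  rw [e1, e2] at h'
  rw [h'.integral_fun_mul_eq_mul_integral hf.aestronglyMeasurable hg.aestronglyMeasurable,
    h0, zero_mul]

/-- Only finitely many terms of the semi-inner product do not vanish. -/
theorem exists_finset_support (f g : LocalFun ν) :
    ∃ T : Finset ℤ, ∀ x ∉ T, ∫ p, f p * g (shift x p) ∂annealed ν = 0 := by
  classical
  obtain ⟨Λ, hΛ⟩ := f.isLocal.cylinder
  obtain ⟨Λ', hΛ'⟩ := g.isLocal.cylinder
  refine ⟨(Λ ×ˢ Λ').image (fun q => q.1 - q.2), fun x hx => ?_⟩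
  have hint := integrable_mul_shift_right f g x
  unfold annealed at hint ⊢
  rw [integral_prod _ hint]
  refine integral_eq_zero_of_ae (Eventually.of_forall fun m => ?_)
  have hmeas : Measurable (shift (C := C) x) := by unfold shift; fun_prop
  refine integral_gibbs_mul_eq_zero (Λ := Λ) (Λ' := Λ'.image (fun z => x + z)) ?_
    (f.isLocal.measurable.comp (by fun_prop))
    (g := fun ω => g (shift x (m, ω)))
    (g.isLocal.measurable.comp (hmeas.comp (by fun_prop))) ?_ ?_ (f.isLocal.centred m)
  · rw [Finset.disjoint_left]
    intro a ha ha'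
    obtain ⟨b, hb, rfl⟩ := Finset.mem_image.1 ha'
    exact hx (Finset.mem_image.2 ⟨(x + b, b), Finset.mem_product.2 ⟨ha, hb⟩, by simp⟩)
  · exact fun ω ω' h => hΛ _ _ fun y hy => ⟨rfl, h y hy⟩
  · exact fun ω ω' h => hΛ' _ _ fun y hy =>
      ⟨rfl, h (x + y) (Finset.mem_image.2 ⟨y, hy, rfl⟩)⟩

theorem summable_semiInner (f g : LocalFun ν) :
    Summable (fun x : ℤ => ∫ p, f p * g (shift x p) ∂annealed ν) := by
  obtain ⟨T, hT⟩ := exists_finset_support f g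
  exact summable_of_ne_finset_zero hT

theorem integral_shift (x : ℤ) {F : Disorder C × Config → ℝ} (hF : Measurable F) :
    ∫ p, F (shift x p) ∂annealed ν = ∫ p, F p ∂annealed ν := by
  have h := measurePreserving_shift (ν := ν) x
  conv_rhs => rw [← h.map_eq]
  exact (integral_map h.measurable.aemeasurable hF.aestronglyMeasurable).symm

theorem integral_shift_mul_shift (f g : LocalFun ν) (x y : ℤ) :
    ∫ p, f (shift x p) * g (shift y p) ∂annealed ν
      = ∫ p, f p * g (shift (y - x) p) ∂annealed ν := by
  have hm : Measurable (shift (C := C) (y - x)) :=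
    (measurePreserving_shift (ν := ν) (y - x)).measurable
  rw [← integral_shift x (F := fun p => f p * g (shift (y - x) p))
    (f.isLocal.measurable.mul (g.isLocal.measurable.comp hm))]
  simp only [shift_shift, sub_add_cancel]

theorem semiInner_comm (f g : LocalFun ν) : semiInner f g = semiInner g f := by
  unfold semiInner
  rw [← (Equiv.neg ℤ).tsum_eq]
  refine tsum_congr fun x => ?_
  have h := integral_shift_mul_shift f g x 0
  have h0 : ∀ p : Disorder C × Config, shift 0 p = p := fun p => by simp [shift]
  simp only [h0, zero_sub] at h
  rw [Equiv.neg_apply, ← h]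
  simp only [mul_comm]

theorem semiInner_add_left (f g h : LocalFun ν) :
    semiInner (f + g) h = semiInner f h + semiInner g h := by
  unfold semiInner
  rw [← (summable_semiInner f h).tsum_add (summable_semiInner g h)]
  refine tsum_congr fun x => ?_
  rw [← integral_add (integrable_mul_shift_right f h x) (integrable_mul_shift_right g h x)]
  refine integral_congr_ae (Eventually.of_forall fun p => ?_)
  exact add_mul (f p) (g p) (h (shift x p))

theorem semiInner_smul_left (c : ℝ) (f g : LocalFun ν) :
    semiInner (c • f) g = c * semiInner f g := by
  unfold semiInner
  rw [← tsum_mul_left]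
  refine tsum_congr fun x => ?_
  rw [← integral_const_mul]
  refine integral_congr_ae (Eventually.of_forall fun p => ?_)
  exact mul_assoc c (f p) (g (shift x p))

theorem card_filter_le (N : ℕ) (x : ℤ) :
    (((Finset.range N).filter
      (fun i : ℕ => ¬ (0 ≤ (i : ℤ) + x ∧ (i : ℤ) + x < N))).card : ℝ) ≤ |(x : ℝ)| := by
  have h : ((Finset.range N).filter
      (fun i : ℕ => ¬ (0 ≤ (i : ℤ) + x ∧ (i : ℤ) + x < N))).card ≤ x.natAbs := by
    rcases le_total 0 x with hx | hx
    · calc _ ≤ (Finset.Ico (N - x.natAbs) N).card := by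
            refine Finset.card_le_card fun i hi => ?_
            simp only [Finset.mem_filter, Finset.mem_range, Finset.mem_Ico] at hi ⊢
            omega
        _ ≤ x.natAbs := by simp only [Nat.card_Ico]; omega
    · calc _ ≤ (Finset.range x.natAbs).card := by
            refine Finset.card_le_card fun i hi => ?_
            simp only [Finset.mem_filter, Finset.mem_range] at hi ⊢
            omega
        _ = x.natAbs := by simp
  have h2 : (x.natAbs : ℝ) = |(x : ℝ)| := by
    rw [← Int.cast_natCast, Int.natCast_natAbs, Int.cast_abs]
  rw [← h2]
  exact_mod_cast h

/-- Positivity: `N ≪f,f≫ = E[(∑_{i<N} τ_i f)²] + O(1)`. -/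
theorem semiInner_self_nonneg (f : LocalFun ν) : 0 ≤ semiInner f f := by
  classical
  obtain ⟨T, hT⟩ := exists_finset_support f f
  set c : ℤ → ℝ := fun x => ∫ p, f p * f (shift x p) ∂annealed ν with hc
  have hS : semiInner f f = ∑ x ∈ T, c x := tsum_eq_sum (fun x hx => hT x hx)
  set K : ℝ := ∑ x ∈ T, |c x| * |(x : ℝ)| with hK
  have key : ∀ N : ℕ, 0 ≤ N * semiInner f f + K := by
    intro N
    have hsq : 0 ≤ ∑ i ∈ Finset.range N, ∑ j ∈ Finset.range N, c ((j : ℤ) - i) := by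
      have h1 : ∑ i ∈ Finset.range N, ∑ j ∈ Finset.range N, c ((j : ℤ) - i)
          = ∫ p, (∑ i ∈ Finset.range N, f (shift (i : ℤ) p)) *
              (∑ j ∈ Finset.range N, f (shift (j : ℤ) p)) ∂annealed ν := by
        simp only [Finset.sum_mul_sum]
        rw [integral_finsetSum (Finset.range N) (f := fun (i : ℕ) p => ∑ j ∈ Finset.range N,
          f (shift (i : ℤ) p) * f (shift (j : ℤ) p)) fun i _ => integrable_finsetSum _ fun j _ =>
          integrable_mul_shift f f i j]
        refine Finset.sum_congr rfl fun i _ => ?_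
        rw [integral_finsetSum (Finset.range N) (f := fun (j : ℕ) p =>
          f (shift (i : ℤ) p) * f (shift (j : ℤ) p)) fun j _ => integrable_mul_shift f f i j]
        exact Finset.sum_congr rfl fun j _ => (integral_shift_mul_shift f f i j).symm
      rw [h1]
      exact integral_nonneg fun p => mul_self_nonneg _
    have hin : ∀ i ∈ Finset.range N, ∑ j ∈ Finset.range N, c ((j : ℤ) - i)
        = ∑ x ∈ T, if 0 ≤ (i : ℤ) + x ∧ (i : ℤ) + x < N then c x else 0 := by
      intro i _
      rw [← Finset.sum_filter]
      refine Finset.sum_bij_ne_zero (fun j _ _ => (j : ℤ) - i) ?_ ?_ ?_ ?_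
      · intro j hj hne
        rw [Finset.mem_range] at hj
        refine Finset.mem_filter.2 ⟨?_, by omega⟩
        by_contra hx
        exact hne (hT _ hx)
      · intro j _ _ j' _ _ h
        omega
      · intro x hx hne
        obtain ⟨hxT, hx0, hxN⟩ := Finset.mem_filter.1 hx
        have he : (((i : ℤ) + x).toNat : ℤ) - i = x := by omega
        refine ⟨((i : ℤ) + x).toNat, Finset.mem_range.2 (by omega), ?_, he⟩
        rw [he]
        exact hne
      · intro j _ _
        rfl
    rw [Finset.sum_congr rfl hin, Finset.sum_comm] at hsq
    have hb : ∀ x ∈ T, (∑ i ∈ Finset.range N,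
        if 0 ≤ (i : ℤ) + x ∧ (i : ℤ) + x < N then c x else 0) ≤ N * c x + |c x| * |(x : ℝ)| := by
      intro x _
      have hsplit : (∑ i ∈ Finset.range N,
          if 0 ≤ (i : ℤ) + x ∧ (i : ℤ) + x < N then c x else 0)
          = N * c x - (((Finset.range N).filter
            (fun i : ℕ => ¬ (0 ≤ (i : ℤ) + x ∧ (i : ℤ) + x < N))).card : ℝ) * c x := by
        have h := Finset.sum_filter_add_sum_filter_not (Finset.range N)
          (fun i : ℕ => 0 ≤ (i : ℤ) + x ∧ (i : ℤ) + x < N) (fun _ => c x)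
        rw [← Finset.sum_filter, eq_sub_iff_add_eq]
        simpa only [Finset.sum_const, nsmul_eq_mul, Finset.card_range] using h
      rw [hsplit]
      have h1 := card_filter_le N x
      have h2 := neg_abs_le (c x)
      have h3 := abs_nonneg (c x)
      have h4 : (0 : ℝ) ≤ ((Finset.range N).filter
            (fun i : ℕ => ¬ (0 ≤ (i : ℤ) + x ∧ (i : ℤ) + x < N))).card := Nat.cast_nonneg _
      nlinarith
    have := hsq.trans (Finset.sum_le_sum hb)
    rwa [Finset.sum_add_distrib, ← Finset.mul_sum, ← hS] at this
  by_contra hneg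
  push Not at hneg
  obtain ⟨N, hN⟩ := exists_nat_gt (K / (-semiInner f f))
  have h1 := key N
  rw [div_lt_iff₀ (by linarith)] at hN
  linarith

variable (ν)

/-- The semi-inner product as a pre-inner-product structure. -/
@[reducible] def semiInnerCore : PreInnerProductSpace.Core ℝ (LocalFun ν) where
  inner := semiInner
  conj_inner_symm f g := by simpa using semiInner_comm g f
  re_inner_nonneg f := by simpa using semiInner_self_nonneg f
  add_left := semiInner_add_left
  smul_left f g c := by simpa using semiInner_smul_left c f g

instance : SeminormedAddCommGroup (LocalFun ν) :=
  @InnerProductSpace.Core.toSeminormedAddCommGroup ℝ (LocalFun ν) _ _ _ (semiInnerCore ν)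

instance : InnerProductSpace ℝ (LocalFun ν) := InnerProductSpace.ofCore (semiInnerCore ν)

/-- The Hilbert space `𝐋²_⋆` generated by the local functions and the semi-inner product. -/
abbrev L2star : Type := UniformSpace.Completion (LocalFun ν)

variable {ν}

theorem inner_eq_semiInner (f g : LocalFun ν) :
    inner ℝ (f : L2star ν) (g : L2star ν) = ∑' x : ℤ, ∫ p, f p * g (shift x p) ∂annealed ν :=
  UniformSpace.Completion.inner_coe f g

end Space

section Generator

/-- The antisymmetric part of the generator (for cylinder functions, all but finitely many terms
of the sum vanish). -/
def genA (f : Disorder C × Config → ℝ) (p : Disorder C × Config) : ℝ :=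
  ∑ᶠ x : ℤ, (p.2 (x + 1) / √((p.1 x : ℝ) * (p.1 (x + 1) : ℝ))
      - p.2 (x - 1) / √((p.1 (x - 1) : ℝ) * (p.1 x : ℝ)))
    * deriv (fun t : ℝ => f (p.1, Function.update p.2 x t)) (p.2 x)

/-- The generator of the flip noise. -/
def genFlip (f : Disorder C × Config → ℝ) (p : Disorder C × Config) : ℝ :=
  ∑ᶠ x : ℤ, (f (p.1, flip x p.2) - f p)

/-- The generator of the exchange noise. -/
def genExch (f : Disorder C × Config → ℝ) (p : Disorder C × Config) : ℝ :=
  ∑ᶠ x : ℤ, (f (p.1, exch x p.2) - f p)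

/-- The total generator, with flip intensity `γ` and exchange intensity `lam`. -/
def gen (lam γ : ℝ) (f : Disorder C × Config → ℝ) (p : Disorder C × Config) : ℝ :=
  genA f p + (γ * genFlip f p + lam * genExch f p)

/-- `f` is, for each disorder, a continuously differentiable function of finitely many `ω_x`. -/
def IsC1 (f : Disorder C × Config → ℝ) : Prop :=
  ∃ Λ : Finset ℤ, ∀ m : Disorder C, ∃ F : (Λ → ℝ) → ℝ, ContDiff ℝ 1 F ∧
    ∀ ω : Config, f (m, ω) = F (fun x => ω x)

variable (ν : Measure (Set.Icc C⁻¹ C)) [IsProbabilityMeasure ν]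

/-- `g = 𝓛 f`, with `f` a continuously differentiable local function and `g` a local function. -/
def IsGen (lam γ : ℝ) (f g : LocalFun ν) : Prop :=
  IsC1 f.toFun ∧ ∀ p, g p = gen lam γ f.toFun p

/-- The graph of the generator in `𝐋²_⋆`: the closure of the graph of `𝓛` on smooth local
functions. -/
def genGraph (lam γ : ℝ) : Set (L2star ν × L2star ν) :=
  closure {q | ∃ f g : LocalFun ν, IsGen ν lam γ f g ∧ q = ((f : L2star ν), (g : L2star ν))}

end Generator

section Current

/-- The antisymmetric energy current `j_{0,1}^A` through the bond `{0, 1}`. -/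
def currentFun (p : Disorder C × Config) : ℝ :=
  2 * p.2 0 * p.2 1 / √((p.1 0 : ℝ) * (p.1 1 : ℝ))

theorem memLp_eval_gibbs (x : ℤ) (r : ℝ≥0∞) (hr : r ≠ ∞) :
    MemLp (fun ω : Config => ω x) r gibbs :=
  (memLp_id_gaussianReal' r hr).comp_measurePreserving
    (measurePreserving_eval_infinitePi (fun _ : ℤ => gaussianReal 0 1) x)

theorem memLp_mul_gibbs : MemLp (fun ω : Config => 2 * ω 0 * ω 1) 2 gibbs := by
  have : ENNReal.HolderTriple 4 4 2 := ⟨by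
    have h : (4 : ℝ≥0∞) = 2 * 2 := by norm_num
    rw [h, ENNReal.mul_inv (by norm_num) (by norm_num), ← mul_add, ENNReal.inv_two_add_inv_two,
      mul_one]⟩
  have h := ((memLp_eval_gibbs 1 4 (by norm_num)).mul
    (memLp_eval_gibbs 0 4 (by norm_num)) (r := 2)).const_mul 2
  refine h.congr_norm (by fun_prop) (Eventually.of_forall fun ω => ?_)
  simp [mul_assoc]

theorem mem_bounds (hC : 0 < C) (m : Set.Icc C⁻¹ C) : C⁻¹ ≤ (m : ℝ) ∧ 0 < (m : ℝ) :=
  ⟨m.2.1, lt_of_lt_of_le (inv_pos.2 hC) m.2.1⟩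

theorem norm_currentFun_le (hC : 0 < C) (p : Disorder C × Config) :
    ‖currentFun p‖ ≤ C * ‖2 * p.2 0 * p.2 1‖ := by
  obtain ⟨h0, h0'⟩ := mem_bounds hC (p.1 0)
  obtain ⟨h1, h1'⟩ := mem_bounds hC (p.1 1)
  have hs : C⁻¹ ≤ √((p.1 0 : ℝ) * (p.1 1 : ℝ)) := by
    refine Real.le_sqrt_of_sq_le ?_
    rw [sq]
    exact mul_le_mul h0 h1 (inv_pos.2 hC).le h0'.le
  have hs0 : 0 < √((p.1 0 : ℝ) * (p.1 1 : ℝ)) := Real.sqrt_pos.2 (mul_pos h0' h1')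
  rw [currentFun, norm_div, Real.norm_of_nonneg hs0.le, div_eq_inv_mul]
  refine mul_le_mul_of_nonneg_right ?_ (norm_nonneg _)
  exact inv_le_of_inv_le₀ hC hs

variable (ν : Measure (Set.Icc C⁻¹ C)) [IsProbabilityMeasure ν]

theorem isLocal_currentFun (hC : 0 < C) : IsLocal ν (currentFun (C := C)) := by
  have hmeas : Measurable (currentFun (C := C)) := by
    unfold currentFun
    fun_prop
  have hpair : ∀ m : Disorder C, MemLp (fun ω => currentFun (m, ω)) 2 gibbs := fun m =>
    memLp_mul_gibbs.of_le_mul (c := C) (hmeas.comp (by fun_prop)).aestronglyMeasurable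
      (Eventually.of_forall fun ω => norm_currentFun_le hC (m, ω))
  refine ⟨hmeas, ⟨{0, 1}, fun p q h => ?_⟩, fun ω => ?_, hpair, fun m => ?_, ?_⟩
  · obtain ⟨h0, h0'⟩ := h 0 (by simp)
    obtain ⟨h1, h1'⟩ := h 1 (by simp)
    simp only [currentFun, h0, h0', h1, h1']
  · unfold currentFun
    refine Continuous.div (by fun_prop) (by fun_prop) fun m => ?_
    exact (Real.sqrt_pos.2 (mul_pos (mem_bounds hC (m 0)).2 (mem_bounds hC (m 1)).2)).ne'
  · have h0 : ∫ ω : Config, ω 0 ∂gibbs = 0 := by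
      have h := measurePreserving_eval_infinitePi (fun _ : ℤ => gaussianReal 0 1) 0
      have h2 := integral_map (μ := gibbs) (f := fun t : ℝ => t) h.measurable.aemeasurable
        measurable_id.aestronglyMeasurable
      rw [gibbs, h.map_eq, integral_id_gaussianReal] at h2
      exact h2.symm
    have h := integral_gibbs_mul_eq_zero (Λ := {0}) (Λ' := {1}) (f := fun ω => ω 0)
      (g := fun ω => 2 * ω 1 / √((m 0 : ℝ) * (m 1 : ℝ))) (by simp) (by fun_prop) (by fun_prop)
      (fun ω ω' h => h 0 (by simp)) (fun ω ω' h => by simp only [h 1 (by simp)]) h0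
    rw [← h]
    refine integral_congr_ae (Eventually.of_forall fun ω => ?_)
    simp only [currentFun]
    ring
  · have h : MemLp (fun p : Disorder C × Config => 2 * p.2 0 * p.2 1) 2 (annealed ν) :=
      memLp_mul_gibbs.comp_measurePreserving measurePreserving_snd
    exact h.of_le_mul (c := C) hmeas.aestronglyMeasurable
      (Eventually.of_forall fun p => norm_currentFun_le hC p)

/-- The antisymmetric energy current as a local function. -/
def current (hC : 0 < C) : LocalFun ν :=
  show localSubmodule ν from ⟨currentFun, isLocal_currentFun ν hC⟩

/-- `h` is a solution in `𝐋²_⋆` of the resolvent equation `(z - 𝓛) h = j_{0,1}^A`. -/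
def IsResolventSolution (hC : 0 < C) (lam γ z : ℝ) (h : L2star ν) : Prop :=
  (h, z • h - (current ν hC : L2star ν)) ∈ genGraph ν lam γ

end Current

section Dynamics

variable (ν : Measure (Set.Icc C⁻¹ C)) [IsProbabilityMeasure ν]

/-- The random disorder `m` and the random evolution `ω` form an equilibrium process of the
disordered chain: its law at every time is the annealed equilibrium measure, and it solves the
martingale problem of the generator `𝓛`. -/
structure IsEquilibriumProcess (lam γ : ℝ) {S : Type*} {mS : MeasurableSpace S} (Q : Measure S)
    (ℱ : Filtration ℝ≥0 mS) (m : S → Disorder C) (ω : ℝ≥0 → S → Config) : Prop where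
  measurable_uncurry : Measurable (fun q : ℝ≥0 × S => ω q.1 q.2)
  adapted_disorder : Measurable[ℱ 0] m
  adapted : ∀ t, Measurable[ℱ t] (ω t)
  law : ∀ t, Q.map (fun s => (m s, ω t s)) = annealed ν
  martingale : ∀ f g : LocalFun ν, IsGen ν lam γ f g →
    Martingale (fun (t : ℝ≥0) s => f (m s, ω t s)
      - ∫ u in (0 : ℝ)..t, g (m s, ω u.toNNReal s)) ℱ Q

/-- `E[j(t) τ_x j(0)]` for the antisymmetric current `j` of the process. -/
def currentCorr {S : Type*} {mS : MeasurableSpace S} (Q : Measure S) (m : S → Disorder C)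
    (ω : ℝ≥0 → S → Config) (t : ℝ≥0) (x : ℤ) : ℝ :=
  ∫ s, currentFun (m s, ω t s) * currentFun (shift x (m s, ω 0 s)) ∂Q

/-- The homogenized infinite-volume Green-Kubo formula at `z`. -/
def greenKubo (lam : ℝ) {S : Type*} {mS : MeasurableSpace S} (Q : Measure S)
    (m : S → Disorder C) (ω : ℝ≥0 → S → Config) (z : ℝ) : ℝ :=
  lam + 1 / 2 * ∫ t in Set.Ioi (0 : ℝ),
    Real.exp (-z * t) * ∑' x : ℤ, currentCorr Q m ω t.toNNReal x

end Dynamics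

end DisorderedChain

end

/-! The current is a quadratic polynomial in `ω`, and the generator preserves quadratic functions:
the drift is linear in `ω` and the noise only flips signs or moves sites. Since `𝐋²_⋆` identifies a
function with its translates, a quadratic function is described there by finitely many disorder
functions `ψ_k`, the coefficient of `ω_0 ω_k` (of `ω_0² - 1` for `k = 0`), and Gaussian
orthogonality makes its squared norm `2 E[ψ_0²] + ∑_{k ≥ 1} E[ψ_k²]` (`semiInner_realize`). In these
coordinates the generator is tridiagonal in the range `k`, with entries bounded because the
conductances are at most `C`. It therefore extends to a bounded operator `L` on the closed span of
the quadratic functions, continued by zero on the orthogonal complement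
(`exists_bounded_generator`).

Existence of `h_z` is then Lax-Milgram for `z - L`. Uniqueness concerns all of `𝐋²_⋆`, so it needs
dissipativity of the whole closed graph: the Hamiltonian field is divergence free for the Gaussian
measure, hence antisymmetric (`integral_drift`, `semiInner_genA_self`), and each noise contributes
minus half a perfect square (`exists_noise_generator`).

The limit `z → 0` rests on a sector condition (`exists_sector_bounds`). Flips give the gap `4γ` on
all ranges `k ≥ 1`; on range `0` only the exchange noise acts, and it controls the disorder gradient
`ψ_0 - τ_1 ψ_0`. This suffices, because the Hamiltonian part also sees `ψ_0` only through that
gradient (`norm_up_zero_le`), and because the current has range one. Thus the form of `L` and the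
functional `⟨j, ·⟩` are both bounded by the Dirichlet form, and `⟨j, h_z⟩` is Cauchy as `z → 0`
(`exists_tendsto_resolvent`). Pairing the resolvent equation with `h_z` shows `⟨j, h_z⟩ ≥ 0`, whence
the lower bound `lam`.

For an equilibrium process, the martingale problem applied to `j, 𝓛 j, 𝓛² j, …` yields a hierarchy
of integral equations for correlations with the initial state. All these functions are quadratic
with coefficients growing geometrically, so Taylor's formula expresses each correlation by
equilibrium moments (`hasSum_currentCorr`). Summing over `x`, with absolute convergence, gives `⟨j,
e^{tL} j⟩` (`hasSum_tsum_currentCorr`), whose Laplace transform is `⟨j, h_z⟩`. -/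

set_option linter.unusedSectionVars false

noncomputable section

/-! ### Bounded dissipative operators: resolvent, sector condition, semigroup. -/

section FunctionalAnalysis

/-- A bounded functional on a pre-Hilbert space is represented by a vector of the completion. -/
theorem exists_completion_riesz {E : Type*} [SeminormedAddCommGroup E] [InnerProductSpace ℝ E]
    (φ : E →ₗ[ℝ] ℝ) {c : ℝ} (hc : 0 ≤ c) (hφ : ∀ v, |φ v| ≤ c * ‖v‖) :
    ∃ g : UniformSpace.Completion E, (∀ f : E, inner ℝ g (f : UniformSpace.Completion E) = φ f) ∧
      ‖g‖ ≤ c := by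
  let ψ : E →L[ℝ] ℝ := φ.mkContinuous c hφ
  let i : E →L[ℝ] UniformSpace.Completion E := UniformSpace.Completion.toComplL
  have hd : DenseRange i := UniformSpace.Completion.denseRange_coe
  have hi : IsUniformInducing i := UniformSpace.Completion.isUniformInducing_coe E
  let Ψ : UniformSpace.Completion E →L[ℝ] ℝ := ψ.extend i
  have hΨ : ∀ f : E, Ψ (f : UniformSpace.Completion E) = φ f := fun f => ψ.extend_eq hd hi f
  have h1 : ∀ f : E, inner ℝ ((InnerProductSpace.toDual ℝ (UniformSpace.Completion E)).symm Ψ)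
      (f : UniformSpace.Completion E) = φ f := fun f => by
    rw [InnerProductSpace.toDual_symm_apply, hΨ]
  refine ⟨_, h1, ?_⟩
  rw [LinearIsometryEquiv.norm_map]
  refine ContinuousLinearMap.opNorm_le_bound _ hc fun w => ?_
  induction w using UniformSpace.Completion.induction_on with
  | hp => exact isClosed_le (by fun_prop) (by fun_prop)
  | ih f => simpa [hΨ] using hφ f

/-- If a bilinear form is controlled by its own quadratic form (sector condition), then every
functional controlled by the quadratic form is approximately represented. -/
theorem exists_energy_approx {E : Type*} [AddCommGroup E] [Module ℝ E] (s b : E →ₗ[ℝ] E →ₗ[ℝ] ℝ)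
    (hs : ∀ u v, s u v = s v u) (hs0 : ∀ v, 0 ≤ s v v) (hb : ∀ v, b v v = s v v) {K : ℝ}
    (hK : 0 ≤ K) (hsec : ∀ u v, (b u v) ^ 2 ≤ K * s u u * s v v) (l : E →ₗ[ℝ] ℝ)
    (hl : ∀ v, (l v) ^ 2 ≤ K * s v v) {ε : ℝ} (hε : 0 < ε) :
    ∃ v, ∀ f, |l f - b v f| ≤ ε * √(s f f) := by
  let core : PreInnerProductSpace.Core ℝ E :=
    { inner := fun u v => s u v
      conj_inner_symm := fun u v => by simpa using hs v u
      re_inner_nonneg := fun v => by simpa using hs0 v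
      add_left := fun u v w => by simp
      smul_left := fun u v c => by simp }
  let _ : SeminormedAddCommGroup E :=
    @InnerProductSpace.Core.toSeminormedAddCommGroup ℝ E _ _ _ core
  let _ : InnerProductSpace ℝ E := InnerProductSpace.ofCore core
  have hin : ∀ u v : E, inner ℝ u v = s u v := fun _ _ => rfl
  have hnorm : ∀ u : E, ‖u‖ = √(s u u) := fun u => by
    rw [norm_eq_sqrt_real_inner, hin]
  have hnsq : ∀ u : E, s u u = ‖u‖ ^ 2 := fun u => by
    rw [hnorm, Real.sq_sqrt (hs0 u)]
  set c := √K with hc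
  have hc0 : 0 ≤ c := Real.sqrt_nonneg _
  have hcK : c ^ 2 = K := Real.sq_sqrt hK
  have hbv : ∀ u v : E, |b u v| ≤ c * ‖u‖ * ‖v‖ := fun u v => by
    refine abs_le_of_sq_le_sq ?_ (by positivity)
    rw [mul_pow, mul_pow, hcK, ← hnsq, ← hnsq]
    exact hsec u v
  have hlv : ∀ v : E, |l v| ≤ c * ‖v‖ := fun v => by
    refine abs_le_of_sq_le_sq ?_ (by positivity)
    rw [mul_pow, hcK, ← hnsq]
    exact hl v
  let Y : Submodule ℝ (UniformSpace.Completion E) :=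
    { carrier := {w | ∃ v : E, ∀ f : E, inner ℝ w (f : UniformSpace.Completion E) = b v f}
      zero_mem' := ⟨0, fun f => by simp⟩
      add_mem' := by
        rintro w w' ⟨v, hv⟩ ⟨v', hv'⟩
        exact ⟨v + v', fun f => by rw [inner_add_left, hv, hv']; simp⟩
      smul_mem' := by
        rintro r w ⟨v, hv⟩
        exact ⟨r • v, fun f => by rw [real_inner_smul_left, hv]; simp⟩ }
  -- The representers of the functionals `b v` are dense. If `w` is orthogonal to all of them, then
  -- `‖v‖² = b v v` equals minus the pairing of the representer with `w - v`, so `‖v‖ ≤ c ‖w - v‖`;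
  -- letting `v` approach `w` forces `w = 0`.
  have hY : Y.topologicalClosure = ⊤ := by
    rw [Submodule.topologicalClosure_eq_top_iff, Submodule.eq_bot_iff]
    intro w hw
    by_contra hne
    have hpos : 0 < ‖w‖ := norm_pos_iff.2 hne
    have key : ∀ v : E, ‖v‖ ≤ c * ‖w - (v : UniformSpace.Completion E)‖ := by
      intro v
      obtain ⟨y, hy, hyn⟩ := exists_completion_riesz (b v) (c := c * ‖v‖) (by positivity)
        (fun f => hbv v f)
      have h0 : inner ℝ y w = 0 := Submodule.inner_right_of_mem_orthogonal
        (show y ∈ Y from ⟨v, hy⟩) hw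
      have h1 : ‖v‖ ^ 2 = - inner ℝ y (w - (v : UniformSpace.Completion E)) := by
        rw [inner_sub_right, h0, hy, hb, hnsq]
        ring
      have h2 := abs_real_inner_le_norm y (w - (v : UniformSpace.Completion E))
      have h3 : ‖v‖ ^ 2 ≤ c * ‖v‖ * ‖w - (v : UniformSpace.Completion E)‖ := by
        rw [h1]
        exact (neg_le_abs _).trans (h2.trans (by gcongr))
      rcases (norm_nonneg v).eq_or_lt with h | h
      · rw [← h]; positivity
      · nlinarith
    -- The radius is chosen so that `‖w‖ ≤ (c + 1) ‖w - v‖ < ‖w‖ / 2`, a contradiction.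
    obtain ⟨v, hv⟩ := Metric.denseRange_iff.1
      (UniformSpace.Completion.denseRange_coe (α := E)) w (‖w‖ / (2 * (c + 1))) (by positivity)
    rw [dist_eq_norm] at hv
    have h1 := key v
    have h2 : ‖w‖ ≤ ‖w - (v : UniformSpace.Completion E)‖ + ‖v‖ := by
      have := norm_add_le (w - (v : UniformSpace.Completion E)) (v : UniformSpace.Completion E)
      simpa using this
    rw [lt_div_iff₀ (by positivity)] at hv
    nlinarith [norm_nonneg (w - (v : UniformSpace.Completion E))]
  obtain ⟨g, hg, -⟩ := exists_completion_riesz l hc0 hlv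
  have hgY : g ∈ closure (Y : Set (UniformSpace.Completion E)) := by
    rw [← Submodule.topologicalClosure_coe, hY]
    trivial
  obtain ⟨y, ⟨v, hv⟩, hy⟩ := Metric.mem_closure_iff.1 hgY ε hε
  refine ⟨v, fun f => ?_⟩
  rw [← hg, ← hv, ← inner_sub_left, ← hnorm]
  refine (abs_real_inner_le_norm _ _).trans ?_
  rw [UniformSpace.Completion.norm_coe]
  rw [dist_eq_norm] at hy
  gcongr

variable {V : Type*} [NormedAddCommGroup V] [InnerProductSpace ℝ V]

/-- Uniqueness for the resolvent equation of a dissipative operator. -/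
theorem resolvent_unique (L : V →L[ℝ] V) (hL : ∀ u, inner ℝ (L u) u ≤ 0) {z : ℝ} (hz : 0 < z)
    {h h' : V} (e : z • h - L h = z • h' - L h') : h = h' := by
  have h1 : z • (h - h') = L (h - h') := by
    rw [map_sub, smul_sub]
    exact sub_eq_sub_iff_sub_eq_sub.1 e
  have h2 := hL (h - h')
  rw [← h1, real_inner_smul_left, real_inner_self_eq_norm_sq] at h2
  have h3 : ‖h - h'‖ ^ 2 ≤ 0 := nonpos_of_mul_nonpos_right h2 hz
  have h4 : ‖h - h'‖ = 0 := by nlinarith [norm_nonneg (h - h')]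
  exact sub_eq_zero.1 (norm_eq_zero.1 h4)

variable [CompleteSpace V]

/-- A bounded dissipative operator has a resolvent on the positive half line. -/
theorem exists_resolvent (L : V →L[ℝ] V) (hL : ∀ u, inner ℝ (L u) u ≤ 0) {z : ℝ} (hz : 0 < z)
    (j : V) : ∃ h, z • h - L h = j := by
  let T : V →L[ℝ] V := z • ContinuousLinearMap.id ℝ V - L
  let B : V →L[ℝ] V →L[ℝ] ℝ := (innerSL ℝ).comp T
  have hB : ∀ u v, B u v = inner ℝ (z • u - L u) v := fun _ _ => rfl
  -- Lax-Milgram: dissipativity makes the form of `z - L` coercive with constant `z`.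
  have hco : IsCoercive B := ⟨z, hz, fun u => by
    rw [hB, inner_sub_left, real_inner_smul_left, real_inner_self_eq_norm_sq]
    nlinarith [hL u]⟩
  refine ⟨hco.continuousLinearEquivOfBilin.symm j, ?_⟩
  refine ext_inner_right ℝ fun w => ?_
  rw [← hB, ← hco.continuousLinearEquivOfBilin_apply, ContinuousLinearEquiv.apply_symm_apply]

/-- Under the sector condition, `⟨j, (z - L)⁻¹ j⟩` converges as `z → 0` for `j` in the dual of the
energy space. -/
theorem exists_tendsto_resolvent (L : V →L[ℝ] V) (hL : ∀ u, inner ℝ (L u) u ≤ 0) {K : ℝ}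
    (hK : 0 ≤ K) (hsec : ∀ u v, (inner ℝ (L u) v) ^ 2 ≤ K * (-inner ℝ (L u) u) * (-inner ℝ (L v) v))
    {j : V} (hj : ∀ v, (inner ℝ j v) ^ 2 ≤ K * (-inner ℝ (L v) v)) (h : ℝ → V)
    (hh : ∀ z, 0 < z → z • h z - L (h z) = j) :
    ∃ D : ℝ, 0 ≤ D ∧ Tendsto (fun z => inner ℝ j (h z)) (𝓝[>] 0) (𝓝 D) := by
  have hpos : ∀ z, 0 < z → 0 ≤ inner ℝ j (h z) := fun z hz => by
    conv_rhs => rw [← hh z hz]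
    simp only [inner_sub_left, real_inner_smul_left, real_inner_self_eq_norm_sq]
    nlinarith [hL (h z), sq_nonneg ‖h z‖]
  have happ : ∀ ε : ℝ, 0 < ε → ∃ a : ℝ, ∃ N : ℝ, 0 ≤ N ∧ ∀ z, 0 < z →
      |inner ℝ j (h z) - a| ≤ √K * (ε + √z * N) := by
    intro ε hε
    let b : V →ₗ[ℝ] V →ₗ[ℝ] ℝ := -((innerₗ V).comp L.toLinearMap)
    have hb : ∀ u v, b u v = -inner ℝ (L u) v := fun _ _ => rfl
    -- The symmetric part of `-L` serves as energy inner product; on the diagonal it agrees with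
    -- `b`.
    let s : V →ₗ[ℝ] V →ₗ[ℝ] ℝ := (1 / 2 : ℝ) • (b + b.flip)
    have hs : ∀ u v, s u v = 1 / 2 * (b u v + b v u) := fun _ _ => rfl
    have hss : ∀ v, s v v = -inner ℝ (L v) v := fun v => by rw [hs, hb]; ring
    obtain ⟨v, hv⟩ := exists_energy_approx s b (fun u v => by rw [hs, hs]; ring)
      (fun v => by rw [hss]; linarith [hL v]) (fun v => by rw [hss, hb]) hK
      (fun u v => by rw [hss, hss, hb, neg_sq]; exact hsec u v) (innerₗ V j)
      (fun v => by rw [hss]; exact hj v) hε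
    refine ⟨inner ℝ j v, ‖v‖, norm_nonneg _, fun z hz => ?_⟩
    obtain ⟨r, hr⟩ := exists_resolvent L hL hz (j + L v)
    obtain ⟨w, hw⟩ := exists_resolvent L hL hz (z • v)
    -- With `v` independent of `z` and `-L v` close to `j` in the dual energy norm, `h z` splits
    -- into `v`, the response `r` to the error `j + L v`, and the response `w` to `z • v`. Both
    -- responses have small energy, and `⟨j, ·⟩` is bounded by the energy, so `⟨j, h z⟩` stays near
    -- `⟨j, v⟩`.
    have e : h z = r + v - w := by
      refine resolvent_unique L hL hz ?_
      rw [hh z hz]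
      simp only [map_add, map_sub, smul_add, smul_sub]
      have e1 : j = (z • r - L r) - L v := by rw [hr]; abel
      rw [e1, ← hw]
      abel
    have hrN : √(-inner ℝ (L r) r) ≤ ε := by
      have h1 := hv r
      rw [hss] at h1
      set q := √(-inner ℝ (L r) r) with hq
      have hqq : q ^ 2 = -inner ℝ (L r) r := Real.sq_sqrt (by linarith [hL r])
      have h2 : inner ℝ (z • r - L r) r = inner ℝ (j + L v) r := by rw [hr]
      rw [inner_sub_left, real_inner_smul_left, real_inner_self_eq_norm_sq] at h2
      have h3 : (innerₗ V j) r - b v r = inner ℝ (j + L v) r := by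
        rw [hb, inner_add_left, sub_neg_eq_add]; rfl
      rw [h3] at h1
      have h4 := (le_abs_self _).trans h1
      have h5 : q ^ 2 ≤ ε * q := by nlinarith [mul_nonneg hz.le (sq_nonneg ‖r‖)]
      by_contra hlt
      push Not at hlt
      nlinarith
    -- The energy identity gives `z‖w‖² - ⟨L w, w⟩ = z⟨v, w⟩ ≤ z‖v‖‖w‖`, and the term `z‖w‖²`
    -- absorbs `‖w‖`.
    have hwN : √(-inner ℝ (L w) w) ≤ √z * ‖v‖ := by
      rw [← Real.sqrt_sq (norm_nonneg v), ← Real.sqrt_mul hz.le]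
      refine Real.sqrt_le_sqrt ?_
      have h2 : inner ℝ (z • w - L w) w = inner ℝ (z • v) w := by rw [hw]
      rw [inner_sub_left, real_inner_smul_left, real_inner_smul_left,
        real_inner_self_eq_norm_sq] at h2
      have h3 := real_inner_le_norm v w
      have h4 : z * inner ℝ v w ≤ z * (‖v‖ * ‖w‖) := by gcongr
      nlinarith [mul_nonneg hz.le (sq_nonneg (‖v‖ - ‖w‖)), mul_nonneg hz.le (sq_nonneg ‖v‖),
        mul_nonneg hz.le (sq_nonneg ‖w‖)]
    have hjv : ∀ u, |inner ℝ j u| ≤ √K * √(-inner ℝ (L u) u) := fun u => by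
      rw [← Real.sqrt_mul hK]
      exact Real.abs_le_sqrt (hj u)
    have e2 : inner ℝ j (h z) - inner ℝ j v = inner ℝ j r - inner ℝ j w := by
      rw [e, inner_sub_right, inner_add_right]; ring
    rw [e2, mul_add]
    refine (abs_sub _ _).trans (add_le_add ((hjv r).trans ?_) ((hjv w).trans ?_)) <;> gcongr
  have hC : Cauchy (map (fun z => (inner ℝ j (h z) : ℝ)) (𝓝[>] 0)) := by
    rw [Metric.cauchy_iff]
    refine ⟨inferInstance, fun ε hε => ?_⟩
    -- This choice makes the error bound at `z = 0` less than `ε / 2`, also when `K = 0`; two values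
    -- near `0` then differ by less than `ε`.
    obtain ⟨a, N, hN, ha⟩ := happ (ε / (4 * (√K + 1))) (by positivity)
    have ht : Tendsto (fun z : ℝ => √K * (ε / (4 * (√K + 1)) + √z * N)) (𝓝[>] 0)
        (𝓝 (√K * (ε / (4 * (√K + 1)) + √0 * N))) := by
      refine Tendsto.mono_left ?_ nhdsWithin_le_nhds
      exact Continuous.tendsto (by fun_prop) 0
    have hlt : √K * (ε / (4 * (√K + 1)) + √0 * N) < ε / 2 := by
      rw [Real.sqrt_zero, zero_mul, add_zero, ← mul_div_assoc, div_lt_iff₀ (by positivity)]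
      nlinarith [Real.sqrt_nonneg K]
    have hev := (ht.eventually (gt_mem_nhds hlt)).and self_mem_nhdsWithin
    refine ⟨_, image_mem_map hev, ?_⟩
    rintro _ ⟨z, ⟨hz, hz0⟩, rfl⟩ _ ⟨z', ⟨hz', hz0'⟩, rfl⟩
    have h1 := ha z hz0
    have h2 := ha z' hz0'
    rw [Real.dist_eq]
    have h3 := abs_sub_le (inner ℝ j (h z)) a (inner ℝ j (h z'))
    rw [abs_sub_comm a] at h3
    linarith
  obtain ⟨D, hD⟩ := CompleteSpace.complete hC
  exact ⟨D, ge_of_tendsto hD (by filter_upwards [self_mem_nhdsWithin] with z hz using hpos z hz), hD⟩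

/-- The semigroup of a bounded dissipative operator is contractive. -/
theorem norm_exp_smul_apply_le (L : V →L[ℝ] V) (hL : ∀ u, inner ℝ (L u) u ≤ 0) (u : V) {t : ℝ}
    (ht : 0 ≤ t) : ‖NormedSpace.exp (t • L) u‖ ≤ ‖u‖ := by
  have hd : ∀ t : ℝ, HasDerivAt (fun t : ℝ => NormedSpace.exp (t • L) u)
      (L (NormedSpace.exp (t • L) u)) t := fun t =>
    (hasDerivAt_exp_smul_const' (𝕂 := ℝ) L t).clm_apply (hasDerivAt_const t u) |>.congr_deriv
      (by simp)
  -- The derivative of the squared norm along the flow is twice the nonpositive quadratic form of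
  -- `L`.
  have hanti : AntitoneOn (fun t : ℝ => ‖NormedSpace.exp (t • L) u‖ ^ 2) (Set.Ici 0) := by
    have hd2 := fun t => (hd t).norm_sq
    refine antitoneOn_of_deriv_nonpos (convex_Ici 0)
      (fun t _ => (hd2 t).continuousAt.continuousWithinAt)
      (fun t _ => (hd2 t).differentiableAt.differentiableWithinAt) fun t _ => ?_
    rw [(hd2 t).deriv, real_inner_comm]
    linarith [hL (NormedSpace.exp (t • L) u)]
  have := hanti (Set.mem_Ici.2 le_rfl) (Set.mem_Ici.2 ht) ht
  simp only [zero_smul, NormedSpace.exp_zero, one_apply_eq_self] at this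
  exact (sq_le_sq₀ (norm_nonneg _) (norm_nonneg _)).1 this

theorem continuous_exp_smul_apply (L : V →L[ℝ] V) (u : V) :
    Continuous (fun t : ℝ => NormedSpace.exp (t • L) u) :=
  continuous_iff_continuousAt.2 fun t =>
    ((hasDerivAt_exp_smul_const' (𝕂 := ℝ) L t).clm_apply (hasDerivAt_const t u)).continuousAt

/-- The Laplace transform of the semigroup of a bounded dissipative operator is its resolvent. -/
theorem laplace_exp_smul (L : V →L[ℝ] V) (hL : ∀ u, inner ℝ (L u) u ≤ 0) {z : ℝ} (hz : 0 < z)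
    {j h : V} (hh : z • h - L h = j) (g : V) :
    IntegrableOn (fun t : ℝ => Real.exp (-z * t) * inner ℝ g (NormedSpace.exp (t • L) j))
      (Set.Ioi 0) ∧
    ∫ t in Set.Ioi (0 : ℝ), Real.exp (-z * t) * inner ℝ g (NormedSpace.exp (t • L) j)
      = inner ℝ g h := by
  have hexp := exp_neg_integrableOn_Ioi 0 hz
  have hint : IntegrableOn
      (fun t : ℝ => Real.exp (-z * t) * inner ℝ g (NormedSpace.exp (t • L) j)) (Set.Ioi 0) := by
    refine Integrable.mono' (hexp.mul_const (‖g‖ * ‖j‖)) ?_ ?_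
    · have := continuous_exp_smul_apply L j
      exact (by fun_prop : Continuous fun t : ℝ =>
        Real.exp (-z * t) * inner ℝ g (NormedSpace.exp (t • L) j)).aestronglyMeasurable
    · refine (ae_restrict_iff' measurableSet_Ioi).2 (Eventually.of_forall fun t ht => ?_)
      rw [norm_mul, Real.norm_of_nonneg (Real.exp_pos _).le]
      gcongr
      refine (norm_inner_le_norm _ _).trans ?_
      gcongr
      exact norm_exp_smul_apply_le L hL j (le_of_lt ht)
  refine ⟨hint, ?_⟩
  -- An explicit antiderivative: `j = z • h - L h` turns the integrand into a total derivative.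
  have hder : ∀ t : ℝ, HasDerivAt
      (fun t : ℝ => -(Real.exp (-z * t) * inner ℝ g (NormedSpace.exp (t • L) h)))
      (Real.exp (-z * t) * inner ℝ g (NormedSpace.exp (t • L) j)) t := by
    intro t
    have h1 : HasDerivAt (fun t : ℝ => NormedSpace.exp (t • L) h)
        (NormedSpace.exp (t • L) (L h)) t :=
      (hasDerivAt_exp_smul_const (𝕂 := ℝ) L t).clm_apply (hasDerivAt_const t h) |>.congr_deriv
        (by simp)
    have h2 : HasDerivAt (fun t : ℝ => Real.exp (-z * t)) (Real.exp (-z * t) * (-z)) t := by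
      have := ((hasDerivAt_id t).const_mul (-z)).exp
      simpa using this
    have h3 := (h2.mul ((hasDerivAt_const t g).inner ℝ h1)).neg
    refine h3.congr_deriv ?_
    have e : NormedSpace.exp (t • L) j
        = z • NormedSpace.exp (t • L) h - NormedSpace.exp (t • L) (L h) := by
      rw [← hh, map_sub, map_smul]
    rw [e, inner_sub_right, real_inner_smul_right]
    simp
    ring
  have hlim : Tendsto (fun t : ℝ => -(Real.exp (-z * t) * inner ℝ g (NormedSpace.exp (t • L) h)))
      atTop (𝓝 0) := by
    rw [← neg_zero]
    refine Tendsto.neg ?_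
    have h0 : Tendsto (fun t : ℝ => Real.exp (-z * t) * (‖g‖ * ‖h‖)) atTop (𝓝 0) := by
      have : Tendsto (fun t : ℝ => Real.exp (-z * t)) atTop (𝓝 0) := by
        refine Real.tendsto_exp_atBot.comp ?_
        exact tendsto_id.const_mul_atTop_of_neg (by linarith)
      simpa using this.mul_const (‖g‖ * ‖h‖)
    refine squeeze_zero_norm' ?_ h0
    filter_upwards [eventually_ge_atTop 0] with t ht
    rw [norm_mul, Real.norm_of_nonneg (Real.exp_pos _).le]
    gcongr
    refine (norm_inner_le_norm _ _).trans ?_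
    gcongr
    exact norm_exp_smul_apply_le L hL h ht
  rw [integral_Ioi_of_hasDerivAt_of_tendsto' (fun t _ => hder t) hint hlim]
  simp

/-- A linear map given on the image of `ι` extends to a bounded operator which vanishes on the
orthogonal complement of that image, provided that the bounds of a dissipative operator hold. -/
theorem exists_bounded_extension {Q : Type*} [AddCommGroup Q] [Module ℝ Q] (ι : Q →ₗ[ℝ] V)
    (L : Q →ₗ[ℝ] Q) {M : ℝ} (hM : ∀ a, ‖ι (L a)‖ ≤ M * ‖ι a‖) :
    ∃ Lb : V →L[ℝ] V, (∀ a, Lb (ι a) = ι (L a)) ∧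
      ∀ u, ∃ u' ∈ closure (Set.range ι), (∀ w ∈ closure (Set.range ι), inner ℝ u w = inner ℝ u' w) ∧
        Lb u = Lb u' ∧ Lb u' ∈ closure (Set.range ι) := by
  let P : Submodule ℝ V := (LinearMap.range ι).topologicalClosure
  have hP : (P : Set V) = closure (Set.range ι) := by
    rw [Submodule.topologicalClosure_coe, LinearMap.coe_range]
  have : CompleteSpace P := (Submodule.isClosed_topologicalClosure _).completeSpace_coe
  let e : Q →ₗ[ℝ] P := ι.codRestrict P fun a =>
    Submodule.le_topologicalClosure _ (LinearMap.mem_range_self ι a)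
  have hd : DenseRange e := by
    rw [Metric.denseRange_iff]
    rintro ⟨x, hx⟩ r hr
    have hx' : x ∈ closure (Set.range ι) := hP ▸ hx
    obtain ⟨_, ⟨a, rfl⟩, ha⟩ := Metric.mem_closure_iff.1 hx' r hr
    exact ⟨a, ha⟩
  let Le : P →L[ℝ] P := (e.comp L).extendOfNorm e
  have hLe : ∀ a, Le (e a) = e (L a) := fun a =>
    LinearMap.extendOfNorm_eq (f := e.comp L) hd ⟨M, fun x => hM x⟩ a
  -- Projecting first means that forms of `Lb` at arbitrary vectors reduce to their projections, so
  -- inequalities need to be proved on the closed range only.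
  let Lb : V →L[ℝ] V := P.subtypeL.comp (Le.comp P.orthogonalProjectionOnto)
  have hLb : ∀ x : P, Lb x = Le x := fun x => by
    simp [Lb]
  refine ⟨Lb, fun a => ?_, fun u => ⟨P.orthogonalProjectionOnto u, hP ▸ Subtype.mem _, fun w hw => ?_,
    ?_, ?_⟩⟩
  · have := hLb (e a)
    rw [hLe] at this
    exact this
  · rw [← hP] at hw
    have h : inner ℝ (u - (P.orthogonalProjectionOnto u : V)) w = 0 :=
      Submodule.inner_left_of_mem_orthogonal hw (P.sub_starProjection_mem_orthogonal u)
    rw [inner_sub_left] at h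
    linarith
  · rw [hLb]; rfl
  · rw [hLb, ← hP]; exact Subtype.mem _

end FunctionalAnalysis

namespace DisorderedChain

/-! ### One-dimensional Gaussian integration by parts and moments. -/

section Gaussian

theorem integrable_gaussianReal_iff {f : ℝ → ℝ} :
    Integrable f (gaussianReal 0 1) ↔ Integrable (fun t => gaussianPDFReal 0 1 t * f t) := by
  rw [gaussianReal_of_var_ne_zero 0 one_ne_zero,
    integrable_withDensity_iff_integrable_smul₀' (measurable_gaussianPDF 0 1).aemeasurable
      (Eventually.of_forall fun _ => gaussianPDF_lt_top)]
  simp [toReal_gaussianPDF]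

theorem hasDerivAt_gaussianPDFReal (t : ℝ) :
    HasDerivAt (gaussianPDFReal 0 1) (-t * gaussianPDFReal 0 1 t) t := by
  have h1 : HasDerivAt (fun x : ℝ => -x ^ 2 / 2) (-t) t := by
    refine ((hasDerivAt_pow 2 t).neg.div_const 2).congr_deriv ?_
    ring
  have h2 := h1.exp.const_mul (√(2 * Real.pi))⁻¹
  refine (h2.congr_deriv ?_).congr_of_eventuallyEq (Eventually.of_forall fun x => ?_)
  · simp [gaussianPDFReal]; ring
  · simp [gaussianPDFReal]

/-- Gaussian integration by parts in one variable. -/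
theorem integral_deriv_gaussianReal {h h' : ℝ → ℝ} (hd : ∀ t, HasDerivAt h (h' t) t)
    (hi : Integrable h (gaussianReal 0 1)) (hi' : Integrable h' (gaussianReal 0 1))
    (hit : Integrable (fun t => t * h t) (gaussianReal 0 1)) :
    ∫ t, h' t ∂gaussianReal 0 1 = ∫ t, t * h t ∂gaussianReal 0 1 := by
  rw [← sub_eq_zero, ← integral_sub hi' hit,
    integral_gaussianReal_eq_integral_smul one_ne_zero]
  have h1 := integrable_gaussianReal_iff.1 hi
  have h2 := integrable_gaussianReal_iff.1 (hi'.sub hit)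
  refine integral_eq_zero_of_hasDerivAt_of_integrable (f := fun t => gaussianPDFReal 0 1 t * h t)
    (fun t => ?_) h2 h1
  refine ((hasDerivAt_gaussianPDFReal t).mul (hd t)).congr_deriv ?_
  simp
  ring

theorem integrable_pow_gaussianReal (n : ℕ) :
    Integrable (fun t : ℝ => t ^ n) (gaussianReal 0 1) := by
  have h := (memLp_id_gaussianReal (μ := 0) (v := 1) (n : ℝ≥0)).integrable_norm_pow'
  refine h.mono' (by fun_prop) (Eventually.of_forall fun t => ?_)
  simp

theorem integral_sq_gaussianReal : ∫ t, t ^ 2 ∂gaussianReal 0 1 = 1 := by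
  have h := integral_deriv_gaussianReal (h := fun t => t) (h' := fun _ => 1)
    (fun t => hasDerivAt_id t) (by simpa using integrable_pow_gaussianReal 1)
    (integrable_const _) (by simpa [sq] using integrable_pow_gaussianReal 2)
  simp only [sq]
  rw [← h]
  simp

theorem integral_pow_four_gaussianReal : ∫ t, t ^ 4 ∂gaussianReal 0 1 = 3 := by
  have h := integral_deriv_gaussianReal (h := fun t => t ^ 3) (h' := fun t => 3 * t ^ 2)
    (fun t => by simpa using hasDerivAt_pow 3 t) (integrable_pow_gaussianReal 3)
    ((integrable_pow_gaussianReal 2).const_mul 3)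
    ((integrable_pow_gaussianReal 4).congr (Eventually.of_forall fun t => by simp; ring))
  have e : ∀ t : ℝ, t ^ 4 = t * t ^ 3 := fun t => by ring
  simp only [e]
  rw [← h, integral_const_mul, integral_sq_gaussianReal, mul_one]

end Gaussian

/-! ### Symmetries of the Gibbs measure and orthogonality of quadratic monomials. -/

section Gibbs

theorem measurable_flip (x : ℤ) : Measurable (flip x) := by
  refine measurable_pi_lambda _ fun z => ?_
  by_cases hz : z = x
  · subst hz; simp [flip]; fun_prop
  · simp [flip, hz]; fun_prop

theorem flip_flip (x : ℤ) (ω : Config) : flip x (flip x ω) = ω := by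
  simp [flip]

theorem measurePreserving_flip (x : ℤ) : MeasurePreserving (flip x) gibbs gibbs := by
  refine ⟨measurable_flip x, ?_⟩
  let f : ℤ → ℝ → ℝ := fun z t => if z = x then -t else t
  have e : flip x = fun (ω : Config) z => f z (ω z) := by
    funext ω z
    by_cases hz : z = x
    · subst hz; simp [flip, f]
    · simp [flip, f, hz]
  have hf : ∀ z, Measurable (f z) := fun z => by
    by_cases hz : z = x <;> simp [f, hz] <;> fun_prop
  rw [e, gibbs, Measure.infinitePi_map_pi _ hf]
  congr 1
  funext z
  by_cases hz : z = x
  · simp only [f, hz, if_true]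
    rw [gaussianReal_map_neg, neg_zero]
  · simp only [f, hz, if_false]
    exact Measure.map_id

theorem measurable_exch (x : ℤ) : Measurable (exch x) :=
  measurable_pi_lambda _ fun _ => measurable_pi_apply _

theorem exch_exch (x : ℤ) (ω : Config) : exch x (exch x ω) = ω := by
  funext z
  simp [exch]

theorem measurePreserving_exch (x : ℤ) : MeasurePreserving (exch x) gibbs gibbs :=
  ⟨measurable_exch x, Measure.map_infinitePi_infinitePi_of_inj
    (P := fun _ : ℤ => gaussianReal 0 1) (Equiv.swap x (x + 1)).injective⟩

theorem measurable_update_prod (x : ℤ) :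
    Measurable (fun q : Config × ℝ => Function.update q.1 x q.2) := by
  refine measurable_pi_lambda _ fun z => ?_
  by_cases hz : z = x
  · subst hz; simp; fun_prop
  · simp [hz]; fun_prop

/-- Resampling one coordinate preserves the Gibbs measure. -/
theorem measurePreserving_update (x : ℤ) :
    MeasurePreserving (fun q : Config × ℝ => Function.update q.1 x q.2)
      (gibbs.prod (gaussianReal 0 1)) gibbs := by
  classical
  refine ⟨measurable_update_prod x, ?_⟩
  rw [gibbs]
  refine Measure.eq_infinitePi _ fun s t ht => ?_
  have e : (fun q : Config × ℝ => Function.update q.1 x q.2) ⁻¹' (Set.pi s t)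
      = (Set.pi (s.erase x : Finset ℤ) t) ×ˢ (if x ∈ s then t x else Set.univ) := by
    ext ⟨ω, r⟩
    simp only [Set.mem_preimage, Set.mem_pi, Set.mem_prod, Finset.coe_erase, Set.mem_sdiff,
      Finset.mem_coe, Set.mem_singleton_iff]
    constructor
    · intro h
      refine ⟨fun i hi => by simpa [hi.2] using h i hi.1, ?_⟩
      split_ifs with hx
      · simpa using h x hx
      · trivial
    · rintro ⟨h, h'⟩ i hi
      by_cases hix : i = x
      · subst hix; simpa [hi] using h'
      · simpa [hix] using h i ⟨hi, hix⟩
  rw [Measure.map_apply (measurable_update_prod x)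
    (MeasurableSet.pi s.countable_toSet fun i _ => ht i), e, Measure.prod_prod,
    Measure.infinitePi_pi _ fun i _ => ht i]
  by_cases hx : x ∈ s
  · simp only [hx, if_true]
    exact Finset.prod_erase_mul s (fun i => gaussianReal 0 1 (t i)) hx
  · simp [hx]

theorem integral_comp_gibbs {T : Config → Config} (hT : MeasurePreserving T gibbs gibbs)
    {F : Config → ℝ} (hF : Measurable F) : ∫ ω, F (T ω) ∂gibbs = ∫ ω, F ω ∂gibbs := by
  conv_rhs => rw [← hT.map_eq]
  exact (integral_map hT.measurable.aemeasurable hF.aestronglyMeasurable).symm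

/-- Parity: the flip preserves the measure, so the integral equals its own negative. This replaces
most moment computations below. -/
theorem integral_eq_zero_of_flip {F : Config → ℝ} (hF : Measurable F) (x : ℤ)
    (h : ∀ ω, F (flip x ω) = -F ω) : ∫ ω, F ω ∂gibbs = 0 := by
  have h1 := integral_comp_gibbs (measurePreserving_flip x) hF
  simp only [h, integral_neg] at h1
  linarith

theorem integral_eval_gibbs (x : ℤ) {F : ℝ → ℝ} (hF : Measurable F) :
    ∫ ω, F (ω x) ∂gibbs = ∫ t, F t ∂gaussianReal 0 1 := by
  have h := measurePreserving_eval_infinitePi (fun _ : ℤ => gaussianReal 0 1) x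
  rw [← h.map_eq, integral_map h.measurable.aemeasurable hF.aestronglyMeasurable]
  rfl

theorem memLp_two_mul {f g : Config → ℝ} (hf : MemLp f 4 gibbs) (hg : MemLp g 4 gibbs) :
    MemLp (fun ω => f ω * g ω) 2 gibbs := by
  have : ENNReal.HolderTriple 4 4 2 := ⟨by
    have h : (4 : ℝ≥0∞) = 2 * 2 := by norm_num
    rw [h, ENNReal.mul_inv (by norm_num) (by norm_num), ← mul_add, ENNReal.inv_two_add_inv_two,
      mul_one]⟩
  exact hg.mul hf

theorem memLp_eval_mul_eval (x y : ℤ) : MemLp (fun ω : Config => ω x * ω y) 2 gibbs :=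
  memLp_two_mul (memLp_eval_gibbs x 4 (by norm_num)) (memLp_eval_gibbs y 4 (by norm_num))

/-- The monomials `ω_x ω_{x+k}` for `k ≥ 1`, and `ω_x² - 1` for `k = 0`. -/
def quad (x : ℤ) (k : ℕ) (ω : Config) : ℝ := ω x * ω (x + k) - if k = 0 then 1 else 0

theorem measurable_quad (x : ℤ) (k : ℕ) : Measurable (quad x k) := by
  unfold quad
  fun_prop

theorem memLp_quad (x : ℤ) (k : ℕ) : MemLp (quad x k) 2 gibbs :=
  (memLp_eval_mul_eval x (x + k)).sub (memLp_const _)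

theorem quad_congr {x : ℤ} {k : ℕ} {ω ω' : Config} (h : ω x = ω' x)
    (h' : ω (x + k) = ω' (x + k)) : quad x k ω = quad x k ω' := by
  simp only [quad, h, h']

theorem quad_flip_of_ne {x s : ℤ} {k : ℕ} (h : x ≠ s) (h' : x + k ≠ s) (ω : Config) :
    quad x k (flip s ω) = quad x k ω :=
  quad_congr (by simp [flip, h]) (by simp [flip, h'])

theorem quad_flip_left {x : ℤ} {k : ℕ} (hk : k ≠ 0) (ω : Config) :
    quad x k (flip x ω) = -quad x k ω := by
  simp [quad, flip, hk]

theorem quad_flip_right {x : ℤ} {k : ℕ} (hk : k ≠ 0) (ω : Config) :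
    quad x k (flip (x + k) ω) = -quad x k ω := by
  have : x ≠ x + k := by omega
  simp [quad, flip, hk, this]

theorem integral_eval_sq_sub_one (x : ℤ) : ∫ ω : Config, ω x * ω x - 1 ∂gibbs = 0 := by
  rw [integral_eval_gibbs x (F := fun t => t * t - 1) (by fun_prop),
    integral_sub (by simpa [sq] using integrable_pow_gaussianReal 2) (integrable_const _)]
  have := integral_sq_gaussianReal
  simp only [sq] at this
  simp [this]

theorem integral_quad (x : ℤ) (k : ℕ) : ∫ ω, quad x k ω ∂gibbs = 0 := by
  by_cases hk : k = 0
  · subst hk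
    simpa [quad] using integral_eval_sq_sub_one x
  · exact integral_eq_zero_of_flip (measurable_quad x k) x (quad_flip_left hk)

/-- A product of two distinct sites has at least one site absent from any other monomial of the
family, and flipping that site changes the sign of the product. -/
theorem integral_quad_mul_quad_of_ne_of_pos {x y : ℤ} {k l : ℕ} (hk : k ≠ 0)
    (h : ¬ (x = y ∧ k = l)) : ∫ ω, quad x k ω * quad y l ω ∂gibbs = 0 := by
  have hm := (measurable_quad x k).mul (measurable_quad y l)
  by_cases h1 : y ≠ x ∧ y + l ≠ x
  · refine integral_eq_zero_of_flip hm x fun ω => ?_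
    simp only [quad_flip_left hk, quad_flip_of_ne h1.1 h1.2]
    ring
  · have h2 : y ≠ x + k ∧ y + l ≠ x + k := by omega
    refine integral_eq_zero_of_flip hm (x + k) fun ω => ?_
    simp only [quad_flip_right hk, quad_flip_of_ne h2.1 h2.2]
    ring

theorem integral_quad_mul_quad_of_ne {x y : ℤ} {k l : ℕ} (h : ¬ (x = y ∧ k = l)) :
    ∫ ω, quad x k ω * quad y l ω ∂gibbs = 0 := by
  by_cases hk : k = 0
  · by_cases hl : l = 0
    · subst hk hl
      have hxy : x ≠ y := fun e => h ⟨e, rfl⟩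
      refine integral_gibbs_mul_eq_zero (Λ := {x}) (Λ' := {y}) (by simpa using hxy)
        (measurable_quad x 0) (measurable_quad y 0)
        (fun ω ω' h => quad_congr (h x (by simp)) (h _ (by simp)))
        (fun ω ω' h => quad_congr (h y (by simp)) (h _ (by simp))) (integral_quad x 0)
    · have := integral_quad_mul_quad_of_ne_of_pos (x := y) (y := x) (l := k) hl (by omega)
      simpa only [mul_comm] using this
  · exact integral_quad_mul_quad_of_ne_of_pos hk h

theorem integral_quad_mul_self (x : ℤ) (k : ℕ) :
    ∫ ω, quad x k ω * quad x k ω ∂gibbs = if k = 0 then 2 else 1 := by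
  by_cases hk : k = 0
  · subst hk
    have e : ∀ ω : Config, quad x 0 ω * quad x 0 ω = ω x ^ 4 - 2 * ω x ^ 2 + 1 := fun ω => by
      simp [quad]; ring
    simp only [e]
    have hi : Integrable (fun t : ℝ => t ^ 4 - 2 * t ^ 2) (gaussianReal 0 1) :=
      (integrable_pow_gaussianReal 4).sub ((integrable_pow_gaussianReal 2).const_mul 2)
    rw [integral_eval_gibbs x (F := fun t => t ^ 4 - 2 * t ^ 2 + 1) (by fun_prop),
      integral_add hi (integrable_const _),
      integral_sub (integrable_pow_gaussianReal 4) ((integrable_pow_gaussianReal 2).const_mul 2),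
      integral_const_mul, integral_pow_four_gaussianReal, integral_sq_gaussianReal]
    norm_num
  · have hne : x ≠ x + k := by omega
    have h1 : ∫ ω : Config, (ω x * ω x - 1) * (ω (x + k) * ω (x + k)) ∂gibbs = 0 := by
      refine integral_gibbs_mul_eq_zero (f := fun ω => ω x * ω x - 1)
        (g := fun ω => ω (x + k) * ω (x + k)) (Λ := {x}) (Λ' := {x + (k : ℤ)})
        (by simpa using hne) (by fun_prop) (by fun_prop)
        (fun ω ω' h => by simp only [h x (by simp)])
        (fun ω ω' h => by simp only [h (x + k) (by simp)]) (integral_eval_sq_sub_one x)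
    have h2 : ∫ ω : Config, ω (x + k) * ω (x + k) ∂gibbs = 1 := by
      rw [integral_eval_gibbs (x + k) (F := fun t => t * t) (by fun_prop)]
      simpa only [sq] using integral_sq_gaussianReal
    have hi1 : Integrable (fun ω => quad x k ω * quad x k ω) gibbs :=
      (memLp_quad x k).integrable_mul (memLp_quad x k)
    have hi2 : Integrable (fun ω : Config => ω (x + k) * ω (x + k)) gibbs :=
      (memLp_eval_gibbs (x + k) 2 (by norm_num)).integrable_mul
        (memLp_eval_gibbs (x + k) 2 (by norm_num))
    have e : ∀ ω : Config, (ω x * ω x - 1) * (ω (x + k) * ω (x + k))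
        = quad x k ω * quad x k ω - ω (x + k) * ω (x + k) := fun ω => by
      simp [quad, hk]; ring
    simp only [e] at h1
    rw [integral_sub hi1 hi2, h2] at h1
    simp only [hk, if_false]
    linarith

theorem integrable_eval_mul_eval (x y : ℤ) : Integrable (fun ω : Config => ω x * ω y) gibbs :=
  (memLp_eval_mul_eval x y).integrable (by norm_num)

theorem integrable_eval (x : ℤ) : Integrable (fun ω : Config => ω x) gibbs :=
  (memLp_eval_gibbs x 2 (by norm_num)).integrable (by norm_num)

/-- Gaussian integration by parts in one coordinate of the Gibbs measure. -/
theorem integral_eval_mul_deriv_gibbs {H : Config → ℝ} {B : ℝ} {y z : ℤ} (hzy : z ≠ y)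
    (hH : Measurable H) (hB : ∀ ω, |H ω| ≤ B)
    (hd : ∀ ω, Differentiable ℝ (fun t => H (Function.update ω y t)))
    (hd' : Measurable fun ω => deriv (fun t => H (Function.update ω y t)) (ω y))
    (hB' : ∀ ω, |deriv (fun t => H (Function.update ω y t)) (ω y)| ≤ B) :
    ∫ ω, ω z * deriv (fun t => H (Function.update ω y t)) (ω y) ∂gibbs
      = ∫ ω, ω z * ω y * H ω ∂gibbs := by
  set H' : Config → ℝ := fun ω => deriv (fun t => H (Function.update ω y t)) (ω y) with hH'
  have hu : ∀ (ω : Config) (t : ℝ),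
      H' (Function.update ω y t) = deriv (fun t => H (Function.update ω y t)) t := fun ω t => by
    simp [hH']
  -- Resampling the coordinate `y` and applying Fubini reduces the claim to one variable; `ω z` is a
  -- constant there since `z ≠ y`.
  have key : ∀ F : Config → ℝ, Measurable F → Integrable F gibbs →
      ∫ ω, F ω ∂gibbs = ∫ ω, ∫ t, F (Function.update ω y t) ∂gaussianReal 0 1 ∂gibbs := by
    intro F hF hFi
    have hp := measurePreserving_update y
    conv_lhs => rw [← hp.map_eq]
    rw [integral_map hp.measurable.aemeasurable hF.aestronglyMeasurable]
    exact integral_prod _ (hp.integrable_comp_of_integrable hFi)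
  have hi1 : Integrable (fun ω => ω z * H' ω) gibbs :=
    (integrable_eval z).mul_bdd (c := B) hd'.aestronglyMeasurable (Eventually.of_forall hB')
  have hi2 : Integrable (fun ω => ω z * ω y * H ω) gibbs :=
    (integrable_eval_mul_eval z y).mul_bdd (c := B) hH.aestronglyMeasurable
      (Eventually.of_forall hB)
  rw [key _ (by fun_prop) hi1, key _ (by fun_prop) hi2]
  refine integral_congr_ae (Eventually.of_forall fun ω => ?_)
  simp only [hu, Function.update_of_ne hzy, Function.update_self, mul_assoc]
  rw [integral_const_mul, integral_const_mul]
  congr 1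
  have hm : Measurable fun t => H (Function.update ω y t) :=
    hH.comp ((measurable_update_prod y).comp (by fun_prop : Measurable fun t : ℝ => (ω, t)))
  refine integral_deriv_gaussianReal (fun t => (hd ω t).hasDerivAt) ?_ ?_ ?_
  · exact Integrable.of_bound hm.aestronglyMeasurable B (Eventually.of_forall fun t => hB _)
  · refine Integrable.of_bound (measurable_deriv _).aestronglyMeasurable B
      (Eventually.of_forall fun t => ?_)
    rw [← hu]
    exact hB' _
  · have := integrable_pow_gaussianReal 1
    simp only [pow_one] at this
    exact this.mul_bdd (c := B) hm.aestronglyMeasurable (Eventually.of_forall fun t => hB _)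

end Gibbs

end DisorderedChain

namespace DisorderedChain

/-! ### The Hamiltonian vector field is divergence free for the Gibbs measure. -/

section Drift

/-- The partial derivative with respect to the coordinate `y`. -/
def partialDeriv (y : ℤ) (G : Config → ℝ) (ω : Config) : ℝ :=
  deriv (fun t : ℝ => G (Function.update ω y t)) (ω y)

/-- The Hamiltonian vector field with bond conductances `w`. -/
def drift (w : ℤ → ℝ) (G : Config → ℝ) (ω : Config) : ℝ :=
  ∑ᶠ y : ℤ, (w y * ω (y + 1) - w (y - 1) * ω (y - 1)) * partialDeriv y G ω

/-- `G` is a continuously differentiable function of the coordinates in `Λ`. -/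
def IsC1On (Λ : Finset ℤ) (G : Config → ℝ) : Prop :=
  ∃ F : (Λ → ℝ) → ℝ, ContDiff ℝ 1 F ∧ ∀ ω : Config, G ω = F (fun x => ω x)

/-- The unit vector in the direction `y`, which is zero if `y ∉ Λ`. -/
def unitVec (Λ : Finset ℤ) (y : ℤ) : Λ → ℝ := fun x => if (x : ℤ) = y then 1 else 0

theorem unitVec_eq_zero {Λ : Finset ℤ} {y : ℤ} (hy : y ∉ Λ) : unitVec Λ y = 0 := by
  funext x
  have : (x : ℤ) ≠ y := fun e => hy (e ▸ x.2)
  simp [unitVec, this]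

theorem norm_unitVec_le (Λ : Finset ℤ) (y : ℤ) : ‖unitVec Λ y‖ ≤ 1 := by
  refine (pi_norm_le_iff_of_nonneg zero_le_one).2 fun x => ?_
  unfold unitVec
  split_ifs <;> simp

theorem hasDerivAt_restrict_update {Λ : Finset ℤ} {F : (Λ → ℝ) → ℝ} (hF : Differentiable ℝ F)
    (ω : Config) (y : ℤ) (t : ℝ) :
    HasDerivAt (fun t : ℝ => F (fun x : Λ => Function.update ω y t x))
      (fderiv ℝ F (fun x : Λ => Function.update ω y t x) (unitVec Λ y)) t := by
  have h : HasDerivAt (fun t : ℝ => (fun x : Λ => Function.update ω y t x)) (unitVec Λ y) t := by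
    refine hasDerivAt_pi.2 fun x => ?_
    by_cases hx : (x : ℤ) = y
    · simp only [unitVec, hx, Function.update_self, if_true]
      exact hasDerivAt_id' t
    · simpa [unitVec, hx] using hasDerivAt_const t (ω x)
  exact (hF _).hasFDerivAt.comp_hasDerivAt t h

theorem partialDeriv_restrict {Λ : Finset ℤ} {F : (Λ → ℝ) → ℝ} (hF : Differentiable ℝ F)
    (ω : Config) (y : ℤ) :
    partialDeriv y (fun ω => F (fun x : Λ => ω x)) ω
      = fderiv ℝ F (fun x : Λ => ω x) (unitVec Λ y) := by
  have h := (hasDerivAt_restrict_update hF ω y (ω y)).deriv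
  simpa [partialDeriv] using h

theorem drift_restrict (w : ℤ → ℝ) {Λ : Finset ℤ} {F : (Λ → ℝ) → ℝ} (hF : Differentiable ℝ F)
    (ω : Config) :
    drift w (fun ω => F (fun x : Λ => ω x)) ω
      = ∑ y ∈ Λ, (w y * ω (y + 1) - w (y - 1) * ω (y - 1))
          * fderiv ℝ F (fun x : Λ => ω x) (unitVec Λ y) := by
  unfold drift
  simp only [partialDeriv_restrict hF]
  refine finsum_eq_sum_of_support_subset _ fun y hy => ?_
  by_contra hyΛ
  exact hy (by simp [unitVec_eq_zero (by simpa using hyΛ)])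

theorem measurable_restrict_finset (Λ : Finset ℤ) :
    Measurable (fun (ω : Config) (x : Λ) => ω x) := by fun_prop

/-- The Hamiltonian vector field is divergence free on compactly supported functions. -/
theorem integral_drift_of_hasCompactSupport (w : ℤ → ℝ) {Λ : Finset ℤ} {F : (Λ → ℝ) → ℝ}
    (hF : ContDiff ℝ 1 F) (hc : HasCompactSupport F) :
    ∫ ω, drift w (fun ω => F (fun x : Λ => ω x)) ω ∂gibbs = 0 := by
  have hFd : Differentiable ℝ F := hF.differentiable one_ne_zero
  have hF' : Continuous (fderiv ℝ F) := hF.continuous_fderiv one_ne_zero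
  obtain ⟨B₁, hB₁⟩ := hc.exists_bound_of_continuous hF.continuous
  obtain ⟨B₂, hB₂⟩ := (hc.fderiv ℝ).exists_bound_of_continuous hF'
  set H : Config → ℝ := fun ω => F (fun x : Λ => ω x) with hH
  have hHm : Measurable H := hF.continuous.measurable.comp (measurable_restrict_finset Λ)
  have hdm : ∀ y, Measurable (partialDeriv y H) := fun y => by
    have e : partialDeriv y H = fun ω => fderiv ℝ F (fun x : Λ => ω x) (unitVec Λ y) :=
      funext fun ω => partialDeriv_restrict hFd ω y
    rw [e]
    have : Continuous fun u => fderiv ℝ F u (unitVec Λ y) := by fun_prop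
    exact this.measurable.comp (measurable_restrict_finset Λ)
  have hdB : ∀ y ω, |partialDeriv y H ω| ≤ B₂ := fun y ω => by
    rw [partialDeriv_restrict hFd, ← Real.norm_eq_abs]
    refine (ContinuousLinearMap.le_opNorm _ _).trans ?_
    have h1 := hB₂ (fun x : Λ => ω x)
    have h2 := norm_unitVec_le Λ y
    nlinarith [norm_nonneg (fderiv ℝ F (fun x : Λ => ω x)), norm_nonneg (unitVec Λ y)]
  have hmain : ∀ y z, z ≠ y → ∫ ω, ω z * partialDeriv y H ω ∂gibbs
      = ∫ ω, ω z * ω y * H ω ∂gibbs := fun y z hzy => by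
    refine integral_eval_mul_deriv_gibbs (B := max B₁ B₂) hzy hHm
      (fun ω => (hB₁ _).trans (le_max_left _ _))
      (fun ω t => (hasDerivAt_restrict_update hFd ω y t).differentiableAt) (hdm y)
      (fun ω => (hdB y ω).trans (le_max_right _ _))
  have hint : ∀ y z, Integrable (fun ω => ω z * partialDeriv y H ω) gibbs := fun y z =>
    (integrable_eval z).mul_bdd (c := B₂) (hdm y).aestronglyMeasurable
      (Eventually.of_forall (hdB y))
  -- The flux through the bond from `y` to `y + 1`: integration by parts turns the `y` term of the
  -- drift into `q y - q (y - 1)`.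
  set q : ℤ → ℝ := fun y => w y * ∫ ω, ω y * ω (y + 1) * H ω ∂gibbs with hq
  have hflip : ∀ s, s ∉ Λ → ∀ ω, H (flip s ω) = H ω := fun s hs ω => by
    simp only [hH]
    congr 1
    funext x
    have : (x : ℤ) ≠ s := fun e => hs (e ▸ x.2)
    simp [flip, this]
  have hq0 : ∀ y, y ∉ Λ → q y = 0 := fun y hy => by
    simp only [hq]
    rw [integral_eq_zero_of_flip (by fun_prop) y fun ω => ?_, mul_zero]
    rw [hflip y hy]
    simp [flip]
  have hq1 : ∀ y, y + 1 ∉ Λ → q y = 0 := fun y hy => by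
    simp only [hq]
    rw [integral_eq_zero_of_flip (by fun_prop) (y + 1) fun ω => ?_, mul_zero]
    rw [hflip _ hy]
    simp [flip]
  have e1 : ∫ ω, drift w H ω ∂gibbs = ∑ y ∈ Λ, (q y - q (y - 1)) := by
    have e : ∀ ω, drift w H ω = ∑ y ∈ Λ, (w y * (ω (y + 1) * partialDeriv y H ω)
        - w (y - 1) * (ω (y - 1) * partialDeriv y H ω)) := fun ω => by
      rw [hH, drift_restrict w hFd]
      refine Finset.sum_congr rfl fun y _ => ?_
      rw [partialDeriv_restrict hFd]
      ring
    simp only [e]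
    have hi : ∀ y ∈ Λ, Integrable (fun ω => w y * (ω (y + 1) * partialDeriv y H ω)
        - w (y - 1) * (ω (y - 1) * partialDeriv y H ω)) gibbs := fun y _ =>
      ((hint y (y + 1)).const_mul _).sub ((hint y (y - 1)).const_mul _)
    rw [integral_finsetSum _ hi]
    refine Finset.sum_congr rfl fun y _ => ?_
    rw [integral_sub ((hint y (y + 1)).const_mul _) ((hint y (y - 1)).const_mul _),
      integral_const_mul, integral_const_mul, hmain y (y + 1) (by omega),
      hmain y (y - 1) (by omega)]
    simp only [hq, sub_add_cancel, mul_comm]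
  rw [e1, Finset.sum_sub_distrib]
  -- By parity `q y` vanishes unless both ends of the bond lie in `Λ`, so both sums extend to all of
  -- `ℤ`, where they differ by a translation.
  have e2 : ∑ y ∈ Λ, q y = ∑ᶠ y, q y := (finsum_eq_sum_of_support_subset _ fun y hy => by
    by_contra h
    exact hy (hq0 y (by simpa using h))).symm
  have e3 : ∑ y ∈ Λ, q (y - 1) = ∑ᶠ y, q (y - 1) :=
    (finsum_eq_sum_of_support_subset _ fun y hy => by
      by_contra h
      exact hy (hq1 (y - 1) (by simpa using h))).symm
  rw [e2, e3, sub_eq_zero]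
  exact (finsum_comp_equiv (Equiv.subRight (1 : ℤ)) (f := q)).symm

/-- `ω z` is independent of `G`; after resampling that coordinate the product is a tensor product.
The drift couples sites of `Λ` to neighbours outside it, and there only integrability of `G` is
available. -/
theorem integrable_mul_eval_of_notMem {Λ : Finset ℤ} {G : Config → ℝ} (hG : Measurable G)
    (hGi : Integrable G gibbs) (hGΛ : ∀ ω ω' : Config, (∀ x ∈ Λ, ω x = ω' x) → G ω = G ω')
    {z : ℤ} (hz : z ∉ Λ) : Integrable (fun ω => G ω * ω z) gibbs := by
  rw [← (measurePreserving_update z).integrable_comp (by fun_prop)]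
  have h : Integrable (fun q : Config × ℝ => G q.1 * q.2) (gibbs.prod (gaussianReal 0 1)) :=
    hGi.mul_prod (by simpa using integrable_pow_gaussianReal 1)
  refine h.congr (Eventually.of_forall fun q => ?_)
  have : G (Function.update q.1 z q.2) = G q.1 := hGΛ _ _ fun x hx => by
    have : x ≠ z := fun e => hz (e ▸ hx)
    simp [this]
  simp [this]

/-- The Hamiltonian vector field is divergence free. -/
theorem integral_drift (w : ℤ → ℝ) {Λ : Finset ℤ} {G : Config → ℝ} (hG : IsC1On Λ G)
    (hGi : Integrable G gibbs) (hAi : Integrable (drift w G) gibbs) :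
    ∫ ω, drift w G ω ∂gibbs = 0 := by
  obtain ⟨F, hF, hGF⟩ := hG
  obtain rfl : G = fun ω => F (fun x : Λ => ω x) := funext hGF
  set G : Config → ℝ := fun ω => F (fun x : Λ => ω x) with hG
  have hFd : Differentiable ℝ F := hF.differentiable one_ne_zero
  have hGm : Measurable G := hF.continuous.measurable.comp (measurable_restrict_finset Λ)
  have hGΛ : ∀ ω ω' : Config, (∀ x ∈ Λ, ω x = ω' x) → G ω = G ω' := fun ω ω' h => by
    simp only [hG]
    congr 1
    funext x
    exact h x x.2
  -- Cutoffs `b (r n • ·)`, equal to one on balls of radius `n + 1`, reduce to compact support. The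
  -- Leibniz rule leaves an error containing `ω_z` times a derivative of the cutoff.
  let b : ContDiffBump (0 : Λ → ℝ) := ⟨1, 2, one_pos, one_lt_two⟩
  have hb : ContDiff ℝ 1 b := b.contDiff
  have hbd : Differentiable ℝ b := hb.differentiable one_ne_zero
  obtain ⟨B, hB⟩ := (b.hasCompactSupport.fderiv ℝ).exists_bound_of_continuous
    (hb.continuous_fderiv one_ne_zero)
  have hB0 : 0 ≤ B := (norm_nonneg _).trans (hB 0)
  let r : ℕ → ℝ := fun n => ((n : ℝ) + 1)⁻¹
  have hr : ∀ n, 0 < r n := fun n => by positivity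
  have hr1 : ∀ n, r n ≤ 1 := fun n => inv_le_one_of_one_le₀ (by
    have : (0 : ℝ) ≤ n := Nat.cast_nonneg n
    linarith)
  have hrlim : Tendsto r atTop (𝓝 0) := by
    simpa [r, one_div] using tendsto_one_div_add_atTop_nhds_zero_nat (𝕜 := ℝ)
  let χ : ℕ → (Λ → ℝ) → ℝ := fun n u => b (r n • u)
  have hχ : ∀ n, ContDiff ℝ 1 (χ n) := fun n => hb.comp (by fun_prop)
  have hχd : ∀ n u, fderiv ℝ (χ n) u = r n • fderiv ℝ b (r n • u) := fun n u => by
    exact fderiv_comp_smul (r n)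
  have hχc : ∀ n, HasCompactSupport (χ n) := fun n =>
    b.hasCompactSupport.comp_homeomorph (Homeomorph.smulOfNeZero (r n) (hr n).ne')
  have hprod : ∀ n (ω : Config), drift w (fun ω => (χ n * F) (fun x : Λ => ω x)) ω
      = χ n (fun x : Λ => ω x) * drift w G ω
        + G ω * ∑ y ∈ Λ, (w y * ω (y + 1) - w (y - 1) * ω (y - 1))
          * fderiv ℝ (χ n) (fun x : Λ => ω x) (unitVec Λ y) := by
    intro n ω
    have hχn : Differentiable ℝ (χ n) := (hχ n).differentiable one_ne_zero
    rw [drift_restrict w (hχn.mul hFd), hG, drift_restrict w hFd, Finset.mul_sum, Finset.mul_sum,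
      ← Finset.sum_add_distrib]
    refine Finset.sum_congr rfl fun y _ => ?_
    rw [fderiv_mul (hχn _) (hFd _)]
    simp
    ring
  have hzero : ∀ n, ∫ ω, drift w (fun ω => (χ n * F) (fun x : Λ => ω x)) ω ∂gibbs = 0 := fun n =>
    integral_drift_of_hasCompactSupport w ((hχ n).mul hF) ((hχc n).mul_right)
  -- For `z ∈ Λ` the cutoff gradient, of size at most `r n * B`, vanishes unless `r n * |ω z| ≤ 2`,
  -- so the growth of `ω z` is compensated. For `z ∉ Λ` it is not, and `|ω z|` stays in the
  -- dominating function.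
  let g : ℤ → Config → ℝ := fun z ω => 2 + if z ∈ Λ then 0 else |ω z|
  have hg : ∀ z n (ω : Config) y, |ω z * fderiv ℝ (χ n) (fun x : Λ => ω x) (unitVec Λ y)|
      ≤ B * g z ω := by
    intro z n ω y
    rw [hχd, abs_mul]
    have h1 : |(r n • fderiv ℝ b (r n • fun x : Λ => ω x)) (unitVec Λ y)| ≤ r n * B := by
      rw [← Real.norm_eq_abs]
      refine (ContinuousLinearMap.le_opNorm _ _).trans ?_
      rw [norm_smul, Real.norm_of_nonneg (hr n).le]
      have h2 := norm_unitVec_le Λ y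
      have h3 := hB (r n • fun x : Λ => ω x)
      calc _ ≤ r n * B * 1 := by gcongr
        _ = r n * B := mul_one _
    by_cases hz : z ∈ Λ
    · simp only [g, hz, if_true, add_zero]
      by_cases hlt : r n * |ω z| ≤ 2
      · calc |ω z| * _ ≤ |ω z| * (r n * B) := by gcongr
          _ = B * (r n * |ω z|) := by ring
          _ ≤ B * 2 := by gcongr
      · have h0 : fderiv ℝ b (r n • fun x : Λ => ω x) = 0 := by
          refine image_eq_zero_of_notMem_tsupport fun hmem => hlt ?_
          have h4 := tsupport_fderiv_subset ℝ hmem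
          rw [b.tsupport_eq, mem_closedBall_zero_iff] at h4
          have h5 := (norm_le_pi_norm (r n • fun x : Λ => ω x) ⟨z, hz⟩).trans h4
          simpa [abs_of_pos (hr n)] using h5
        rw [h0]
        simp
        positivity
    · simp only [g, hz, if_false]
      calc |ω z| * _ ≤ |ω z| * (r n * B) := by gcongr
        _ ≤ |ω z| * (1 * B) := by gcongr; exact hr1 n
        _ ≤ B * (2 + |ω z|) := by nlinarith
  have hgi : ∀ z, Integrable (fun ω => |G ω| * (B * g z ω)) gibbs := by
    intro z
    by_cases hz : z ∈ Λ
    · simp only [g, hz, if_true, add_zero]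
      exact hGi.abs.mul_const _
    · simp only [g, hz, if_false]
      have h1 := ((hGi.abs.mul_const 2).add
        (integrable_mul_eval_of_notMem hGm hGi hGΛ hz).abs).const_mul B
      refine h1.congr (Eventually.of_forall fun ω => ?_)
      simp only [Pi.add_apply, abs_mul]
      ring
  let bd : Config → ℝ := fun ω => |drift w G ω| + ∑ y ∈ Λ, (|w y| * (|G ω| * (B * g (y + 1) ω))
    + |w (y - 1)| * (|G ω| * (B * g (y - 1) ω)))
  have hbd : Integrable bd gibbs := hAi.abs.add (integrable_finsetSum _ fun y _ =>
    ((hgi _).const_mul _).add ((hgi _).const_mul _))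
  have hmeas : ∀ n, Measurable
      (drift w (fun ω => (χ n * F) (fun x : Λ => ω x))) := fun n => by
    have hC1 : ContDiff ℝ 1 (χ n * F) := (hχ n).mul hF
    have e : drift w (fun ω => (χ n * F) (fun x : Λ => ω x)) = fun ω =>
        ∑ y ∈ Λ, (w y * ω (y + 1) - w (y - 1) * ω (y - 1))
          * fderiv ℝ (χ n * F) (fun x : Λ => ω x) (unitVec Λ y) :=
      funext fun ω => drift_restrict w (hC1.differentiable one_ne_zero) ω
    rw [e]
    refine Finset.measurable_fun_sum _ fun y _ => Measurable.mul (by fun_prop) ?_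
    have hcd := hC1.continuous_fderiv one_ne_zero
    have : Continuous fun u => fderiv ℝ (χ n * F) u (unitVec Λ y) := by fun_prop
    exact this.measurable.comp (measurable_restrict_finset Λ)
  have hlim := tendsto_integral_of_dominated_convergence (f := drift w G) bd
    (fun n => (hmeas n).aestronglyMeasurable) hbd (fun n => Eventually.of_forall fun ω => ?_)
    (Eventually.of_forall fun ω => ?_)
  · simp only [hzero] at hlim
    exact (tendsto_nhds_unique hlim tendsto_const_nhds)
  · rw [hprod]
    refine (norm_add_le _ _).trans (add_le_add ?_ ?_)
    · rw [norm_mul, Real.norm_eq_abs, Real.norm_eq_abs, abs_of_nonneg b.nonneg]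
      exact mul_le_of_le_one_left (abs_nonneg _) b.le_one
    · rw [norm_mul, Real.norm_eq_abs, Real.norm_eq_abs]
      refine (mul_le_mul_of_nonneg_left (Finset.abs_sum_le_sum_abs _ _) (abs_nonneg _)).trans ?_
      rw [Finset.mul_sum]
      refine Finset.sum_le_sum fun y _ => ?_
      have h1 := hg (y + 1) n ω y
      have h2 := hg (y - 1) n ω y
      set d := fderiv ℝ (χ n) (fun x : Λ => ω x) (unitVec Λ y)
      have h3 : |(w y * ω (y + 1) - w (y - 1) * ω (y - 1)) * d|
          ≤ |w y| * |ω (y + 1) * d| + |w (y - 1)| * |ω (y - 1) * d| := by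
        rw [← abs_mul, ← abs_mul]
        have e : (w y * ω (y + 1) - w (y - 1) * ω (y - 1)) * d
          = w y * (ω (y + 1) * d) - w (y - 1) * (ω (y - 1) * d) := by ring
        rw [e]
        exact abs_sub _ _
      calc _ ≤ |G ω| * (|w y| * (B * g (y + 1) ω) + |w (y - 1)| * (B * g (y - 1) ω)) := by
            gcongr
            exact h3.trans (by gcongr)
        _ = _ := by ring
  · simp only [hprod]
    have h1 : Tendsto (fun n => χ n (fun x : Λ => ω x)) atTop (𝓝 1) := by
      have h2 : Tendsto (fun n => r n • (fun x : Λ => ω x)) atTop (𝓝 0) := by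
        simpa using hrlim.smul_const (fun x : Λ => ω x)
      have h3 := (hb.continuous.tendsto 0).comp h2
      rwa [b.one_of_mem_closedBall (Metric.mem_closedBall_self (by positivity))] at h3
    have h2 : ∀ y, Tendsto (fun n => fderiv ℝ (χ n) (fun x : Λ => ω x) (unitVec Λ y))
        atTop (𝓝 0) := fun y => by
      refine squeeze_zero_norm (a := fun n => r n * B) (fun n => ?_) (by simpa using hrlim.mul_const B)
      rw [hχd]
      refine (ContinuousLinearMap.le_opNorm _ _).trans ?_
      rw [norm_smul, Real.norm_of_nonneg (hr n).le]
      have h2 := norm_unitVec_le Λ y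
      have h3 := hB (r n • fun x : Λ => ω x)
      calc _ ≤ r n * B * 1 := by gcongr
        _ = r n * B := mul_one _
    have h3 := (h1.mul_const (drift w G ω)).add ((tendsto_finsetSum Λ fun y _ =>
      (h2 y).const_mul (w y * ω (y + 1) - w (y - 1) * ω (y - 1))).const_mul (G ω))
    simpa using h3

end Drift

end DisorderedChain

namespace DisorderedChain

variable {C : ℝ} {ν : Measure (Set.Icc C⁻¹ C)} [IsProbabilityMeasure ν]

/-! ### Pointwise evaluation of local functions. -/

section Eval

/-- Evaluation of local functions at a point. -/
def evalₗ (p : Disorder C × Config) : LocalFun ν →ₗ[ℝ] ℝ where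
  toFun f := f p
  map_add' _ _ := rfl
  map_smul' _ _ := rfl

theorem evalₗ_apply (p : Disorder C × Config) (f : LocalFun ν) : evalₗ p f = f p := rfl

theorem LocalFun.ext {f g : LocalFun ν} (h : ∀ p, f p = g p) : f = g :=
  Subtype.ext (funext h)

theorem inner_localFun (f g : LocalFun ν) : inner ℝ f g = semiInner f g := rfl

end Eval

/-! ### Antisymmetry of the Hamiltonian part in `𝐋²_⋆`. -/

section HamiltonianPart

/-- The conductance of the bond `{y, y + 1}`. -/
def bond (m : Disorder C) (y : ℤ) : ℝ := (√((m y : ℝ) * (m (y + 1) : ℝ)))⁻¹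

theorem IsC1On.mono {Λ Λ' : Finset ℤ} (h : Λ ⊆ Λ') {G : Config → ℝ} (hG : IsC1On Λ G) :
    IsC1On Λ' G := by
  obtain ⟨F, hF, hGF⟩ := hG
  exact ⟨fun u => F fun x => u ⟨x, h x.2⟩, hF.comp (by fun_prop), hGF⟩

theorem IsC1On.mul {Λ : Finset ℤ} {G G' : Config → ℝ} (hG : IsC1On Λ G) (hG' : IsC1On Λ G') :
    IsC1On Λ (fun ω => G ω * G' ω) := by
  obtain ⟨F, hF, hGF⟩ := hG
  obtain ⟨F', hF', hGF'⟩ := hG'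
  exact ⟨F * F', hF.mul hF', fun ω => by simp [hGF, hGF']⟩

theorem IsC1On.comp_shift {Λ : Finset ℤ} {G : Config → ℝ} (hG : IsC1On Λ G) (x : ℤ) :
    IsC1On (Λ.image (x + ·)) (fun ω => G fun z => ω (x + z)) := by
  obtain ⟨F, hF, hGF⟩ := hG
  exact ⟨fun u => F fun z => u ⟨x + z, Finset.mem_image_of_mem _ z.2⟩, hF.comp (by fun_prop),
    fun ω => by simp [hGF]⟩

theorem IsC1On.differentiableAt_update {Λ : Finset ℤ} {G : Config → ℝ} (hG : IsC1On Λ G)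
    (ω : Config) (y : ℤ) (t : ℝ) :
    DifferentiableAt ℝ (fun t : ℝ => G (Function.update ω y t)) t := by
  obtain ⟨F, hF, hGF⟩ := hG
  simp only [hGF]
  exact (hasDerivAt_restrict_update (hF.differentiable one_ne_zero) ω y t).differentiableAt

theorem IsC1On.partialDeriv_eq_zero {Λ : Finset ℤ} {G : Config → ℝ} (hG : IsC1On Λ G)
    {y : ℤ} (hy : y ∉ Λ) (ω : Config) : partialDeriv y G ω = 0 := by
  obtain ⟨F, hF, hGF⟩ := hG
  rw [show G = _ from funext hGF, partialDeriv_restrict (hF.differentiable one_ne_zero),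
    unitVec_eq_zero hy, map_zero]

theorem IsC1On.drift_eq_sum (w : ℤ → ℝ) {Λ : Finset ℤ} {G : Config → ℝ} (hG : IsC1On Λ G)
    (ω : Config) : drift w G ω = ∑ y ∈ Λ, (w y * ω (y + 1) - w (y - 1) * ω (y - 1))
      * partialDeriv y G ω := by
  refine finsum_eq_sum_of_support_subset _ fun y hy => ?_
  by_contra hyΛ
  exact hy (by simp [hG.partialDeriv_eq_zero (by simpa using hyΛ)])

theorem drift_mul (w : ℤ → ℝ) {Λ : Finset ℤ} {G G' : Config → ℝ} (hG : IsC1On Λ G)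
    (hG' : IsC1On Λ G') (ω : Config) :
    drift w (fun ω => G ω * G' ω) ω = drift w G ω * G' ω + G ω * drift w G' ω := by
  rw [(hG.mul hG').drift_eq_sum, hG.drift_eq_sum, hG'.drift_eq_sum, Finset.sum_mul,
    Finset.mul_sum, ← Finset.sum_add_distrib]
  refine Finset.sum_congr rfl fun y _ => ?_
  have h : HasDerivAt (fun t => G (Function.update ω y t) * G' (Function.update ω y t)) _ (ω y) :=
    (hG.differentiableAt_update ω y (ω y)).hasDerivAt.mul
    (hG'.differentiableAt_update ω y (ω y)).hasDerivAt
  have e : partialDeriv y (fun ω => G ω * G' ω) ω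
      = partialDeriv y G ω * G' ω + G ω * partialDeriv y G' ω := by
    have := h.deriv
    simpa [partialDeriv] using this
  rw [e]
  ring

theorem genA_eq_drift (f : Disorder C × Config → ℝ) (m : Disorder C) (ω : Config) :
    genA f (m, ω) = drift (bond m) (fun ω => f (m, ω)) ω := by
  unfold genA drift partialDeriv bond
  refine finsum_congr fun y => ?_
  simp only [sub_add_cancel, div_eq_inv_mul]

/-- Translation covariance, by relabelling the sites. It makes `f` and its translate subject to the
same vector field, so the Leibniz rule applies to their product. -/
theorem genA_shift (f : Disorder C × Config → ℝ) (x : ℤ) (m : Disorder C) (ω : Config) :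
    genA f (shift x (m, ω)) = drift (bond m) (fun ω => f (shift x (m, ω))) ω := by
  rw [shift, genA_eq_drift]
  unfold drift
  conv_rhs => rw [← finsum_comp_equiv (Equiv.addLeft x)]
  refine finsum_congr fun y => ?_
  have e1 : ∀ t : ℝ, (fun z => Function.update ω (x + y) t (x + z))
      = Function.update (fun z => ω (x + z)) y t := fun t => by
    funext z
    by_cases hz : z = y
    · subst hz; simp
    · have : x + z ≠ x + y := by omega
      simp [hz, this]
  simp only [Equiv.coe_addLeft, bond, partialDeriv, shift, e1, add_assoc, add_sub_assoc]

theorem memLp_comp_shift_gibbs (f : LocalFun ν) (x : ℤ) (m : Disorder C) :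
    MemLp (fun ω => f (shift x (m, ω))) 2 gibbs := by
  have h2 : MeasurePreserving (fun (ω : Config) z => ω (x + z)) gibbs gibbs :=
    ⟨by fun_prop, Measure.map_infinitePi_infinitePi_of_inj
      (P := fun _ : ℤ => gaussianReal 0 1) (add_right_injective x)⟩
  exact (f.isLocal.memLp_gibbs (fun z => m (x + z))).comp_measurePreserving h2

/-- The Hamiltonian part of the generator is antisymmetric. -/
theorem semiInner_genA_self {f a : LocalFun ν} (hf : IsC1 f.toFun) (ha : ∀ p, a p = genA f.toFun p) :
    semiInner a f = 0 := by
  obtain ⟨Λ, hΛ⟩ := hf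
  -- The sum of the two correlations is the mean of the vector field applied to `f · τ_x f`, which
  -- vanishes for each fixed disorder.
  have hanti : ∀ x : ℤ, ∫ p, a p * f (shift x p) ∂annealed ν
      = -∫ p, a p * f (shift (-x) p) ∂annealed ν := by
    intro x
    have h1 := integral_shift_mul_shift a f x 0
    have h0 : ∀ p : Disorder C × Config, shift 0 p = p := fun p => by simp [shift]
    simp only [h0, zero_sub] at h1
    rw [← h1, ← add_eq_zero_iff_eq_neg]
    have hi1 := integrable_mul_shift_right a f x
    have hi2 : Integrable (fun p => a (shift x p) * f p) (annealed ν) :=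
      (a.memLp_shift x).integrable_mul f.isLocal.memLp
    rw [← integral_add hi1 hi2]
    have hi : Integrable (fun p => a p * f (shift x p) + a (shift x p) * f p) (annealed ν) :=
      hi1.add hi2
    unfold annealed at hi ⊢
    rw [integral_prod _ hi]
    refine integral_eq_zero_of_ae (Eventually.of_forall fun m => ?_)
    have c1 : IsC1On (Λ ∪ Λ.image (x + ·)) (fun ω => f (m, ω)) :=
      IsC1On.mono Finset.subset_union_left (hΛ m)
    have c2 : IsC1On (Λ ∪ Λ.image (x + ·)) (fun ω => f (shift x (m, ω))) :=
      IsC1On.mono Finset.subset_union_right (IsC1On.comp_shift (hΛ fun z => m (x + z)) x)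
    have e : ∀ ω, a (m, ω) * f (shift x (m, ω)) + a (shift x (m, ω)) * f (m, ω)
        = drift (bond m) (fun ω => f (m, ω) * f (shift x (m, ω))) ω := fun ω => by
      rw [drift_mul (bond m) c1 c2, ha, ha, genA_eq_drift, genA_shift]
      ring
    have hiA : Integrable
        (drift (bond m) (fun ω => f (m, ω) * f (shift x (m, ω)))) gibbs := by
      rw [show drift (bond m) (fun ω => f (m, ω) * f (shift x (m, ω))) = _ from
        funext fun ω => (e ω).symm]
      exact ((a.isLocal.memLp_gibbs m).integrable_mul (memLp_comp_shift_gibbs f x m)).add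
        ((memLp_comp_shift_gibbs a x m).integrable_mul (f.isLocal.memLp_gibbs m))
    simp only [Pi.zero_apply, e]
    exact integral_drift (bond m) (c1.mul c2)
      ((f.isLocal.memLp_gibbs m).integrable_mul (memLp_comp_shift_gibbs f x m)) hiA
  -- Replacing `x` by `-x` in the sum over translations turns the termwise identity into
  -- antisymmetry of the whole.
  have h : semiInner a f = -semiInner a f := by
    unfold semiInner
    conv_lhs => rw [← (Equiv.neg ℤ).tsum_eq]
    rw [← tsum_neg]
    refine tsum_congr fun x => ?_
    rw [Equiv.neg_apply, hanti, neg_neg]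
  linarith

end HamiltonianPart

/-! ### Negativity of the flip and exchange noises, treated together. -/

section Noise

/-- A translation covariant family of local involutions of the configurations, each of which
preserves the Gibbs measure. -/
structure IsLocalNoise (θ : ℤ → Config → Config) : Prop where
  measurePreserving : ∀ y, MeasurePreserving (θ y) gibbs gibbs
  involutive : ∀ y ω, θ y (θ y ω) = ω
  source : ∀ y, ∃ s : ℤ → ℤ, ∀ ω ω' z, ω (s z) = ω' (s z) → θ y ω z = θ y ω' z
  covariant : ∀ x y ω, (fun z => θ y ω (x + z)) = θ (y - x) (fun z => ω (x + z))
  trivial : ∀ Λ : Finset ℤ, ∃ S : Finset ℤ, ∀ y ∉ S, ∀ ω, ∀ z ∈ Λ, θ y ω z = ω z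

theorem isLocalNoise_flip : IsLocalNoise flip where
  measurePreserving := measurePreserving_flip
  involutive := flip_flip
  source y := ⟨id, fun ω ω' z h => by
    by_cases hz : z = y
    · subst hz; simpa [flip] using h
    · simpa [flip, hz] using h⟩
  covariant x y ω := by
    funext z
    by_cases hz : x + z = y
    · subst hz; simp [flip]
    · have : z ≠ y - x := by omega
      simp [flip, hz, this]
  trivial Λ := ⟨Λ, fun y hy ω z hz => by
    have : z ≠ y := fun e => hy (e ▸ hz)
    simp [flip, this]⟩

theorem isLocalNoise_exch : IsLocalNoise exch where
  measurePreserving := measurePreserving_exch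
  involutive := exch_exch
  source y := ⟨Equiv.swap y (y + 1), fun _ _ _ h => h⟩
  covariant x y ω := by
    funext z
    simp only [exch]
    congr 1
    simp only [Equiv.swap_apply_def]
    split_ifs <;> omega
  trivial Λ := ⟨Λ ∪ Λ.image (· - 1), fun y hy ω z hz => by
    have h1 : z ≠ y := fun e => hy (Finset.mem_union_left _ (e ▸ hz))
    have h2 : z ≠ y + 1 := fun e => hy (Finset.mem_union_right _
      (Finset.mem_image.2 ⟨z, hz, by omega⟩))
    simp [exch, Equiv.swap_apply_of_ne_of_ne h1 h2]⟩

variable {θ : ℤ → Config → Config}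

theorem measurePreserving_prod_noise (hθ : IsLocalNoise θ) (y : ℤ) :
    MeasurePreserving (fun p : Disorder C × Config => (p.1, θ y p.2)) (annealed ν) (annealed ν) :=
  (MeasurePreserving.id (disorderLaw ν)).prod (hθ.measurePreserving y)

/-- A local function after one move of the noise. -/
def LocalFun.move (hθ : IsLocalNoise θ) (y : ℤ) (f : LocalFun ν) : LocalFun ν :=
  show localSubmodule ν from ⟨fun p => f (p.1, θ y p.2),
    { measurable := f.isLocal.measurable.comp
        (measurePreserving_prod_noise (ν := ν) hθ y).measurable
      cylinder := by
        obtain ⟨Λ, hΛ⟩ := f.isLocal.cylinder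
        obtain ⟨s, hs⟩ := hθ.source y
        refine ⟨Λ ∪ Λ.image s, fun p q h => hΛ _ _ fun x hx =>
          ⟨(h x (Finset.mem_union_left _ hx)).1, hs _ _ _ ?_⟩⟩
        exact (h (s x) (Finset.mem_union_right _ (Finset.mem_image_of_mem _ hx))).2
      continuous_disorder := fun ω => f.isLocal.continuous_disorder (θ y ω)
      memLp_gibbs := fun m =>
        (f.isLocal.memLp_gibbs m).comp_measurePreserving (hθ.measurePreserving y)
      centred := fun m => by
        rw [integral_comp_gibbs (hθ.measurePreserving y) (F := fun ω => f (m, ω))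
          (f.isLocal.measurable.comp (by fun_prop)), f.isLocal.centred m]
      memLp := f.isLocal.memLp.comp_measurePreserving (measurePreserving_prod_noise hθ y) }⟩

theorem LocalFun.move_apply (hθ : IsLocalNoise θ) (y : ℤ) (f : LocalFun ν)
    (p : Disorder C × Config) : f.move hθ y p = f (p.1, θ y p.2) := rfl

/-- The discrete gradient of a local function. -/
def LocalFun.grad (hθ : IsLocalNoise θ) (y : ℤ) (f : LocalFun ν) : LocalFun ν := f.move hθ y - f

theorem LocalFun.grad_apply (hθ : IsLocalNoise θ) (y : ℤ) (f : LocalFun ν)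
    (p : Disorder C × Config) : f.grad hθ y p = f (p.1, θ y p.2) - f p := rfl

/-- The gradient is odd under the involution `θ y`, so pairing it with a function is minus half its
pairing with the gradient of that function; covariance turns the gradient of `τ_x f` into a
translate of the gradient of `f` at `y - x`. Recentring both gradients prepares the perfect square.
-/
theorem integral_grad_mul (hθ : IsLocalNoise θ) (f : LocalFun ν) (y x : ℤ) :
    ∫ p, f.grad hθ y p * f (shift x p) ∂annealed ν
      = -(1 / 2) * ∫ p, f.grad hθ y (shift (-y) p) * f.grad hθ (y - x) (shift (-(y - x)) p)
        ∂annealed ν := by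
  have h2 := integral_shift_mul_shift (f.grad hθ y) (f.grad hθ (y - x)) (-y) (-(y - x))
  rw [h2, show -(y - x) - -y = x by ring]
  let Θ : Disorder C × Config → Disorder C × Config := fun p => (p.1, θ y p.2)
  have hΘ : MeasurePreserving Θ (annealed ν) (annealed ν) := measurePreserving_prod_noise hθ y
  have hcov : ∀ p, f.grad hθ (y - x) (shift x p) = f (shift x (Θ p)) - f (shift x p) := fun p => by
    rw [LocalFun.grad_apply]
    simp only [shift, Θ, hθ.covariant]
  have hm : Measurable (fun p => f.grad hθ y p * f (shift x p)) :=
    (f.grad hθ y).isLocal.measurable.mul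
      (f.isLocal.measurable.comp (measurePreserving_shift (ν := ν) x).measurable)
  have h3 : ∫ p, f.grad hθ y p * f (shift x p) ∂annealed ν
      = -∫ p, f.grad hθ y p * f (shift x (Θ p)) ∂annealed ν := by
    conv_lhs => rw [← hΘ.map_eq]
    rw [integral_map hΘ.measurable.aemeasurable hm.aestronglyMeasurable, ← integral_neg]
    refine integral_congr_ae (Eventually.of_forall fun p => ?_)
    simp only [LocalFun.grad_apply, Θ, hθ.involutive]
    ring
  have hi1 := integrable_mul_shift_right (f.grad hθ y) f x
  have hi2 : Integrable (fun p => f.grad hθ y p * f (shift x (Θ p))) (annealed ν) :=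
    (f.grad hθ y).isLocal.memLp.integrable_mul ((f.memLp_shift x).comp_measurePreserving hΘ)
  have h4 : ∫ p, f.grad hθ y p * f.grad hθ (y - x) (shift x p) ∂annealed ν
      = ∫ p, f.grad hθ y p * f (shift x (Θ p)) ∂annealed ν
        - ∫ p, f.grad hθ y p * f (shift x p) ∂annealed ν := by
    rw [← integral_sub hi2 hi1]
    refine integral_congr_ae (Eventually.of_forall fun p => ?_)
    simp only [hcov]
    ring
  rw [h4]
  linarith

/-- The generator of a local noise is negative on local functions. -/
theorem exists_noise_generator (hθ : IsLocalNoise θ) (f : LocalFun ν) :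
    ∃ u : LocalFun ν, (∀ p, u p = ∑ᶠ y : ℤ, (f (p.1, θ y p.2) - f p)) ∧ semiInner u f ≤ 0 := by
  obtain ⟨Λ, hΛ⟩ := f.isLocal.cylinder
  obtain ⟨S, hS⟩ := hθ.trivial Λ
  have h0 : ∀ y ∉ S, ∀ p, f.grad hθ y p = 0 := fun y hy p => by
    rw [LocalFun.grad_apply, sub_eq_zero]
    exact hΛ _ _ fun x hx => ⟨rfl, hS y hy _ x hx⟩
  refine ⟨∑ y ∈ S, f.grad hθ y, fun p => ?_, ?_⟩
  · rw [← evalₗ_apply, map_sum, finsum_eq_sum_of_support_subset]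
    · rfl
    · intro y hy
      by_contra hyS
      exact hy (h0 y (by simpa using hyS) p)
  · rw [← inner_localFun, sum_inner]
    simp only [inner_localFun]
    -- Summing over translations `x` amounts to summing over the second noise site `y' = y - x`.
    have e : ∀ y, semiInner (f.grad hθ y) f = -(1 / 2) * ∑ y' ∈ S,
        ∫ p, f.grad hθ y (shift (-y) p) * f.grad hθ y' (shift (-y') p) ∂annealed ν := fun y => by
      unfold semiInner
      simp only [integral_grad_mul]
      rw [tsum_mul_left]
      congr 1
      refine ((Equiv.subLeft y).tsum_eq (fun y' => ∫ p, f.grad hθ y (shift (-y) p)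
        * f.grad hθ y' (shift (-y') p) ∂annealed ν)).trans (tsum_eq_sum fun y' hy' => ?_)
      simp [h0 y' hy']
    simp only [e]
    rw [← Finset.mul_sum]
    -- The double sum over noise sites is the second moment of the sum of recentred gradients.
    have h1 : ∑ y ∈ S, ∑ y' ∈ S,
        ∫ p, f.grad hθ y (shift (-y) p) * f.grad hθ y' (shift (-y') p) ∂annealed ν
        = ∫ p, (∑ y ∈ S, f.grad hθ y (shift (-y) p)) * (∑ y ∈ S, f.grad hθ y (shift (-y) p))
          ∂annealed ν := by
      simp only [Finset.sum_mul_sum]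
      rw [integral_finsetSum S (f := fun y p => ∑ y' ∈ S,
        f.grad hθ y (shift (-y) p) * f.grad hθ y' (shift (-y') p)) fun y _ =>
        integrable_finsetSum _ fun y' _ => integrable_mul_shift _ _ _ _]
      refine Finset.sum_congr rfl fun y _ => ?_
      rw [integral_finsetSum S (f := fun y' p =>
        f.grad hθ y (shift (-y) p) * f.grad hθ y' (shift (-y') p)) fun y' _ =>
        integrable_mul_shift _ _ _ _]
    rw [h1]
    have h2 : 0 ≤ ∫ p, (∑ y ∈ S, f.grad hθ y (shift (-y) p))
        * (∑ y ∈ S, f.grad hθ y (shift (-y) p)) ∂annealed ν :=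
      integral_nonneg fun p => mul_self_nonneg _
    linarith

end Noise

/-- The generator is dissipative on its core. -/
theorem semiInner_nonpos_of_isGen {lam γ : ℝ} (hlam : 0 ≤ lam) (hγ : 0 ≤ γ) {f g : LocalFun ν}
    (h : IsGen ν lam γ f g) : semiInner g f ≤ 0 := by
  obtain ⟨u, hu, hu0⟩ := exists_noise_generator isLocalNoise_flip f
  obtain ⟨v, hv, hv0⟩ := exists_noise_generator isLocalNoise_exch f
  -- Both noise parts are local functions, so the Hamiltonian part is one too and its antisymmetry
  -- can be used separately.
  set a : LocalFun ν := g - (γ • u + lam • v) with ha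
  have ha' : ∀ p, a p = genA f.toFun p := fun p => by
    have e : a p = g p - (γ * u p + lam * v p) := rfl
    rw [e, h.2, hu, hv, gen, genFlip, genExch]
    ring
  have h1 := semiInner_genA_self h.1 ha'
  have e : g = a + (γ • u + lam • v) := by rw [ha]; abel
  rw [e, semiInner_add_left, semiInner_add_left, semiInner_smul_left, semiInner_smul_left, h1]
  nlinarith

/-- The closure of the generator is dissipative. -/
theorem inner_nonpos_of_mem_genGraph {lam γ : ℝ} (hlam : 0 ≤ lam) (hγ : 0 ≤ γ)
    {q : L2star ν × L2star ν} (hq : q ∈ genGraph ν lam γ) : inner ℝ q.2 q.1 ≤ 0 := by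
  have hc : IsClosed {q : L2star ν × L2star ν | inner ℝ q.2 q.1 ≤ 0} :=
    isClosed_le (by fun_prop) continuous_const
  refine closure_minimal ?_ hc hq
  rintro _ ⟨f, g, hfg, rfl⟩
  rw [Set.mem_ofPred_eq, UniformSpace.Completion.inner_coe]
  exact semiInner_nonpos_of_isGen hlam hγ hfg

end DisorderedChain

namespace DisorderedChain

variable {C : ℝ}

/-! ### Disorder functions as coefficients: translations and conductances. -/

section Coefficients

/-- Continuous cylinder functions of the disorder. -/
def coefAlg (C : ℝ) : Subalgebra ℝ C(Disorder C, ℝ) where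
  carrier := {a | ∃ Λ : Finset ℤ, ∀ m m' : Disorder C, (∀ x ∈ Λ, m x = m' x) → a m = a m'}
  mul_mem' := by
    rintro a b ⟨Λ, h⟩ ⟨Λ', h'⟩
    refine ⟨Λ ∪ Λ', fun m m' hm => ?_⟩
    rw [ContinuousMap.mul_apply, ContinuousMap.mul_apply,
      h m m' fun x hx => hm x (Finset.mem_union_left _ hx),
      h' m m' fun x hx => hm x (Finset.mem_union_right _ hx)]
  add_mem' := by
    rintro a b ⟨Λ, h⟩ ⟨Λ', h'⟩
    refine ⟨Λ ∪ Λ', fun m m' hm => ?_⟩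
    rw [ContinuousMap.add_apply, ContinuousMap.add_apply,
      h m m' fun x hx => hm x (Finset.mem_union_left _ hx),
      h' m m' fun x hx => hm x (Finset.mem_union_right _ hx)]
  algebraMap_mem' r := ⟨∅, fun _ _ _ => rfl⟩

variable (ν : Measure (Set.Icc C⁻¹ C)) [IsProbabilityMeasure ν]

/-- The space of continuous cylinder functions of the disorder, with the inner product
`E[a b]`. -/
def Coef (_ν : Measure (Set.Icc C⁻¹ C)) : Type := coefAlg C

instance : AddCommGroup (Coef ν) := inferInstanceAs (AddCommGroup (coefAlg C))

instance : Module ℝ (Coef ν) := inferInstanceAs (Module ℝ (coefAlg C))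

variable {ν}

/-- The underlying continuous function. -/
def Coef.toMap (a : Coef ν) : C(Disorder C, ℝ) := (show coefAlg C from a).1

instance : CoeFun (Coef ν) (fun _ => Disorder C → ℝ) := ⟨fun a => a.toMap⟩

theorem Coef.ext {a b : Coef ν} (h : ∀ m, a m = b m) : a = b :=
  Subtype.ext (ContinuousMap.ext h)

theorem Coef.cylinder (a : Coef ν) :
    ∃ Λ : Finset ℤ, ∀ m m' : Disorder C, (∀ x ∈ Λ, m x = m' x) → a m = a m' :=
  (show coefAlg C from a).2

@[simp] theorem Coef.add_apply (a b : Coef ν) (m : Disorder C) : (a + b) m = a m + b m := rfl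

@[simp] theorem Coef.smul_apply (r : ℝ) (a : Coef ν) (m : Disorder C) : (r • a) m = r * a m := rfl

theorem Coef.abs_apply_le (a : Coef ν) (m : Disorder C) : |a m| ≤ ‖a.toMap‖ :=
  a.toMap.norm_coe_le_norm m

theorem Coef.measurable (a : Coef ν) : Measurable (fun m => a m) := a.toMap.continuous.measurable

theorem Coef.integrable_mul (a b : Coef ν) :
    Integrable (fun m => a m * b m) (disorderLaw ν) :=
  Integrable.of_bound (a.measurable.mul b.measurable).aestronglyMeasurable
    (‖a.toMap‖ * ‖b.toMap‖) (Eventually.of_forall fun m => by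
      rw [norm_mul]
      exact mul_le_mul (a.abs_apply_le m) (b.abs_apply_le m) (norm_nonneg _) (norm_nonneg _))

variable (ν)

/-- The inner product `E[a b]`. -/
@[reducible] def coefCore : PreInnerProductSpace.Core ℝ (Coef ν) where
  inner a b := ∫ m, a m * b m ∂disorderLaw ν
  conj_inner_symm a b := by simp [mul_comm]
  re_inner_nonneg a := by
    simpa using integral_nonneg fun m => mul_self_nonneg (a m)
  add_left a b c := by
    rw [← integral_add (a.integrable_mul c) (b.integrable_mul c)]
    simp only [Coef.add_apply, add_mul]
  smul_left a b r := by
    simp only [Coef.smul_apply, mul_assoc, integral_const_mul]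
    rfl

instance : SeminormedAddCommGroup (Coef ν) :=
  @InnerProductSpace.Core.toSeminormedAddCommGroup ℝ (Coef ν) _ _ _ (coefCore ν)

instance : InnerProductSpace ℝ (Coef ν) := InnerProductSpace.ofCore (coefCore ν)

variable {ν}

theorem inner_coef (a b : Coef ν) : inner ℝ a b = ∫ m, a m * b m ∂disorderLaw ν := rfl

/-- Translation of a function of the disorder. -/
def transl (y : ℤ) : Coef ν →ₗ[ℝ] Coef ν where
  toFun a := show coefAlg C from ⟨a.toMap.comp ⟨fun m z => m (y + z), by fun_prop⟩, by
    obtain ⟨Λ, h⟩ := a.cylinder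
    exact ⟨Λ.image (y + ·), fun m m' hm => h _ _ fun x hx =>
      hm _ (Finset.mem_image_of_mem _ hx)⟩⟩
  map_add' _ _ := rfl
  map_smul' _ _ := rfl

theorem transl_apply (y : ℤ) (a : Coef ν) (m : Disorder C) :
    transl y a m = a (fun z => m (y + z)) := rfl

theorem transl_transl (x y : ℤ) (a : Coef ν) : transl x (transl y a) = transl (x + y) a := by
  refine Coef.ext fun m => ?_
  simp only [transl_apply]
  congr 1
  funext z
  rw [add_assoc]

theorem transl_zero (a : Coef ν) : transl 0 a = a := by
  refine Coef.ext fun m => ?_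
  simp only [transl_apply, zero_add]

theorem inner_transl (y : ℤ) (a b : Coef ν) :
    inner ℝ (transl y a) (transl y b) = inner ℝ a b := by
  have h1 : MeasurePreserving (fun (m : Disorder C) z => m (y + z))
      (disorderLaw ν) (disorderLaw ν) :=
    ⟨by fun_prop, Measure.map_infinitePi_infinitePi_of_inj (P := fun _ : ℤ => ν)
      (add_right_injective y)⟩
  rw [inner_coef, inner_coef]
  conv_rhs => rw [← h1.map_eq]
  exact (integral_map h1.measurable.aemeasurable
    (a.measurable.mul b.measurable).aestronglyMeasurable).symm

theorem bond_nonneg (m : Disorder C) (y : ℤ) : 0 ≤ bond m y := by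
  unfold bond
  positivity

theorem bond_le (hC : 0 < C) (m : Disorder C) (y : ℤ) : bond m y ≤ C := by
  obtain ⟨h0, h0'⟩ := mem_bounds hC (m y)
  obtain ⟨h1, h1'⟩ := mem_bounds hC (m (y + 1))
  refine inv_le_of_inv_le₀ hC (Real.le_sqrt_of_sq_le ?_)
  rw [sq]
  exact mul_le_mul h0 h1 (inv_pos.2 hC).le h0'.le

theorem continuous_bond (hC : 0 < C) (y : ℤ) : Continuous (fun m : Disorder C => bond m y) := by
  unfold bond
  refine Continuous.inv₀ (by fun_prop) fun m => ?_
  exact (Real.sqrt_pos.2 (mul_pos (mem_bounds hC (m y)).2 (mem_bounds hC (m (y + 1))).2)).ne'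

/-- Multiplication by the conductance of a bond. -/
def mulBond (hC : 0 < C) (y : ℤ) : Coef ν →ₗ[ℝ] Coef ν where
  toFun a := show coefAlg C from ⟨⟨fun m => bond m y, continuous_bond hC y⟩ * a.toMap,
    (coefAlg C).mul_mem ⟨{y, y + 1}, fun m m' h => by
      simp only [ContinuousMap.coe_mk, bond, h y (by simp), h (y + 1) (by simp)]⟩
      (show coefAlg C from a).2⟩
  map_add' a b := Subtype.ext (mul_add _ a.toMap b.toMap)
  map_smul' r a := Subtype.ext (mul_smul_comm r _ a.toMap)

theorem mulBond_apply (hC : 0 < C) (y : ℤ) (a : Coef ν) (m : Disorder C) :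
    mulBond hC y a m = bond m y * a m := rfl

theorem transl_mulBond (hC : 0 < C) (x y : ℤ) (a : Coef ν) :
    transl x (mulBond hC y a) = mulBond hC (x + y) (transl x a) := by
  refine Coef.ext fun m => ?_
  simp only [transl_apply, mulBond_apply, bond, add_assoc]

theorem inner_mulBond (hC : 0 < C) (y : ℤ) (a b : Coef ν) :
    inner ℝ (mulBond hC y a) b = inner ℝ a (mulBond hC y b) := by
  simp only [inner_coef, mulBond_apply]
  refine integral_congr_ae (Eventually.of_forall fun m => ?_)
  ring

theorem norm_mulBond_le (hC : 0 < C) (y : ℤ) (a : Coef ν) : ‖mulBond hC y a‖ ≤ C * ‖a‖ := by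
  refine abs_le_of_sq_le_sq' ?_ (by positivity) |>.2
  rw [mul_pow, ← real_inner_self_eq_norm_sq, ← real_inner_self_eq_norm_sq, inner_coef, inner_coef,
    ← integral_const_mul]
  refine integral_mono ((mulBond hC y a).integrable_mul _) ((a.integrable_mul a).const_mul _)
    fun m => ?_
  simp only [mulBond_apply]
  have h := mul_self_nonneg (a m)
  have h2 : bond m y * bond m y ≤ C * C :=
    mul_le_mul (bond_le hC m y) (bond_le hC m y) (bond_nonneg m y) hC.le
  nlinarith

/-- Supremum norms accompany the mean-square norms because correlations along a process, whose
coefficients depend on the same disorder, are bounded by pointwise bounds on the coefficients. -/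
theorem supNorm_transl_le (y : ℤ) (a : Coef ν) : ‖(transl y a).toMap‖ ≤ ‖a.toMap‖ :=
  (ContinuousMap.norm_le _ (norm_nonneg _)).2 fun _ => a.abs_apply_le _

theorem supNorm_mulBond_le (hC : 0 < C) (y : ℤ) (a : Coef ν) :
    ‖(mulBond hC y a).toMap‖ ≤ C * ‖a.toMap‖ := by
  refine (ContinuousMap.norm_le _ (by positivity)).2 fun m => ?_
  have h := mulBond_apply hC y a m
  rw [h, norm_mul, Real.norm_of_nonneg (bond_nonneg m y)]
  exact mul_le_mul (bond_le hC m y) (a.abs_apply_le m) (norm_nonneg _) hC.le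

end Coefficients

/-! ### Quadratic functions and their reduced coefficients in `𝐋²_⋆`. -/

section Quadratic

variable (ν : Measure (Set.Icc C⁻¹ C))

/-- Quadratic functions `∑ a_{x,k}(m) quad x k`, given by their coefficients. -/
abbrev QuadSpace : Type := (ℤ × ℕ) →₀ Coef ν

variable {ν} [IsProbabilityMeasure ν]

theorem isLocal_mono (a : Coef ν) (x : ℤ) (k : ℕ) :
    IsLocal ν (fun p : Disorder C × Config => a p.1 * quad x k p.2) := by
  have hmeas : Measurable (fun p : Disorder C × Config => a p.1 * quad x k p.2) :=
    (a.measurable.comp measurable_fst).mul ((measurable_quad x k).comp measurable_snd)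
  refine ⟨hmeas, ?_, fun ω => a.toMap.continuous.mul (continuous_const (y := quad x k ω)),
    fun m => (memLp_quad x k).const_mul (a m), fun m => ?_, ?_⟩
  · obtain ⟨Λ, h⟩ := a.cylinder
    refine ⟨Λ ∪ {x, x + (k : ℤ)}, fun p q hpq => ?_⟩
    beta_reduce
    rw [h p.1 q.1 fun z hz => (hpq z (Finset.mem_union_left _ hz)).1,
      quad_congr (hpq x (by simp)).2 (hpq (x + k) (by simp)).2]
  · simp only [integral_const_mul, integral_quad, mul_zero]
  · have h : MemLp (fun p : Disorder C × Config => quad x k p.2) 2 (annealed ν) :=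
      (memLp_quad x k).comp_measurePreserving measurePreserving_snd
    refine h.of_le_mul (c := ‖a.toMap‖) hmeas.aestronglyMeasurable
      (Eventually.of_forall fun p => ?_)
    rw [norm_mul]
    exact mul_le_mul_of_nonneg_right (a.abs_apply_le p.1) (norm_nonneg _)

/-- The local function `a(m) quad x k ω`. -/
def mono (i : ℤ × ℕ) : Coef ν →ₗ[ℝ] LocalFun ν where
  toFun a := show localSubmodule ν from
    ⟨fun p => a p.1 * quad i.1 i.2 p.2, isLocal_mono a i.1 i.2⟩
  map_add' _ _ := LocalFun.ext fun _ => add_mul _ _ _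
  map_smul' _ _ := LocalFun.ext fun _ => mul_assoc _ _ _

theorem mono_apply (i : ℤ × ℕ) (a : Coef ν) (p : Disorder C × Config) :
    mono i a p = a p.1 * quad i.1 i.2 p.2 := rfl

/-- The local function with given quadratic coefficients. -/
def realize : QuadSpace ν →ₗ[ℝ] LocalFun ν := Finsupp.lsum ℝ mono

theorem realize_single (i : ℤ × ℕ) (a : Coef ν) :
    realize (Finsupp.single i a) = mono i a := by
  simp [realize]

/-- Disorder and configuration factorize, and distinct monomials are orthogonal. -/
theorem integral_mono_mul_mono_shift (x y z : ℤ) (k l : ℕ) (a b : Coef ν) :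
    ∫ p, mono (x, k) a p * mono (y, l) b (shift z p) ∂annealed ν
      = if x = z + y ∧ k = l then (if k = 0 then 2 else 1) * inner ℝ a (transl z b) else 0 := by
  have e : ∀ p : Disorder C × Config, mono (x, k) a p * mono (y, l) b (shift z p)
      = (a p.1 * transl z b p.1) * (quad x k p.2 * quad (z + y) l p.2) := fun p => by
    simp only [mono_apply, shift, transl_apply, quad, add_assoc]
    ring
  simp only [e]
  rw [annealed, integral_prod_mul (fun m => a m * transl z b m)
    (fun ω => quad x k ω * quad (z + y) l ω), ← inner_coef]
  split_ifs with h
  · obtain ⟨rfl, rfl⟩ := h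
    rw [integral_quad_mul_self, mul_comm]
    simp_all
  · obtain ⟨rfl, rfl⟩ := h
    rw [integral_quad_mul_self, mul_comm]
    simp_all
  · rw [integral_quad_mul_quad_of_ne h, mul_zero]

/-- The coefficients of a quadratic function modulo translations. -/
def reduce : QuadSpace ν →ₗ[ℝ] (ℕ →₀ Coef ν) :=
  Finsupp.lsum ℝ fun i : ℤ × ℕ => (Finsupp.lsingle i.2).comp (transl (-i.1))

theorem reduce_single (i : ℤ × ℕ) (a : Coef ν) :
    reduce (Finsupp.single i a) = Finsupp.single i.2 (transl (-i.1) a) := by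
  simp [reduce]

/-- The weight `E[(quad x k)²]`. -/
def weight (k : ℕ) : ℝ := if k = 0 then 2 else 1

/-- The inner product of reduced coefficients. -/
def coefForm : (ℕ →₀ Coef ν) →ₗ[ℝ] (ℕ →₀ Coef ν) →ₗ[ℝ] ℝ :=
  Finsupp.lsum ℝ fun k => weight k • ((Finsupp.lapply k).lcomp ℝ ℝ).comp (innerₗ (Coef ν))

theorem coefForm_single (k : ℕ) (a : Coef ν) (φ : ℕ →₀ Coef ν) :
    coefForm (Finsupp.single k a) φ = weight k * inner ℝ a (φ k) := by
  simp [coefForm]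

theorem semiInner_mono (x y : ℤ) (k l : ℕ) (a b : Coef ν) :
    semiInner (mono (x, k) a) (mono (y, l) b)
      = if k = l then weight k * inner ℝ (transl (-x) a) (transl (-y) b) else 0 := by
  unfold semiInner
  simp only [integral_mono_mul_mono_shift]
  rw [tsum_eq_single (x - y)]
  · have h1 : inner ℝ (transl (-x) a) (transl (-y) b) = inner ℝ a (transl (x - y) b) := by
      rw [← inner_transl x, transl_transl, transl_transl, add_neg_cancel, transl_zero]
      rfl
    by_cases h : k = l
    · simp [h, h1, weight]
    · simp [h]
  · intro z hz
    have : ¬ (x = z + y ∧ k = l) := by omega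
    simp [this]

/-- The sum over translations matches two monomials of equal range at exactly one shift, so only
coefficients transported to the origin matter. All later estimates are thereby estimates on
sequences of disorder functions. -/
theorem semiInner_realize (a b : QuadSpace ν) :
    semiInner (realize a) (realize b) = coefForm (reduce a) (reduce b) := by
  rw [← inner_localFun]
  induction a using Finsupp.induction_linear with
  | zero => simp
  | add a a' h h' => rw [map_add, map_add, inner_add_left, h, h', map_add, LinearMap.add_apply]
  | single i α =>
    induction b using Finsupp.induction_linear with
    | zero => simp
    | add b b' h h' => rw [map_add, map_add, inner_add_right, h, h', map_add]
    | single i' β =>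
      obtain ⟨x, k⟩ := i
      obtain ⟨y, l⟩ := i'
      rw [realize_single, realize_single, reduce_single, reduce_single, coefForm_single,
        inner_localFun, semiInner_mono]
      by_cases h : k = l
      · subst h; simp
      · rw [if_neg h, Finsupp.single_eq_of_ne h, inner_zero_right, mul_zero]

theorem coefForm_eq_sum (ψ φ : ℕ →₀ Coef ν) {N : ℕ} (hN : ∀ k, N < k → ψ k = 0) :
    coefForm ψ φ = 2 * inner ℝ (ψ 0) (φ 0)
      + ∑ k ∈ Finset.range N, inner ℝ (ψ (k + 1)) (φ (k + 1)) := by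
  have h1 : coefForm ψ φ = ψ.sum fun k a => weight k * inner ℝ a (φ k) := by
    rw [coefForm, Finsupp.lsum_apply, Finsupp.sum, Finsupp.sum, LinearMap.sum_apply]
    simp
  rw [h1, Finsupp.sum_of_support_subset ψ (s := Finset.range (N + 1)) ?_ _ (by simp),
    Finset.sum_range_succ', add_comm]
  · simp [weight]
  · intro k hk
    rw [Finset.mem_range]
    by_contra h
    exact (Finsupp.mem_support_iff.1 hk) (hN k (by omega))

end Quadratic

end DisorderedChain

namespace DisorderedChain

variable {C : ℝ} {ν : Measure (Set.Icc C⁻¹ C)} [IsProbabilityMeasure ν]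

/-! ### The generator in coefficients: a tridiagonal operator in the range. -/

section QuadGenerator

/-- The action of the generator on the monomials `a(m) quad x k ω`. -/
def genMono (hC : 0 < C) (lam γ : ℝ) : ℤ × ℕ → Coef ν →ₗ[ℝ] QuadSpace ν
  | (x, 0) => (2 : ℝ) • (Finsupp.lsingle (x, 1) ∘ₗ mulBond hC x
      - Finsupp.lsingle (x - 1, 1) ∘ₗ mulBond hC (x - 1))
    + lam • (Finsupp.lsingle (x + 1, 0) + Finsupp.lsingle (x - 1, 0)
      - (2 : ℝ) • Finsupp.lsingle (x, 0))
  -- Exchanging the two occupied neighbours does nothing, so only two exchange moves act here,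
  -- against four at larger ranges. The constants in the two squares produced by the Hamiltonian
  -- part cancel.
  | (x, 1) => Finsupp.lsingle (x + 1, 0) ∘ₗ mulBond hC x
    - Finsupp.lsingle (x - 1, 2) ∘ₗ mulBond hC (x - 1)
    + Finsupp.lsingle (x, 2) ∘ₗ mulBond hC (x + 1) - Finsupp.lsingle (x, 0) ∘ₗ mulBond hC x
    - (4 * γ) • Finsupp.lsingle (x, 1)
    + lam • (Finsupp.lsingle (x - 1, 2) + Finsupp.lsingle (x, 2)
      - (2 : ℝ) • Finsupp.lsingle (x, 1))
  | (x, j + 2) => Finsupp.lsingle (x + 1, j + 1) ∘ₗ mulBond hC x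
    - Finsupp.lsingle (x - 1, j + 3) ∘ₗ mulBond hC (x - 1)
    + Finsupp.lsingle (x, j + 3) ∘ₗ mulBond hC (x + (j + 2 : ℕ))
    - Finsupp.lsingle (x, j + 1) ∘ₗ mulBond hC (x + (j + 1 : ℕ))
    - (4 * γ) • Finsupp.lsingle (x, j + 2)
    + lam • (Finsupp.lsingle (x + 1, j + 1) + Finsupp.lsingle (x - 1, j + 3)
      + Finsupp.lsingle (x, j + 1) + Finsupp.lsingle (x, j + 3)
      - (4 : ℝ) • Finsupp.lsingle (x, j + 2))

/-- The generator on quadratic functions. -/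
def genQuad (hC : 0 < C) (lam γ : ℝ) : QuadSpace ν →ₗ[ℝ] QuadSpace ν :=
  Finsupp.lsum ℝ (genMono hC lam γ)

theorem genQuad_single (hC : 0 < C) (lam γ : ℝ) (i : ℤ × ℕ) (a : Coef ν) :
    genQuad hC lam γ (Finsupp.single i a) = genMono hC lam γ i a := by
  simp [genQuad]

/-- The part of the Hamiltonian generator which increases the range of a monomial. -/
def up (hC : 0 < C) (k : ℕ) : Coef ν →ₗ[ℝ] Coef ν := mulBond hC k - mulBond hC 0 ∘ₗ transl 1

/-- The part of the Hamiltonian generator which decreases the range of a monomial. -/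
def down (hC : 0 < C) (k : ℕ) : Coef ν →ₗ[ℝ] Coef ν :=
  transl (-1) ∘ₗ mulBond hC 0 - mulBond hC k

theorem up_apply (hC : 0 < C) (k : ℕ) (a : Coef ν) :
    up hC k a = mulBond hC k a - mulBond hC 0 (transl 1 a) := rfl

theorem down_apply (hC : 0 < C) (k : ℕ) (a : Coef ν) :
    down hC k a = transl (-1) (mulBond hC 0 a) - mulBond hC k a := rfl

theorem inner_transl_neg (a b : Coef ν) :
    inner ℝ (transl (-1) a) b = inner ℝ a (transl 1 b) := by
  rw [← inner_transl 1, transl_transl, add_neg_cancel, transl_zero]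

/-- Stationarity of the disorder makes translations unitary and conductances act symmetrically: this
is the antisymmetry of the Hamiltonian part, range by range. -/
theorem inner_down (hC : 0 < C) (k : ℕ) (a b : Coef ν) :
    inner ℝ (down hC k a) b = -inner ℝ a (up hC k b) := by
  rw [down_apply, up_apply, inner_sub_left, inner_sub_right, inner_transl_neg, inner_mulBond,
    inner_mulBond]
  ring

theorem norm_transl (y : ℤ) (a : Coef ν) : ‖transl y a‖ = ‖a‖ := by
  rw [norm_eq_sqrt_real_inner, norm_eq_sqrt_real_inner, inner_transl]

theorem norm_up_le (hC : 0 < C) (k : ℕ) (a : Coef ν) : ‖up hC k a‖ ≤ 2 * C * ‖a‖ := by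
  rw [up_apply]
  have h1 := norm_mulBond_le hC k a
  have h2 := norm_mulBond_le hC 0 (transl 1 a)
  rw [norm_transl] at h2
  linarith [norm_sub_le (mulBond hC k a) (mulBond hC 0 (transl 1 a))]

/-- At range zero both terms carry the same conductance, which factors out and leaves a gradient.
Range zero has no flip gap, so the sector condition depends on this factorization. -/
theorem norm_up_zero_le (hC : 0 < C) (a : Coef ν) : ‖up hC 0 a‖ ≤ C * ‖a - transl 1 a‖ := by
  have e : up hC 0 a = mulBond hC 0 (a - transl 1 a) := by
    rw [up_apply, map_sub]
    rfl
  rw [e]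
  exact norm_mulBond_le hC 0 _

theorem transl_neg_succ (x : ℤ) (a : Coef ν) :
    transl (-1 + -x) a = transl (-1) (transl (-x) a) :=
  (transl_transl _ _ _).symm

theorem transl_neg_pred (x : ℤ) (a : Coef ν) :
    transl (1 - x) a = transl 1 (transl (-x) a) :=
  (transl_transl _ _ _).symm

theorem transl_neg_mulBond (hC : 0 < C) (x y : ℤ) (a : Coef ν) :
    transl (-x) (mulBond hC (x + y) a) = mulBond hC y (transl (-x) a) := by
  rw [transl_mulBond]
  congr 2
  ring

theorem transl_neg_mulBond_self (hC : 0 < C) (x : ℤ) (a : Coef ν) :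
    transl (-x) (mulBond hC x a) = mulBond hC 0 (transl (-x) a) := by
  simpa using transl_neg_mulBond hC x 0 a

theorem transl_one_transl_neg_mulBond_pred (hC : 0 < C) (x : ℤ) (a : Coef ν) :
    transl 1 (transl (-x) (mulBond hC (x - 1) a)) = mulBond hC 0 (transl 1 (transl (-x) a)) := by
  rw [← transl_neg_pred, ← neg_sub, transl_neg_mulBond_self, neg_sub, transl_neg_pred]

/-- Here and in the next two lemmas, recentring a monomial moved by one site leaves a unit
translation of its coefficient. Flips do not act on range zero, and exchanges do not couple it to
range one. -/
theorem reduce_genQuad_zero (hC : 0 < C) (lam γ : ℝ) (a : QuadSpace ν) :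
    reduce (genQuad hC lam γ a) 0 = down hC 0 (reduce a 1)
      + lam • (transl (-1) (reduce a 0) + transl 1 (reduce a 0) - (2 : ℝ) • reduce a 0) := by
  induction a using Finsupp.induction_linear with
  | zero => simp
  | add a b ha hb =>
    simp only [map_add, Finsupp.add_apply, ha, hb]
    module
  | single i α =>
    rw [genQuad_single]
    match i with
    | (x, 0) =>
      simp [genMono, reduce_single, transl_neg_succ, transl_neg_pred]
    | (x, 1) =>
      simp [genMono, reduce_single, down_apply, transl_neg_succ, transl_neg_mulBond_self]
    | (x, j + 2) => simp [genMono, reduce_single]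

theorem reduce_genQuad_one (hC : 0 < C) (lam γ : ℝ) (a : QuadSpace ν) :
    reduce (genQuad hC lam γ a) 1 = (2 : ℝ) • up hC 0 (reduce a 0)
      - (4 * γ + 2 * lam) • reduce a 1 + down hC 1 (reduce a 2)
      + lam • (transl (-1) (reduce a 2) + reduce a 2) := by
  induction a using Finsupp.induction_linear with
  | zero => simp
  | add a b ha hb =>
    simp only [map_add, Finsupp.add_apply, ha, hb]
    module
  | single i α =>
    rw [genQuad_single]
    match i with
    | (x, 0) =>
      simp [genMono, reduce_single, up_apply, transl_neg_pred, transl_neg_mulBond_self,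
        transl_one_transl_neg_mulBond_pred]
    | (x, 1) =>
      simp [genMono, reduce_single]
      module
    | (x, 0 + 2) =>
      simp [genMono, reduce_single, down_apply, transl_neg_succ, transl_neg_mulBond_self,
        transl_neg_mulBond]
    | (x, j + 3) => simp [genMono, reduce_single]

theorem reduce_genQuad_add_two (hC : 0 < C) (lam γ : ℝ) (a : QuadSpace ν) (n : ℕ) :
    reduce (genQuad hC lam γ a) (n + 2) = up hC (n + 1) (reduce a (n + 1))
      + lam • (transl 1 (reduce a (n + 1)) + reduce a (n + 1))
      - (4 * γ + 4 * lam) • reduce a (n + 2) + down hC (n + 2) (reduce a (n + 3))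
      + lam • (transl (-1) (reduce a (n + 3)) + reduce a (n + 3)) := by
  induction a using Finsupp.induction_linear with
  | zero => simp
  | add a b ha hb =>
    simp only [map_add, Finsupp.add_apply, ha, hb]
    module
  | single i α =>
    rw [genQuad_single]
    match i with
    | (x, 0) => simp [genMono, reduce_single]
    | (x, 1) =>
      by_cases h : n = 0
      · subst h
        simp [genMono, reduce_single, up_apply, transl_neg_pred, transl_neg_mulBond,
          transl_one_transl_neg_mulBond_pred]
        module
      · simp [genMono, reduce_single, h]
    | (x, j + 2) =>
      by_cases h : n = j
      · subst h
        simp [genMono, reduce_single]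
        module
      by_cases h1 : n = j + 1
      · subst h1
        simp [genMono, reduce_single, up_apply, transl_neg_pred, transl_neg_mulBond,
          transl_one_transl_neg_mulBond_pred]
        rw [show (j : ℤ) + 1 + 1 = j + 2 by ring]
        abel
      by_cases h2 : j = n + 1
      · subst h2
        simp [genMono, reduce_single, down_apply, transl_neg_succ, transl_neg_mulBond_self,
          transl_neg_mulBond]
        rw [show (n : ℤ) + 1 + 1 = n + 2 by ring]
      have h3 : j + 1 ≠ n + 2 := by omega
      have h4 : j + 3 ≠ n + 2 := by omega
      have h5 : j + 2 ≠ n + 1 := by omega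
      have h6 : j + 2 ≠ n + 3 := by omega
      have h7 : j + 2 ≠ n + 2 := by omega
      have h8 : j ≠ n := Ne.symm h
      simp [genMono, reduce_single, h2, h4, h5, h8]

end QuadGenerator

end DisorderedChain

namespace DisorderedChain

variable {C : ℝ} {ν : Measure (Set.Icc C⁻¹ C)} [IsProbabilityMeasure ν]

/-! ### Dirichlet form, sector condition and bound on the current. -/

section Estimates

theorem exists_support_bound (ψ : ℕ →₀ Coef ν) : ∃ N, ∀ k, N < k → ψ k = 0 := by
  refine ⟨ψ.support.sup id, fun k hk => ?_⟩
  by_contra h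
  exact absurd (Finset.le_sup (f := id) (Finsupp.mem_support_iff.2 h)) (by simpa using hk)

/-- The exchange part of the Dirichlet form between the ranges `k` and `k + 1`. -/
def exchForm (ψ φ : ℕ →₀ Coef ν) (k : ℕ) : ℝ :=
  inner ℝ (ψ k - ψ (k + 1)) (φ k - φ (k + 1))
    + inner ℝ (transl 1 (ψ k) - ψ (k + 1)) (transl 1 (φ k) - φ (k + 1))

theorem exchForm_eq (ψ φ : ℕ →₀ Coef ν) (k : ℕ) :
    exchForm ψ φ k = 2 * inner ℝ (ψ k) (φ k) + 2 * inner ℝ (ψ (k + 1)) (φ (k + 1))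
      - inner ℝ (transl 1 (ψ k) + ψ k) (φ (k + 1))
      - inner ℝ (ψ (k + 1)) (transl 1 (φ k) + φ k) := by
  simp only [exchForm, inner_sub_left, inner_sub_right, inner_add_left, inner_add_right,
    inner_transl]
  ring

/-- The contribution of the monomials of range `k` to the bilinear form of the generator. -/
def rangeForm (hC : 0 < C) (lam γ : ℝ) (ψ φ : ℕ →₀ Coef ν) (k : ℕ) : ℝ :=
  -(4 * γ) * inner ℝ (ψ k) (φ k) + (inner ℝ (up hC k (ψ k)) (φ (k + 1))
    - inner ℝ (ψ (k + 1)) (up hC k (φ k))) - lam * exchForm ψ φ k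

/-- The bilinear form of the generator on quadratic functions. -/
theorem coefForm_genQuad (hC : 0 < C) (lam γ : ℝ) (a b : QuadSpace ν) {N : ℕ}
    (ha : ∀ k, N < k → reduce a k = 0) (hb : ∀ k, N < k → reduce b k = 0) :
    coefForm (reduce (genQuad hC lam γ a)) (reduce b)
      = -(2 * lam) * inner ℝ (reduce a 0 - transl 1 (reduce a 0))
          (reduce b 0 - transl 1 (reduce b 0))
        + 2 * inner ℝ (up hC 0 (reduce a 0)) (reduce b 1)
        - 2 * inner ℝ (reduce a 1) (up hC 0 (reduce b 0))
        + ∑ k ∈ Finset.range (N + 1), rangeForm hC lam γ (reduce a) (reduce b) (k + 1) := by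
  -- The generator raises the range by at most one.
  have hχ : ∀ k, N + 1 < k → reduce (genQuad hC lam γ a) k = 0 := by
    intro k hk
    obtain ⟨n, rfl⟩ : ∃ n, k = n + 2 := ⟨k - 2, by omega⟩
    rw [reduce_genQuad_add_two, ha (n + 1) (by omega), ha (n + 2) (by omega),
      ha (n + 3) (by omega)]
    simp
  rw [coefForm_eq_sum _ _ hχ]
  set ψ := reduce a
  set φ := reduce b
  -- Summation by parts: terms coupling ranges `k` and `k + 1` are attributed to the lower range,
  -- leaving a boundary term that vanishes at `n = N` because `φ (N + 2) = 0`.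
  have hpart : ∀ n, ∑ k ∈ Finset.range (n + 1),
      inner ℝ (reduce (genQuad hC lam γ a) (k + 1)) (φ (k + 1))
      = 2 * inner ℝ (up hC 0 (ψ 0)) (φ 1)
        + ∑ k ∈ Finset.range (n + 1), rangeForm hC lam γ ψ φ (k + 1)
        - (inner ℝ (up hC (n + 1) (ψ (n + 1))) (φ (n + 2))
          + lam * inner ℝ (transl 1 (ψ (n + 1)) + ψ (n + 1)) (φ (n + 2))
          - 2 * lam * inner ℝ (ψ (n + 2)) (φ (n + 2))) := by
    intro n
    induction n with
    | zero =>
      simp only [zero_add, Finset.range_one, Finset.sum_singleton, rangeForm, exchForm_eq,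
        reduce_genQuad_one, inner_add_left, inner_sub_left, real_inner_smul_left, inner_down,
        inner_transl_neg, inner_add_right, Nat.reduceAdd]
      ring
    | succ n ih =>
      rw [Finset.sum_range_succ, ih, Finset.sum_range_succ _ (n + 1)]
      simp only [rangeForm, exchForm_eq, add_assoc, Nat.reduceAdd,
        reduce_genQuad_add_two, inner_add_left, inner_sub_left, real_inner_smul_left, inner_down,
        inner_transl_neg, inner_add_right]
      ring
  rw [hpart, hb (N + 2) (by omega), reduce_genQuad_zero]
  simp only [inner_zero_right, inner_add_left, inner_sub_left, inner_sub_right,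
    real_inner_smul_left, inner_down, inner_transl_neg, inner_transl]
  have e : inner ℝ (transl 1 (ψ 0)) (φ 0) = inner ℝ (φ 0) (transl 1 (ψ 0)) := real_inner_comm _ _
  ring

theorem sum_mul_le_of_sq_le {N : ℕ} {α β : ℕ → ℝ} {s t : ℝ} (hs : 0 ≤ s) (ht : 0 ≤ t)
    (hα : ∑ k ∈ Finset.range N, α k ^ 2 ≤ s ^ 2) (hβ : ∑ k ∈ Finset.range N, β k ^ 2 ≤ t ^ 2) :
    ∑ k ∈ Finset.range N, α k * β k ≤ s * t := by
  refine (Real.sum_mul_le_sqrt_mul_sqrt _ _ _).trans ?_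
  exact mul_le_mul (Real.sqrt_le_iff.2 ⟨hs, hα⟩) (Real.sqrt_le_iff.2 ⟨ht, hβ⟩)
    (Real.sqrt_nonneg _) hs

/-- The off-diagonal norm of reduced coefficients up to the range `N`. -/
def offNorm (N : ℕ) (ψ : ℕ →₀ Coef ν) : ℝ := √(∑ k ∈ Finset.range (N + 1), ‖ψ (k + 1)‖ ^ 2)

theorem offNorm_nonneg (N : ℕ) (ψ : ℕ →₀ Coef ν) : 0 ≤ offNorm N ψ := Real.sqrt_nonneg _

theorem offNorm_sq (N : ℕ) (ψ : ℕ →₀ Coef ν) :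
    offNorm N ψ ^ 2 = ∑ k ∈ Finset.range (N + 1), ‖ψ (k + 1)‖ ^ 2 :=
  Real.sq_sqrt (Finset.sum_nonneg fun _ _ => sq_nonneg _)

theorem norm_one_le_offNorm (N : ℕ) (ψ : ℕ →₀ Coef ν) : ‖ψ 1‖ ≤ offNorm N ψ := by
  refine Real.le_sqrt_of_sq_le ?_
  exact Finset.single_le_sum (f := fun k => ‖ψ (k + 1)‖ ^ 2) (fun _ _ => sq_nonneg _)
    (Finset.mem_range.2 (Nat.succ_pos N))

/-- Shifting the index drops range one and adds range `N + 2`, whose coefficient is zero. -/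
theorem sum_sq_succ_le_offNorm {N : ℕ} {ψ : ℕ →₀ Coef ν} (hψ : ∀ k, N < k → ψ k = 0) :
    ∑ k ∈ Finset.range (N + 1), ‖ψ (k + 1 + 1)‖ ^ 2 ≤ offNorm N ψ ^ 2 := by
  rw [offNorm_sq, Finset.sum_range_succ, hψ (N + 1 + 1) (by omega),
    Finset.sum_range_succ' (fun k => ‖ψ (k + 1)‖ ^ 2)]
  simp only [norm_zero, ne_eq, OfNat.ofNat_ne_zero, not_false_eq_true, zero_pow, add_zero]
  exact le_add_of_nonneg_right (sq_nonneg _)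

/-- Range-zero coefficients enter the form only through their gradients, and the remaining terms
couple equal or neighbouring ranges, so Cauchy-Schwarz in the range suffices. -/
theorem abs_coefForm_genQuad_le (hC : 0 < C) {lam γ : ℝ} (hlam : 0 ≤ lam) (hγ : 0 ≤ γ)
    (a b : QuadSpace ν) {N : ℕ}
    (ha : ∀ k, N < k → reduce a k = 0) (hb : ∀ k, N < k → reduce b k = 0) :
    |coefForm (reduce (genQuad hC lam γ a)) (reduce b)| ≤ (8 * lam + 4 * γ + 4 * C)
      * (‖reduce a 0 - transl 1 (reduce a 0)‖ + offNorm N (reduce a))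
      * (‖reduce b 0 - transl 1 (reduce b 0)‖ + offNorm N (reduce b)) := by
  rw [coefForm_genQuad hC lam γ a b ha hb]
  set ψ := reduce a
  set φ := reduce b
  set g := ‖ψ 0 - transl 1 (ψ 0)‖ with hg
  set g' := ‖φ 0 - transl 1 (φ 0)‖ with hg'
  have hO := offNorm_nonneg N ψ
  have hO' := offNorm_nonneg N φ
  have h1 := norm_one_le_offNorm N ψ
  have h1' := norm_one_le_offNorm N φ
  have e0 := (offNorm_sq N ψ).symm.le
  have e0' := (offNorm_sq N φ).symm.le
  have e1 := sum_sq_succ_le_offNorm ha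
  have e1' := sum_sq_succ_le_offNorm hb
  set O := offNorm N ψ
  set O' := offNorm N φ
  have hg0 : 0 ≤ g := norm_nonneg _
  have hg0' : 0 ≤ g' := norm_nonneg _
  have t1 : |inner ℝ (ψ 0 - transl 1 (ψ 0)) (φ 0 - transl 1 (φ 0))| ≤ g * g' :=
    abs_real_inner_le_norm _ _
  have t2 : |inner ℝ (up hC 0 (ψ 0)) (φ 1)| ≤ C * g * O' :=
    (abs_real_inner_le_norm _ _).trans (mul_le_mul (norm_up_zero_le hC _) h1' (norm_nonneg _)
      (by positivity))
  have t3 : |inner ℝ (ψ 1) (up hC 0 (φ 0))| ≤ O * (C * g') :=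
    (abs_real_inner_le_norm _ _).trans (mul_le_mul h1 (norm_up_zero_le hC _) (norm_nonneg _) hO)
  have hr : ∀ k, |rangeForm hC lam γ ψ φ k| ≤ (4 * γ + 2 * lam) * (‖ψ k‖ * ‖φ k‖)
      + (2 * C + 2 * lam) * (‖ψ k‖ * ‖φ (k + 1)‖) + (2 * C + 2 * lam) * (‖ψ (k + 1)‖ * ‖φ k‖)
      + 2 * lam * (‖ψ (k + 1)‖ * ‖φ (k + 1)‖) := by
    intro k
    have u1 := abs_real_inner_le_norm (ψ k) (φ k)
    have u2 : |inner ℝ (up hC k (ψ k)) (φ (k + 1))| ≤ 2 * C * ‖ψ k‖ * ‖φ (k + 1)‖ :=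
      (abs_real_inner_le_norm _ _).trans
        (mul_le_mul_of_nonneg_right (norm_up_le hC k _) (norm_nonneg _))
    have u3 : |inner ℝ (ψ (k + 1)) (up hC k (φ k))| ≤ ‖ψ (k + 1)‖ * (2 * C * ‖φ k‖) :=
      (abs_real_inner_le_norm _ _).trans
        (mul_le_mul_of_nonneg_left (norm_up_le hC k _) (norm_nonneg _))
    have n1 : ∀ (χ : ℕ →₀ Coef ν), ‖χ k - χ (k + 1)‖ ≤ ‖χ k‖ + ‖χ (k + 1)‖ :=
      fun χ => norm_sub_le _ _
    have n2 : ∀ (χ : ℕ →₀ Coef ν), ‖transl 1 (χ k) - χ (k + 1)‖ ≤ ‖χ k‖ + ‖χ (k + 1)‖ :=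
      fun χ => (norm_sub_le _ _).trans (by rw [norm_transl])
    have u4 : |exchForm ψ φ k| ≤ 2 * ((‖ψ k‖ + ‖ψ (k + 1)‖) * (‖φ k‖ + ‖φ (k + 1)‖)) := by
      have v1 := (abs_real_inner_le_norm (ψ k - ψ (k + 1)) (φ k - φ (k + 1))).trans
        (mul_le_mul (n1 ψ) (n1 φ) (norm_nonneg _) (by positivity))
      have v2 := (abs_real_inner_le_norm (transl 1 (ψ k) - ψ (k + 1))
        (transl 1 (φ k) - φ (k + 1))).trans
        (mul_le_mul (n2 ψ) (n2 φ) (norm_nonneg _) (by positivity))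
      rw [exchForm]
      exact (abs_add_le _ _).trans (by linarith)
    have u5 : |rangeForm hC lam γ ψ φ k| ≤ 4 * γ * |inner ℝ (ψ k) (φ k)|
        + (|inner ℝ (up hC k (ψ k)) (φ (k + 1))| + |inner ℝ (ψ (k + 1)) (up hC k (φ k))|)
        + lam * |exchForm ψ φ k| := by
      rw [rangeForm]
      refine (abs_sub _ _).trans (add_le_add ((abs_add_le _ _).trans
        (add_le_add ?_ (abs_sub _ _))) ?_)
      · rw [abs_mul, abs_neg, abs_of_nonneg (by positivity : (0 : ℝ) ≤ 4 * γ)]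
      · rw [abs_mul, abs_of_nonneg hlam]
    have u6 : 4 * γ * |inner ℝ (ψ k) (φ k)| ≤ 4 * γ * (‖ψ k‖ * ‖φ k‖) := by gcongr
    have u7 := mul_le_mul_of_nonneg_left u4 hlam
    nlinarith
  have s1 := sum_mul_le_of_sq_le hO hO' e0 e0'
  have s2 := sum_mul_le_of_sq_le hO hO' e0 e1'
  have s3 := sum_mul_le_of_sq_le hO hO' e1 e0'
  have s4 := sum_mul_le_of_sq_le hO hO' e1 e1'
  have t4 : |∑ k ∈ Finset.range (N + 1), rangeForm hC lam γ ψ φ (k + 1)|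
      ≤ (4 * γ + 8 * lam + 4 * C) * (O * O') := by
    refine ((Finset.abs_sum_le_sum_abs _ _).trans (Finset.sum_le_sum fun k _ => hr (k + 1))).trans
      ?_
    simp only [Finset.sum_add_distrib, ← Finset.mul_sum]
    have := mul_le_mul_of_nonneg_left s1 (by positivity : 0 ≤ 4 * γ + 2 * lam)
    have := mul_le_mul_of_nonneg_left s2 (by positivity : 0 ≤ 2 * C + 2 * lam)
    have := mul_le_mul_of_nonneg_left s3 (by positivity : 0 ≤ 2 * C + 2 * lam)
    have := mul_le_mul_of_nonneg_left s4 (by positivity : 0 ≤ 2 * lam)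
    linarith
  have t5 : ∀ p q r s : ℝ, |-(2 * lam) * p + 2 * q - 2 * r + s|
      ≤ 2 * lam * |p| + 2 * |q| + 2 * |r| + |s| := fun p q r s => by
    refine (abs_add_le _ _).trans (add_le_add ((abs_sub _ _).trans (add_le_add
      ((abs_add_le _ _).trans (add_le_add ?_ ?_)) ?_)) le_rfl)
    · rw [abs_mul, abs_neg, abs_of_nonneg (by positivity : (0 : ℝ) ≤ 2 * lam)]
    · rw [abs_mul, abs_two]
    · rw [abs_mul, abs_two]
  refine (t5 _ _ _ _).trans ?_
  have t6 := mul_le_mul_of_nonneg_left t1 (by positivity : 0 ≤ 2 * lam)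
  have p1 := mul_nonneg hg0 hg0'
  have p2 := mul_nonneg hg0 hO'
  have p3 := mul_nonneg hO hg0'
  have q1 := mul_nonneg hC.le p1
  have q2 := mul_nonneg hC.le p2
  have q3 := mul_nonneg hC.le p3
  have r1 := mul_nonneg hγ p1
  have r2 := mul_nonneg hγ p2
  have r3 := mul_nonneg hγ p3
  have l1 := mul_nonneg hlam p1
  have l2 := mul_nonneg hlam p2
  have l3 := mul_nonneg hlam p3
  linarith

/-- On the diagonal the Hamiltonian terms cancel. The exchange noise supplies the gradient at range
zero, its contributions at higher ranges are nonnegative and dropped, and the flips supply the gap.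
-/
theorem le_neg_coefForm_genQuad_self (hC : 0 < C) {lam γ : ℝ} (hlam : 0 ≤ lam)
    (a : QuadSpace ν) {N : ℕ} (ha : ∀ k, N < k → reduce a k = 0) :
    2 * lam * ‖reduce a 0 - transl 1 (reduce a 0)‖ ^ 2 + 4 * γ * offNorm N (reduce a) ^ 2
      ≤ -coefForm (reduce (genQuad hC lam γ a)) (reduce a) := by
  rw [coefForm_genQuad hC lam γ a a ha ha, offNorm_sq, real_inner_self_eq_norm_sq,
    real_inner_comm (reduce a 1) (up hC 0 (reduce a 0))]
  have h : ∑ k ∈ Finset.range (N + 1), rangeForm hC lam γ (reduce a) (reduce a) (k + 1)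
      ≤ ∑ k ∈ Finset.range (N + 1), -(4 * γ) * ‖reduce a (k + 1)‖ ^ 2 := by
    refine Finset.sum_le_sum fun k _ => ?_
    rw [rangeForm, real_inner_self_eq_norm_sq, real_inner_comm (reduce a (k + 1 + 1)), sub_self]
    have h1 : 0 ≤ exchForm (reduce a) (reduce a) (k + 1) := by
      rw [exchForm, real_inner_self_eq_norm_sq, real_inner_self_eq_norm_sq]
      positivity
    nlinarith
  rw [← Finset.mul_sum] at h
  linarith

/-- The current as a quadratic function. -/
def currentQuad (ν : Measure (Set.Icc C⁻¹ C)) [IsProbabilityMeasure ν] (hC : 0 < C) :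
    QuadSpace ν :=
  Finsupp.single (0, 1) ((2 : ℝ) • mulBond hC 0 (show coefAlg C from 1))

theorem realize_currentQuad (hC : 0 < C) : realize (currentQuad ν hC) = current ν hC := by
  refine LocalFun.ext fun p => ?_
  rw [currentQuad, realize_single, mono_apply]
  have e : ((2 : ℝ) • mulBond hC 0 (show coefAlg C from 1) : Coef ν) p.1
      = 2 * (bond p.1 0 * 1) := rfl
  rw [e]
  simp [quad, bond, current, LocalFun.toFun, currentFun]
  ring

/-- The generator on quadratic functions is bounded and satisfies the sector condition, and the
current is controlled by the Dirichlet form. -/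
theorem exists_sector_bounds (hC : 0 < C) {lam γ : ℝ} (hlam : 0 < lam) (hγ : 0 < γ) :
    ∃ M K : ℝ, 0 ≤ M ∧ 0 ≤ K ∧ ∀ a b : QuadSpace ν,
      |semiInner (realize (genQuad hC lam γ a)) (realize b)| ≤ M * ‖realize a‖ * ‖realize b‖ ∧
      semiInner (realize (genQuad hC lam γ a)) (realize b) ^ 2
        ≤ K * (-semiInner (realize (genQuad hC lam γ a)) (realize a))
          * (-semiInner (realize (genQuad hC lam γ b)) (realize b)) ∧
      semiInner (current ν hC) (realize b) ^ 2
        ≤ K * (-semiInner (realize (genQuad hC lam γ b)) (realize b)) := by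
  set A := 8 * lam + 4 * γ + 4 * C with hA
  have hA0 : 0 < A := by positivity
  -- The smaller of the two Dirichlet constants; `(p + q)² ≤ 2 (p² + q²)` accounts for the factor `2
  -- / κ` below.
  set κ := min (2 * lam) (4 * γ) with hκ
  have hκ0 : 0 < κ := by positivity
  set c := ‖((2 : ℝ) • mulBond hC 0 (show coefAlg C from 1) : Coef ν)‖ with hc
  -- The factor `4` comes from bounding gradient plus off-diagonal norm by twice the full norm, for
  -- `a` and for `b`. The two summands of `K` serve the sector condition and the current.
  refine ⟨4 * A, (A * (2 / κ)) ^ 2 + c ^ 2 * (2 / κ), by positivity, by positivity,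
    fun a b => ?_⟩
  obtain ⟨N₁, hN₁⟩ := exists_support_bound (reduce a)
  obtain ⟨N₂, hN₂⟩ := exists_support_bound (reduce b)
  set N := max N₁ N₂
  have ha : ∀ k, N < k → reduce a k = 0 := fun k hk => hN₁ k ((le_max_left _ _).trans_lt hk)
  have hb : ∀ k, N < k → reduce b k = 0 := fun k hk => hN₂ k ((le_max_right _ _).trans_lt hk)
  have hab := abs_coefForm_genQuad_le hC hlam.le hγ.le a b ha hb
  have hnorm : ∀ d : QuadSpace ν, (∀ k, N < k → reduce d k = 0) →
      ‖realize d‖ ^ 2 = 2 * ‖reduce d 0‖ ^ 2 + offNorm N (reduce d) ^ 2 := by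
    intro d hd
    rw [← real_inner_self_eq_norm_sq, inner_localFun, semiInner_realize,
      coefForm_eq_sum _ _ (N := N + 1) fun k hk => hd k (by omega), offNorm_sq]
    simp only [real_inner_self_eq_norm_sq]
  have hE : ∀ d : QuadSpace ν, (∀ k, N < k → reduce d k = 0) →
      (‖reduce d 0 - transl 1 (reduce d 0)‖ + offNorm N (reduce d)) ^ 2
        ≤ 2 / κ * (-semiInner (realize (genQuad hC lam γ d)) (realize d)) := by
    intro d hd
    have h := le_neg_coefForm_genQuad_self hC (lam := lam) (γ := γ) hlam.le d hd
    rw [semiInner_realize, div_mul_eq_mul_div, le_div_iff₀ hκ0]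
    have h1 : κ ≤ 2 * lam := min_le_left _ _
    have h2 : κ ≤ 4 * γ := min_le_right _ _
    have h3 := mul_le_mul_of_nonneg_right h1 (sq_nonneg ‖reduce d 0 - transl 1 (reduce d 0)‖)
    have h4 := mul_le_mul_of_nonneg_right h2 (sq_nonneg (offNorm N (reduce d)))
    have h5 := mul_nonneg hκ0.le
      (sq_nonneg (‖reduce d 0 - transl 1 (reduce d 0)‖ - offNorm N (reduce d)))
    linarith
  have hB : ∀ d : QuadSpace ν, (∀ k, N < k → reduce d k = 0) →
      ‖reduce d 0 - transl 1 (reduce d 0)‖ + offNorm N (reduce d) ≤ 2 * ‖realize d‖ := by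
    intro d hd
    refine abs_le_of_sq_le_sq' ?_ (by positivity) |>.2
    rw [mul_pow, hnorm d hd]
    have h1 : ‖reduce d 0 - transl 1 (reduce d 0)‖ ≤ 2 * ‖reduce d 0‖ := by
      refine (norm_sub_le _ _).trans ?_
      rw [norm_transl]
      linarith
    have h2 := offNorm_nonneg N (reduce d)
    have h3 : (‖reduce d 0 - transl 1 (reduce d 0)‖ + offNorm N (reduce d)) ^ 2
        ≤ (2 * ‖reduce d 0‖ + offNorm N (reduce d)) ^ 2 := by gcongr
    nlinarith [sq_nonneg (2 * ‖reduce d 0‖ - offNorm N (reduce d)), sq_nonneg ‖reduce d 0‖,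
      sq_nonneg (offNorm N (reduce d))]
  set Ga := ‖reduce a 0 - transl 1 (reduce a 0)‖ + offNorm N (reduce a) with hGa
  set Gb := ‖reduce b 0 - transl 1 (reduce b 0)‖ + offNorm N (reduce b) with hGb
  have hGa0 : 0 ≤ Ga := add_nonneg (norm_nonneg _) (offNorm_nonneg _ _)
  have hGb0 : 0 ≤ Gb := add_nonneg (norm_nonneg _) (offNorm_nonneg _ _)
  have hEa := hE a ha
  have hEb := hE b hb
  have hEa0 : 0 ≤ -semiInner (realize (genQuad hC lam γ a)) (realize a) := by
    have := (sq_nonneg _).trans hEa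
    exact nonneg_of_mul_nonneg_right this (by positivity)
  have hEb0 : 0 ≤ -semiInner (realize (genQuad hC lam γ b)) (realize b) := by
    have := (sq_nonneg _).trans hEb
    exact nonneg_of_mul_nonneg_right this (by positivity)
  refine ⟨?_, ?_, ?_⟩
  · rw [semiInner_realize]
    refine hab.trans ?_
    calc A * Ga * Gb ≤ A * (2 * ‖realize a‖) * (2 * ‖realize b‖) := by
          gcongr
          · exact hB a ha
          · exact hB b hb
      _ = _ := by ring
  · have h1 : semiInner (realize (genQuad hC lam γ a)) (realize b) ^ 2 ≤ (A * Ga * Gb) ^ 2 := by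
      rw [semiInner_realize, ← sq_abs]
      gcongr
    refine h1.trans ?_
    calc (A * Ga * Gb) ^ 2 = A ^ 2 * (Ga ^ 2 * Gb ^ 2) := by ring
      _ ≤ A ^ 2 * ((2 / κ * (-semiInner (realize (genQuad hC lam γ a)) (realize a)))
          * (2 / κ * (-semiInner (realize (genQuad hC lam γ b)) (realize b)))) := by gcongr
      _ = (A * (2 / κ)) ^ 2 * (-semiInner (realize (genQuad hC lam γ a)) (realize a))
          * (-semiInner (realize (genQuad hC lam γ b)) (realize b)) := by ring
      _ ≤ _ := by
          gcongr
          exact le_add_of_nonneg_right (by positivity)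
  -- The current lives at range one alone, so its pairing never involves the uncontrolled range-zero
  -- coefficient.
  · have h1 : |semiInner (current ν hC) (realize b)| ≤ c * Gb := by
      rw [← realize_currentQuad, semiInner_realize, currentQuad, reduce_single, coefForm_single]
      simp only [weight, one_ne_zero, if_false, one_mul, neg_zero, transl_zero]
      refine (abs_real_inner_le_norm _ _).trans ?_
      gcongr
      exact (norm_one_le_offNorm N _).trans (le_add_of_nonneg_left (norm_nonneg _))
    calc semiInner (current ν hC) (realize b) ^ 2 ≤ (c * Gb) ^ 2 := by
          rw [← sq_abs]; gcongr
      _ = c ^ 2 * Gb ^ 2 := by ring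
      _ ≤ c ^ 2 * (2 / κ * (-semiInner (realize (genQuad hC lam γ b)) (realize b))) := by gcongr
      _ = c ^ 2 * (2 / κ) * (-semiInner (realize (genQuad hC lam γ b)) (realize b)) := by ring
      _ ≤ _ := by
          gcongr
          exact le_add_of_nonneg_left (by positivity)

end Estimates

end DisorderedChain

namespace DisorderedChain

variable {C : ℝ} {ν : Measure (Set.Icc C⁻¹ C)} [IsProbabilityMeasure ν]

/-! ### Verification that the coefficient formulas compute the generator. -/

section GeneratorOnQuadratics

theorem IsC1.exists_isC1On {f : Disorder C × Config → ℝ} (hf : IsC1 f) :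
    ∃ Λ, ∀ m, IsC1On Λ (fun ω => f (m, ω)) := hf

theorem finite_support_noise {θ : ℤ → Config → Config} (hθ : IsLocalNoise θ) (f : LocalFun ν)
    (p : Disorder C × Config) :
    (Function.support fun y : ℤ => f (p.1, θ y p.2) - f p).Finite := by
  obtain ⟨Λ, hΛ⟩ := f.isLocal.cylinder
  obtain ⟨S, hS⟩ := hθ.trivial Λ
  refine S.finite_toSet.subset fun y hy => ?_
  by_contra h
  refine hy (sub_eq_zero.2 (hΛ _ _ fun x hx => ⟨rfl, hS y (by simpa using h) _ x hx⟩))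

theorem noise_add {θ : ℤ → Config → Config} (hθ : IsLocalNoise θ) (f g : LocalFun ν)
    (p : Disorder C × Config) :
    ∑ᶠ y : ℤ, ((f + g) (p.1, θ y p.2) - (f + g) p)
      = ∑ᶠ y : ℤ, (f (p.1, θ y p.2) - f p) + ∑ᶠ y : ℤ, (g (p.1, θ y p.2) - g p) := by
  rw [← finsum_add_distrib (finite_support_noise hθ f p) (finite_support_noise hθ g p)]
  refine finsum_congr fun y => ?_
  exact add_sub_add_comm _ _ _ _

theorem isGen_add {lam γ : ℝ} {f g f' g' : LocalFun ν} (h : IsGen ν lam γ f g)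
    (h' : IsGen ν lam γ f' g') : IsGen ν lam γ (f + f') (g + g') := by
  obtain ⟨Λ, hΛ⟩ := h.1.exists_isC1On
  obtain ⟨Λ', hΛ'⟩ := h'.1.exists_isC1On
  have c : ∀ m, IsC1On (Λ ∪ Λ') (fun ω => f (m, ω)) := fun m =>
    (hΛ m).mono Finset.subset_union_left
  have c' : ∀ m, IsC1On (Λ ∪ Λ') (fun ω => f' (m, ω)) := fun m =>
    (hΛ' m).mono Finset.subset_union_right
  have cadd : ∀ m, IsC1On (Λ ∪ Λ') (fun ω => (f + f') (m, ω)) := fun m => by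
    obtain ⟨F, hF, hFe⟩ := c m
    obtain ⟨F', hF', hFe'⟩ := c' m
    exact ⟨F + F', hF.add hF', fun ω => congrArg₂ (· + ·) (hFe ω) (hFe' ω)⟩
  refine ⟨⟨Λ ∪ Λ', cadd⟩, fun p => ?_⟩
  have hA : genA (f + f').toFun p = genA f.toFun p + genA f'.toFun p := by
    obtain ⟨m, ω⟩ := p
    rw [genA_eq_drift, genA_eq_drift, genA_eq_drift, (cadd m).drift_eq_sum, (c m).drift_eq_sum,
      (c' m).drift_eq_sum, ← Finset.sum_add_distrib]
    refine Finset.sum_congr rfl fun y _ => ?_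
    have hd : HasDerivAt (fun t => f (m, Function.update ω y t) + f' (m, Function.update ω y t))
        _ (ω y) := ((c m).differentiableAt_update ω y (ω y)).hasDerivAt.add
      ((c' m).differentiableAt_update ω y (ω y)).hasDerivAt
    have e : partialDeriv y (fun ω => (f + f') (m, ω)) ω
        = partialDeriv y (fun ω => f (m, ω)) ω + partialDeriv y (fun ω => f' (m, ω)) ω := hd.deriv
    rw [e]
    ring
  have e : (g + g') p = g p + g' p := rfl
  have hF : genFlip (f + f').toFun p = genFlip f.toFun p + genFlip f'.toFun p :=
    noise_add isLocalNoise_flip f f' p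
  have hE : genExch (f + f').toFun p = genExch f.toFun p + genExch f'.toFun p :=
    noise_add isLocalNoise_exch f f' p
  rw [e, h.2, h'.2, gen, gen, gen, hA, hF, hE]
  ring

theorem isGen_zero (lam γ : ℝ) : IsGen ν lam γ 0 0 := by
  have e : ∀ p : Disorder C × Config, (0 : LocalFun ν) p = 0 := fun _ => rfl
  refine ⟨⟨∅, fun m => ⟨0, contDiff_const, fun _ => rfl⟩⟩, fun p => ?_⟩
  simp [e, gen, genA, genFlip, genExch]

theorem isC1On_mono (i : ℤ × ℕ) (a : Coef ν) (m : Disorder C) :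
    IsC1On {i.1, i.1 + (i.2 : ℤ)} (fun ω => mono i a (m, ω)) := by
  obtain ⟨x, k⟩ := i
  refine ⟨fun u => a m * (u ⟨x, by simp⟩ * u ⟨x + k, by simp⟩ - if k = 0 then 1 else 0),
    by fun_prop, fun ω => rfl⟩

theorem partialDeriv_mono_of_ne {x y z : ℤ} {k : ℕ} (a : Coef ν) (m : Disorder C) (ω : Config)
    (hy : y = x ∧ z = x + k ∨ y = x + k ∧ z = x) (hzy : z ≠ y) :
    partialDeriv y (fun ω => mono (x, k) a (m, ω)) ω = a m * ω z := by
  have e : (fun t => mono (x, k) a (m, Function.update ω y t))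
      = fun t => a m * (t * ω z - if k = 0 then 1 else 0) := by
    funext t
    rw [mono_apply]
    rcases hy with ⟨rfl, rfl⟩ | ⟨rfl, rfl⟩
    · simp [quad, hzy]
    · simp [quad, hzy, mul_comm]
  rw [partialDeriv, e]
  have h := (((hasDerivAt_id' (ω y)).mul_const (ω z)).sub_const
    (if k = 0 then (1 : ℝ) else 0)).const_mul (a m)
  rw [h.deriv, one_mul]

theorem partialDeriv_mono_self (x : ℤ) (a : Coef ν) (m : Disorder C) (ω : Config) :
    partialDeriv x (fun ω => mono (x, 0) a (m, ω)) ω = 2 * a m * ω x := by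
  have e : (fun t => mono (x, 0) a (m, Function.update ω x t)) = fun t => a m * (t * t - 1) := by
    funext t
    simp [mono_apply, quad]
  rw [partialDeriv, e]
  have h := (((hasDerivAt_id' (ω x)).mul (hasDerivAt_id' (ω x))).sub_const 1).const_mul (a m)
  have h2 : deriv (fun t => a m * (t * t - 1)) (ω x) = _ := h.deriv
  rw [h2]
  ring

/-- The monomial `quad x k` with the two sites given separately. -/
theorem mono_mk_apply (x : ℤ) (k : ℕ) (a : Coef ν) (p : Disorder C × Config) :
    mono (x, k) a p = a p.1 * (p.2 x * p.2 (x + k) - if k = 0 then 1 else 0) := rfl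

/-- Each of two distinct sites contributes `-2` times the monomial, while squares are invariant. -/
theorem genFlip_mono (x : ℤ) (k : ℕ) (a : Coef ν) (p : Disorder C × Config) :
    genFlip (mono (x, k) a).toFun p = if k = 0 then 0 else -4 * mono (x, k) a p := by
  have hf : ∀ y, mono (x, k) a (p.1, flip y p.2) = a p.1 * quad x k (flip y p.2) := fun _ => rfl
  have h0 : mono (x, k) a p = a p.1 * quad x k p.2 := rfl
  unfold genFlip
  simp only [hf, h0]
  split_ifs with hk
  · subst hk
    refine finsum_eq_zero_of_forall_eq_zero fun y => ?_
    by_cases hy : x = y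
    · subst hy; simp [quad, flip]
    · rw [quad_flip_of_ne hy (by simpa using hy), sub_self]
  · have hne : x ≠ x + k := by omega
    rw [finsum_eq_sum_of_support_subset (s := {x, x + (k : ℤ)}), Finset.sum_pair hne,
      quad_flip_left hk, quad_flip_right hk]
    · ring
    · intro y hy
      by_contra h
      simp only [Finset.coe_insert, Finset.coe_singleton, Set.mem_insert_iff,
        Set.mem_singleton_iff, not_or] at h
      exact hy (by simp [quad_flip_of_ne (Ne.symm h.1) (Ne.symm h.2)])

/-- Only bonds touching `x` or `x + k` matter. The listed sites coincide partially for `k = 0` and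
`k = 1`, hence the separate cases that follow. -/
theorem genExch_eq_sum (x : ℤ) (k : ℕ) (a : Coef ν) (p : Disorder C × Config) :
    genExch (mono (x, k) a).toFun p
      = ∑ y ∈ ({x - 1, x, x + k - 1, x + k} : Finset ℤ),
        (mono (x, k) a (p.1, exch y p.2) - mono (x, k) a p) := by
  refine finsum_eq_sum_of_support_subset _ fun y hy => ?_
  by_contra h
  simp only [Finset.coe_insert, Finset.coe_singleton, Set.mem_insert_iff,
    Set.mem_singleton_iff, not_or] at h
  refine hy (sub_eq_zero.2 ?_)
  simp only [mono_apply]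
  rw [quad_congr]
  · simp only [exch]
    rw [Equiv.swap_apply_of_ne_of_ne (by omega) (by omega)]
  · simp only [exch]
    rw [Equiv.swap_apply_of_ne_of_ne (by omega) (by omega)]

theorem exch_apply_left (y : ℤ) (ω : Config) : exch y ω y = ω (y + 1) := by simp [exch]

theorem exch_apply_right (y : ℤ) (ω : Config) : exch y ω (y + 1) = ω y := by simp [exch]

theorem exch_apply_of_ne {y z : ℤ} (h : z ≠ y) (h' : z ≠ y + 1) (ω : Config) :
    exch y ω z = ω z := by
  simp [exch, Equiv.swap_apply_of_ne_of_ne h h']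

theorem exch_pred_apply (x : ℤ) (ω : Config) : exch (x - 1) ω x = ω (x - 1) := by
  simpa using exch_apply_right (x - 1) ω

theorem genExch_mono_zero (x : ℤ) (a : Coef ν) (p : Disorder C × Config) :
    genExch (mono (x, 0) a).toFun p
      = a p.1 * (p.2 (x + 1) ^ 2 + p.2 (x - 1) ^ 2 - 2 * p.2 x ^ 2) := by
  rw [genExch_eq_sum]
  have e : ({x - 1, x, x + (0 : ℕ) - 1, x + (0 : ℕ)} : Finset ℤ) = {x - 1, x} := by
    ext z; simp
  rw [e, Finset.sum_pair (by omega)]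
  simp only [mono_mk_apply, Nat.cast_zero, add_zero, exch_pred_apply, exch_apply_left]
  ring

theorem genExch_mono_one (x : ℤ) (a : Coef ν) (p : Disorder C × Config) :
    genExch (mono (x, 1) a).toFun p
      = a p.1 * (p.2 (x - 1) * p.2 (x + 1) + p.2 x * p.2 (x + 2) - 2 * p.2 x * p.2 (x + 1)) := by
  rw [genExch_eq_sum]
  have e : ({x - 1, x, x + (1 : ℕ) - 1, x + (1 : ℕ)} : Finset ℤ) = {x - 1, x, x + 1} := by
    ext z; simp
  rw [e, Finset.sum_insert (by simp; omega), Finset.sum_pair (by omega)]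
  simp only [mono_mk_apply, Nat.cast_one, exch_pred_apply, exch_apply_left, exch_apply_right]
  rw [exch_apply_of_ne (y := x - 1) (z := x + 1) (by omega) (by omega),
    exch_apply_of_ne (y := x + 1) (z := x) (by omega) (by omega), add_assoc x 1 1]
  norm_num
  ring

theorem genExch_mono_add_two (x : ℤ) (j : ℕ) (a : Coef ν) (p : Disorder C × Config) :
    genExch (mono (x, j + 2) a).toFun p
      = a p.1 * (p.2 (x - 1) * p.2 (x + (j + 2)) + p.2 (x + 1) * p.2 (x + (j + 2))
        + p.2 x * p.2 (x + (j + 1)) + p.2 x * p.2 (x + (j + 3))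
        - 4 * p.2 x * p.2 (x + (j + 2))) := by
  rw [genExch_eq_sum, Finset.sum_insert (by simp; omega), Finset.sum_insert (by simp; omega),
    Finset.sum_pair (by omega)]
  have e2 : x + ((j + 2 : ℕ) : ℤ) = x + (j + 2) := by push_cast; ring
  have e3 : x + ((j : ℤ) + 2) - 1 = x + (j + 1) := by ring
  have e4 : x + ((j : ℤ) + 2) + 1 = x + (j + 3) := by ring
  have e5 : exch (x + (j + 1)) p.2 (x + (j + 2)) = p.2 (x + (j + 1)) := by
    have := exch_apply_right (x + (j + 1)) p.2
    rwa [show x + ((j : ℤ) + 1) + 1 = x + (j + 2) by ring] at this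
  simp only [mono_mk_apply, e2, e3, exch_pred_apply, exch_apply_left, e4, e5]
  rw [exch_apply_of_ne (y := x - 1) (z := x + (j + 2)) (by omega) (by omega),
    exch_apply_of_ne (y := x) (z := x + (j + 2)) (by omega) (by omega),
    exch_apply_of_ne (y := x + (j + 1)) (z := x) (by omega) (by omega),
    exch_apply_of_ne (y := x + (j + 2)) (z := x) (by omega) (by omega)]
  simp
  ring

theorem genA_mono_zero (x : ℤ) (a : Coef ν) (p : Disorder C × Config) :
    genA (mono (x, 0) a).toFun p = 2 * a p.1 * p.2 x
      * (bond p.1 x * p.2 (x + 1) - bond p.1 (x - 1) * p.2 (x - 1)) := by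
  obtain ⟨m, ω⟩ := p
  rw [genA_eq_drift, (isC1On_mono (x, 0) a m).drift_eq_sum]
  simp only [Nat.cast_zero, add_zero, Finset.pair_eq_singleton, Finset.sum_singleton,
    partialDeriv_mono_self]
  ring

theorem genA_mono_of_ne (x : ℤ) {k : ℕ} (hk : k ≠ 0) (a : Coef ν) (p : Disorder C × Config) :
    genA (mono (x, k) a).toFun p
      = a p.1 * ((bond p.1 x * p.2 (x + 1) - bond p.1 (x - 1) * p.2 (x - 1)) * p.2 (x + k)
        + (bond p.1 (x + k) * p.2 (x + k + 1) - bond p.1 (x + k - 1) * p.2 (x + k - 1))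
          * p.2 x) := by
  obtain ⟨m, ω⟩ := p
  have hne : x ≠ x + k := by omega
  rw [genA_eq_drift, (isC1On_mono (x, k) a m).drift_eq_sum, Finset.sum_pair hne,
    partialDeriv_mono_of_ne a m ω (Or.inl ⟨rfl, rfl⟩) hne.symm,
    partialDeriv_mono_of_ne a m ω (Or.inr ⟨rfl, rfl⟩) hne]
  ring

theorem isGen_mono (hC : 0 < C) (lam γ : ℝ) (i : ℤ × ℕ) (a : Coef ν) :
    IsGen ν lam γ (mono i a) (realize (genMono hC lam γ i a)) := by
  refine ⟨⟨_, isC1On_mono i a⟩, fun p => ?_⟩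
  rw [← evalₗ_apply]
  match i with
  | (x, 0) =>
    rw [gen, genFlip_mono, genExch_mono_zero, genA_mono_zero]
    simp only [genMono, LinearMap.add_apply, LinearMap.sub_apply, LinearMap.smul_apply,
      LinearMap.comp_apply, Finsupp.lsingle_apply, map_add, map_sub, map_smul, realize_single,
      evalₗ_apply, mono_mk_apply, mulBond_apply, smul_eq_mul]
    simp
    ring
  | (x, 1) =>
    rw [gen, genFlip_mono, genExch_mono_one, genA_mono_of_ne x one_ne_zero]
    simp only [genMono, LinearMap.add_apply, LinearMap.sub_apply, LinearMap.smul_apply,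
      LinearMap.comp_apply, Finsupp.lsingle_apply, map_add, map_sub, map_smul, realize_single,
      evalₗ_apply, mono_mk_apply, mulBond_apply, smul_eq_mul]
    have e1 : x - 1 + 2 = x + 1 := by ring
    have e2 : x + 1 + 1 = x + 2 := by ring
    simp [e1, e2]
    ring
  | (x, j + 2) =>
    rw [gen, genFlip_mono, genExch_mono_add_two, genA_mono_of_ne x (by omega)]
    simp only [genMono, LinearMap.add_apply, LinearMap.sub_apply, LinearMap.smul_apply,
      LinearMap.comp_apply, Finsupp.lsingle_apply, map_add, map_sub, map_smul, realize_single,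
      evalₗ_apply, mono_mk_apply, mulBond_apply, smul_eq_mul]
    push_cast
    have e1 : x + 1 + ((j : ℤ) + 1) = x + (j + 2) := by ring
    have e2 : x - 1 + ((j : ℤ) + 3) = x + (j + 2) := by ring
    have e3 : x + ((j : ℤ) + 2) + 1 = x + (j + 3) := by ring
    have e4 : x + ((j : ℤ) + 2) - 1 = x + (j + 1) := by ring
    simp [e1, e2, e3, e4]
    ring

/-- The generator maps the quadratic function with coefficients `a` to the one with coefficients
`genQuad a`. -/
theorem isGen_realize (hC : 0 < C) (lam γ : ℝ) (a : QuadSpace ν) :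
    IsGen ν lam γ (realize a) (realize (genQuad hC lam γ a)) := by
  induction a using Finsupp.induction_linear with
  | zero => simpa using isGen_zero lam γ
  | add a b ha hb => simpa only [map_add] using isGen_add ha hb
  | single i α =>
    rw [realize_single, genQuad_single]
    exact isGen_mono hC lam γ i α

end GeneratorOnQuadratics

/-! ### A norm on coefficients that controls correlations at individual sites. -/

section AbsoluteNorm

/-- The sum of the supremum norms of the coefficients. -/
def absNorm (a : QuadSpace ν) : ℝ := a.sum fun _ α => ‖α.toMap‖

theorem absNorm_nonneg (a : QuadSpace ν) : 0 ≤ absNorm a :=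
  Finset.sum_nonneg fun _ _ => norm_nonneg _

theorem toMap_zero : (0 : Coef ν).toMap = 0 := rfl

theorem absNorm_single (i : ℤ × ℕ) (α : Coef ν) : absNorm (Finsupp.single i α) = ‖α.toMap‖ := by
  rw [absNorm, Finsupp.sum_single_index]
  rw [toMap_zero, norm_zero]

theorem absNorm_eq_sum {a : QuadSpace ν} {s : Finset (ℤ × ℕ)} (hs : a.support ⊆ s) :
    absNorm a = ∑ i ∈ s, ‖(a i).toMap‖ :=
  Finsupp.sum_of_support_subset _ hs _ fun _ _ => by rw [toMap_zero, norm_zero]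

theorem absNorm_add_le (a b : QuadSpace ν) : absNorm (a + b) ≤ absNorm a + absNorm b := by
  classical
  rw [absNorm_eq_sum (Finsupp.support_add (g₁ := a) (g₂ := b)),
    absNorm_eq_sum (Finset.subset_union_left (s₁ := a.support) (s₂ := b.support)),
    absNorm_eq_sum (Finset.subset_union_right (s₁ := a.support) (s₂ := b.support)),
    ← Finset.sum_add_distrib]
  exact Finset.sum_le_sum fun i _ => norm_add_le (a i).toMap (b i).toMap

theorem absNorm_smul (r : ℝ) (a : QuadSpace ν) : absNorm (r • a) = |r| * absNorm a := by
  rw [absNorm_eq_sum (Finsupp.support_smul (b := r) (g := a)), absNorm, Finsupp.sum,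
    Finset.mul_sum]
  exact Finset.sum_congr rfl fun i _ => norm_smul r (a i).toMap

theorem absNorm_sub_le (a b : QuadSpace ν) : absNorm (a - b) ≤ absNorm a + absNorm b := by
  have h := absNorm_add_le a ((-1 : ℝ) • b)
  rw [absNorm_smul] at h
  simpa [sub_eq_add_neg] using h

theorem absNorm_single_mulBond_le (hC : 0 < C) (i : ℤ × ℕ) (y : ℤ) (α : Coef ν) :
    absNorm (Finsupp.single i (mulBond hC y α)) ≤ C * ‖α.toMap‖ := by
  rw [absNorm_single]
  exact supNorm_mulBond_le hC y α

theorem absNorm_genMono_le (hC : 0 < C) {lam γ : ℝ} (hlam : 0 ≤ lam) (hγ : 0 ≤ γ) (i : ℤ × ℕ)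
    (α : Coef ν) :
    absNorm (genMono hC lam γ i α) ≤ (4 * C + 4 * γ + 8 * lam) * ‖α.toMap‖ := by
  have hα := norm_nonneg α.toMap
  have hb := fun i y => absNorm_single_mulBond_le hC i y α
  have hs := fun i => absNorm_single i α
  have p1 := mul_nonneg hγ hα
  have p2 := mul_nonneg hlam hα
  have p3 := mul_nonneg hC.le hα
  match i with
  | (x, 0) =>
    simp only [genMono, LinearMap.add_apply, LinearMap.sub_apply, LinearMap.smul_apply,
      LinearMap.comp_apply, Finsupp.lsingle_apply]
    refine (absNorm_add_le _ _).trans ?_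
    rw [absNorm_smul, absNorm_smul, abs_two, abs_of_nonneg hlam]
    have h1 := (absNorm_sub_le _ _).trans (add_le_add (hb (x, 1) x) (hb (x - 1, 1) (x - 1)))
    have h2 := (absNorm_sub_le (Finsupp.single (x + 1, 0) α + Finsupp.single (x - 1, 0) α)
      ((2 : ℝ) • Finsupp.single (x, 0) α)).trans (add_le_add (absNorm_add_le _ _) le_rfl)
    rw [absNorm_smul, abs_two, hs, hs, hs] at h2
    have h3 := mul_le_mul_of_nonneg_left h2 hlam
    linarith
  | (x, 1) =>
    simp only [genMono, LinearMap.add_apply, LinearMap.sub_apply, LinearMap.smul_apply,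
      LinearMap.comp_apply, Finsupp.lsingle_apply]
    refine (absNorm_add_le _ _).trans ((add_le_add ((absNorm_sub_le _ _).trans (add_le_add
      ((absNorm_sub_le _ _).trans (add_le_add ((absNorm_add_le _ _).trans (add_le_add
      ((absNorm_sub_le _ _).trans (add_le_add (hb _ _) (hb _ _))) (hb _ _))) (hb _ _)))
      le_rfl)) le_rfl).trans ?_)
    rw [absNorm_smul, absNorm_smul, abs_of_nonneg hlam, abs_of_nonneg (by positivity), hs]
    have h2 := (absNorm_sub_le (Finsupp.single (x - 1, 2) α + Finsupp.single (x, 2) α)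
      ((2 : ℝ) • Finsupp.single (x, 1) α)).trans (add_le_add (absNorm_add_le _ _) le_rfl)
    rw [absNorm_smul, abs_two, hs, hs, hs] at h2
    have h3 := mul_le_mul_of_nonneg_left h2 hlam
    linarith
  | (x, j + 2) =>
    simp only [genMono, LinearMap.add_apply, LinearMap.sub_apply, LinearMap.smul_apply,
      LinearMap.comp_apply, Finsupp.lsingle_apply]
    refine (absNorm_add_le _ _).trans ((add_le_add ((absNorm_sub_le _ _).trans (add_le_add
      ((absNorm_sub_le _ _).trans (add_le_add ((absNorm_add_le _ _).trans (add_le_add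
      ((absNorm_sub_le _ _).trans (add_le_add (hb _ _) (hb _ _))) (hb _ _))) (hb _ _)))
      le_rfl)) le_rfl).trans ?_)
    rw [absNorm_smul, absNorm_smul, abs_of_nonneg hlam, abs_of_nonneg (by positivity), hs]
    have h2 := (absNorm_sub_le (Finsupp.single (x + 1, j + 1) α + Finsupp.single (x - 1, j + 3) α
      + Finsupp.single (x, j + 1) α + Finsupp.single (x, j + 3) α)
      ((4 : ℝ) • Finsupp.single (x, j + 2) α)).trans (add_le_add ((absNorm_add_le _ _).trans
        (add_le_add ((absNorm_add_le _ _).trans (add_le_add (absNorm_add_le _ _) le_rfl))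
          le_rfl)) le_rfl)
    rw [absNorm_smul, abs_of_nonneg (by norm_num), hs, hs, hs, hs, hs] at h2
    have h3 := mul_le_mul_of_nonneg_left h2 hlam
    linarith

/-- Each monomial is sent to boundedly many monomials with bounded factors. Iterates of the
generator on the current therefore grow at most geometrically, which the factorials of the
exponential series beat. -/
theorem absNorm_genQuad_le (hC : 0 < C) {lam γ : ℝ} (hlam : 0 ≤ lam) (hγ : 0 ≤ γ)
    (a : QuadSpace ν) :
    absNorm (genQuad hC lam γ a) ≤ (4 * C + 4 * γ + 8 * lam) * absNorm a := by
  have hsum : ∀ (s : Finset (ℤ × ℕ)) (F : ℤ × ℕ → QuadSpace ν),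
      absNorm (∑ i ∈ s, F i) ≤ ∑ i ∈ s, absNorm (F i) := fun s F =>
    Finset.le_sum_of_subadditive absNorm (by simp [absNorm]) absNorm_add_le s F
  have e : genQuad hC lam γ a = ∑ i ∈ a.support, genMono hC lam γ i (a i) := by
    simp [genQuad, Finsupp.sum]
  rw [e]
  refine (hsum _ _).trans ?_
  rw [show absNorm a = ∑ i ∈ a.support, ‖(a i).toMap‖ from rfl, Finset.mul_sum]
  exact Finset.sum_le_sum fun i _ => absNorm_genMono_le hC hlam hγ i (a i)

end AbsoluteNorm

end DisorderedChain

/-! ### Taylor expansion for a hierarchy of integral equations. -/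

section Taylor

/-- Each function of the hierarchy is the integral of the next, so integrating the remainder
estimate for level `n + 1` gives the next order at level `n`; no differentiability is needed. -/
theorem abs_sub_taylor_le {φ : ℕ → ℝ → ℝ} {K M : ℝ}
    (hi : ∀ n t, 0 ≤ t → IntervalIntegrable (φ n) volume 0 t)
    (hφ : ∀ n t, 0 ≤ t → φ n t = φ n 0 + ∫ u in (0 : ℝ)..t, φ (n + 1) u)
    (hb : ∀ n t, 0 ≤ t → |φ n t| ≤ K * M ^ n) (N n : ℕ) {t : ℝ} (ht : 0 ≤ t) :
    |φ n t - ∑ k ∈ Finset.range N, t ^ k / k.factorial * φ (n + k) 0|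
      ≤ K * M ^ (n + N) * (t ^ N / N.factorial) := by
  induction N generalizing n t with
  | zero => simpa using hb n t ht
  | succ N ih =>
    have hpow : ∀ (k : ℕ) (c : ℝ), ∫ u in (0 : ℝ)..t, u ^ k / k.factorial * c
        = t ^ (k + 1) / (k + 1).factorial * c := fun k c => by
      rw [intervalIntegral.integral_mul_const, intervalIntegral.integral_div, integral_pow,
        Nat.factorial_succ]
      push_cast
      field_simp
      simp
    have hpi : ∀ (k : ℕ) (c : ℝ),
        IntervalIntegrable (fun u : ℝ => u ^ k / k.factorial * c) volume 0 t := fun k c =>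
      Continuous.intervalIntegrable (by fun_prop) _ _
    have hs : IntervalIntegrable (fun u : ℝ => ∑ k ∈ Finset.range N,
        u ^ k / k.factorial * φ (n + 1 + k) 0) volume 0 t :=
      Continuous.intervalIntegrable (by fun_prop) _ _
    have e : φ n t - ∑ k ∈ Finset.range (N + 1), t ^ k / k.factorial * φ (n + k) 0
        = ∫ u in (0 : ℝ)..t, (φ (n + 1) u
          - ∑ k ∈ Finset.range N, u ^ k / k.factorial * φ (n + 1 + k) 0) := by
      rw [intervalIntegral.integral_sub (hi _ _ ht) hs,
        intervalIntegral.integral_finsetSum fun k _ => hpi k _, hφ n t ht,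
        Finset.sum_range_succ']
      simp only [hpow, add_assoc, add_comm 1]
      simp
      ring
    rw [e]
    refine (intervalIntegral.norm_integral_le_of_norm_le
      (f := fun u : ℝ => φ (n + 1) u
        - ∑ k ∈ Finset.range N, u ^ k / k.factorial * φ (n + 1 + k) 0)
      (g := fun u : ℝ => K * M ^ (n + 1 + N) * (u ^ N / N.factorial)) ht (Eventually.of_forall
      fun u hu => ih (n + 1) hu.1.le) (Continuous.intervalIntegrable (by fun_prop) _ _)).trans ?_
    have h := hpow N (K * M ^ (n + 1 + N))
    simp only [mul_comm _ (K * M ^ (n + 1 + N))] at h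
    rw [h, add_right_comm, add_assoc]

theorem hasSum_taylor {φ : ℕ → ℝ → ℝ} {K M : ℝ}
    (hi : ∀ n t, 0 ≤ t → IntervalIntegrable (φ n) volume 0 t)
    (hφ : ∀ n t, 0 ≤ t → φ n t = φ n 0 + ∫ u in (0 : ℝ)..t, φ (n + 1) u)
    (hb : ∀ n t, 0 ≤ t → |φ n t| ≤ K * M ^ n) {t : ℝ} (ht : 0 ≤ t) :
    HasSum (fun n : ℕ => t ^ n / n.factorial * φ n 0) (φ 0 t) := by
  have hK : 0 ≤ K := by simpa using (abs_nonneg _).trans (hb 0 0 le_rfl)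
  have hsum : Summable fun n : ℕ => K * ((M * t) ^ n / n.factorial) :=
    (Real.summable_pow_div_factorial (M * t)).mul_left K
  have hs : Summable fun n : ℕ => t ^ n / n.factorial * φ n 0 := by
    refine Summable.of_norm_bounded hsum fun n => ?_
    rw [norm_mul, Real.norm_of_nonneg (by positivity)]
    refine (mul_le_mul_of_nonneg_left (hb n 0 le_rfl) (by positivity)).trans (le_of_eq ?_)
    rw [mul_pow]
    ring
  rw [hs.hasSum_iff_tendsto_nat]
  rw [tendsto_iff_norm_sub_tendsto_zero]
  refine squeeze_zero (fun _ => norm_nonneg _) (fun N => ?_) hsum.tendsto_atTop_zero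
  have h := abs_sub_taylor_le hi hφ hb N 0 ht
  simp only [zero_add] at h
  rw [norm_sub_rev, Real.norm_eq_abs]
  refine h.trans (le_of_eq ?_)
  rw [mul_pow]
  ring

end Taylor

namespace DisorderedChain

variable {C : ℝ} {ν : Measure (Set.Icc C⁻¹ C)} [IsProbabilityMeasure ν]

/-! ### Equilibrium processes: expansion of the current correlations. -/

section Dynamics

variable {S : Type*} {mS : MeasurableSpace S} {Q : Measure S} {ℱ : Filtration ℝ≥0 mS}
  {m : S → Disorder C} {ω : ℝ≥0 → S → Config} {lam γ : ℝ}

namespace IsEquilibriumProcess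

theorem measurable_disorder (h : IsEquilibriumProcess ν lam γ Q ℱ m ω) : Measurable m :=
  h.adapted_disorder.mono (ℱ.le 0) le_rfl

theorem measurable_pair (h : IsEquilibriumProcess ν lam γ Q ℱ m ω) (t : ℝ≥0) :
    Measurable (fun s => (m s, ω t s)) :=
  h.measurable_disorder.prodMk ((h.adapted t).mono (ℱ.le t) le_rfl)

theorem measurePreserving (h : IsEquilibriumProcess ν lam γ Q ℱ m ω) (t : ℝ≥0) :
    MeasurePreserving (fun s => (m s, ω t s)) Q (annealed ν) :=
  ⟨h.measurable_pair t, h.law t⟩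

theorem isProbabilityMeasure (h : IsEquilibriumProcess ν lam γ Q ℱ m ω) :
    IsProbabilityMeasure Q := by
  refine ⟨?_⟩
  have e := (h.measurePreserving 0).measure_preimage (s := Set.univ) nullMeasurableSet_univ
  rw [Set.preimage_univ] at e
  exact e.trans measure_univ

theorem integral_comp (h : IsEquilibriumProcess ν lam γ Q ℱ m ω) (t : ℝ≥0)
    {F : Disorder C × Config → ℝ} (hF : Measurable F) :
    ∫ s, F (m s, ω t s) ∂Q = ∫ p, F p ∂annealed ν := by
  conv_rhs => rw [← h.law t]
  exact (integral_map (h.measurable_pair t).aemeasurable hF.aestronglyMeasurable).symm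

theorem integrable_mul (h : IsEquilibriumProcess ν lam γ Q ℱ m ω) (t : ℝ≥0)
    {F G : Disorder C × Config → ℝ} (hF : MemLp F 2 (annealed ν)) (hG : MemLp G 2 (annealed ν)) :
    Integrable (fun s => F (m s, ω t s) * G (m s, ω 0 s)) Q :=
  (hF.comp_measurePreserving (h.measurePreserving t)).integrable_mul
    (hG.comp_measurePreserving (h.measurePreserving 0))

theorem integral_abs_mul_le (h : IsEquilibriumProcess ν lam γ Q ℱ m ω) (t : ℝ≥0)
    {F G : Disorder C × Config → ℝ} (hF : MemLp F 2 (annealed ν)) (hG : MemLp G 2 (annealed ν))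
    (hFm : Measurable F) (hGm : Measurable G) :
    ∫ s, |F (m s, ω t s) * G (m s, ω 0 s)| ∂Q
      ≤ ∫ p, F p ^ 2 ∂annealed ν + ∫ p, G p ^ 2 ∂annealed ν := by
  have iF : Integrable (fun s => F (m s, ω t s) ^ 2) Q :=
    (hF.comp_measurePreserving (h.measurePreserving t)).integrable_sq
  have iG : Integrable (fun s => G (m s, ω 0 s) ^ 2) Q :=
    (hG.comp_measurePreserving (h.measurePreserving 0)).integrable_sq
  rw [← h.integral_comp t (hFm.pow_const 2), ← h.integral_comp 0 (hGm.pow_const 2),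
    ← integral_add iF iG]
  refine integral_mono (h.integrable_mul t hF hG).abs (iF.add iG) fun s => ?_
  simp only [abs_mul, ← sq_abs (F _), ← sq_abs (G _)]
  nlinarith [sq_nonneg (|F (m s, ω t s)| - |G (m s, ω 0 s)|), sq_nonneg (|F (m s, ω t s)|),
    sq_nonneg (|G (m s, ω 0 s)|)]

theorem integrable_prod (h : IsEquilibriumProcess ν lam γ Q ℱ m ω) (t : ℝ)
    {F G : Disorder C × Config → ℝ} (hF : MemLp F 2 (annealed ν)) (hG : MemLp G 2 (annealed ν))
    (hFm : Measurable F) (hGm : Measurable G) :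
    Integrable (fun q : ℝ × S => F (m q.2, ω q.1.toNNReal q.2) * G (m q.2, ω 0 q.2))
      ((volume.restrict (Set.Ioc 0 t)).prod Q) := by
  have := h.isProbabilityMeasure
  have hm : Measurable (fun q : ℝ × S => F (m q.2, ω q.1.toNNReal q.2) * G (m q.2, ω 0 q.2)) := by
    have h1 : Measurable fun q : ℝ × S => ω q.1.toNNReal q.2 :=
      h.measurable_uncurry.comp (f := fun q : ℝ × S => (q.1.toNNReal, q.2)) (by fun_prop)
    exact (hFm.comp ((h.measurable_disorder.comp measurable_snd).prodMk h1)).mul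
      (hGm.comp ((h.measurable_pair 0).comp measurable_snd))
  rw [integrable_prod_iff hm.aestronglyMeasurable]
  refine ⟨Eventually.of_forall fun u => h.integrable_mul u.toNNReal hF hG, ?_⟩
  refine Integrable.of_bound hm.aestronglyMeasurable.norm.integral_prod_right'
    (∫ p, F p ^ 2 ∂annealed ν + ∫ p, G p ^ 2 ∂annealed ν) (Eventually.of_forall fun u => ?_)
  rw [Real.norm_of_nonneg (integral_nonneg fun _ => norm_nonneg _)]
  exact h.integral_abs_mul_le u.toNNReal hF hG hFm hGm

theorem intervalIntegrable_corr (h : IsEquilibriumProcess ν lam γ Q ℱ m ω) {t : ℝ} (ht : 0 ≤ t)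
    {F G : Disorder C × Config → ℝ} (hF : MemLp F 2 (annealed ν)) (hG : MemLp G 2 (annealed ν))
    (hFm : Measurable F) (hGm : Measurable G) :
    IntervalIntegrable (fun u : ℝ => ∫ s, F (m s, ω u.toNNReal s) * G (m s, ω 0 s) ∂Q)
      volume 0 t := by
  have := h.isProbabilityMeasure
  rw [intervalIntegrable_iff_integrableOn_Ioc_of_le ht]
  exact (h.integrable_prod t hF hG hFm hGm).integral_prod_left

/-- The evolution equation for correlations with a function of the initial state. -/
theorem corr_eq_add_integral (h : IsEquilibriumProcess ν lam γ Q ℱ m ω) {f g : LocalFun ν}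
    (hfg : IsGen ν lam γ f g) {G : Disorder C × Config → ℝ} (hG : MemLp G 2 (annealed ν))
    (hGm : Measurable G) {t : ℝ} (ht : 0 ≤ t) :
    ∫ s, f (m s, ω t.toNNReal s) * G (m s, ω 0 s) ∂Q
      = ∫ s, f (m s, ω 0 s) * G (m s, ω 0 s) ∂Q
        + ∫ u in (0 : ℝ)..t, ∫ s, g (m s, ω u.toNNReal s) * G (m s, ω 0 s) ∂Q := by
  have := h.isProbabilityMeasure
  have hM := h.martingale f g hfg
  set X : S → ℝ := fun s => f (m s, ω t.toNNReal s)
    - ∫ u in (0 : ℝ)..t, g (m s, ω u.toNNReal s) with hX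
  have htt : ((t.toNNReal : ℝ≥0) : ℝ) = t := Real.coe_toNNReal t ht
  have hXi : Integrable X Q := by
    have := hM.integrable t.toNNReal
    simpa only [htt] using this
  -- The compensator vanishes at time zero, so the martingale starts from `f` at the initial state.
  have hc : Q[X | ℱ 0] =ᵐ[Q] fun s => f (m s, ω 0 s) := by
    have := hM.condExp_ae_eq (zero_le (a := t.toNNReal))
    simpa only [htt, NNReal.coe_zero, intervalIntegral.integral_same, sub_zero] using this
  set G₀ : S → ℝ := fun s => G (m s, ω 0 s) with hG₀
  have hG₀m : StronglyMeasurable[ℱ 0] G₀ :=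
    (hGm.comp (h.adapted_disorder.prodMk (h.adapted 0))).stronglyMeasurable
  have hp := h.integrable_prod t g.isLocal.memLp hG g.isLocal.measurable hGm
  have e1 : ∀ s, (∫ u in (0 : ℝ)..t, g (m s, ω u.toNNReal s)) * G₀ s
      = ∫ u in Set.Ioc 0 t, g (m s, ω u.toNNReal s) * G (m s, ω 0 s) := fun s => by
    rw [intervalIntegral.integral_of_le ht, integral_mul_const]
  have hi1 : Integrable (fun s => f (m s, ω t.toNNReal s) * G₀ s) Q :=
    h.integrable_mul _ f.isLocal.memLp hG
  have hi2 : Integrable (fun s => (∫ u in (0 : ℝ)..t, g (m s, ω u.toNNReal s)) * G₀ s) Q := by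
    simp only [e1]
    exact hp.integral_prod_right
  have eXG : X * G₀ = fun s => f (m s, ω t.toNNReal s) * G₀ s
      - (∫ u in (0 : ℝ)..t, g (m s, ω u.toNNReal s)) * G₀ s := by
    funext s
    exact sub_mul _ _ _
  have hXG : Integrable (X * G₀) Q := by
    rw [eXG]
    exact hi1.sub hi2
  -- The test function `G₀` is measurable at time zero and pulls out of the conditional expectation.
  have key : ∫ s, (X * G₀) s ∂Q = ∫ s, f (m s, ω 0 s) * G (m s, ω 0 s) ∂Q := by
    rw [← integral_condExp (ℱ.le 0)]
    refine integral_congr_ae ?_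
    filter_upwards [condExp_mul_of_stronglyMeasurable_right hG₀m hXG hXi, hc] with s h1 h2
    rw [h1, Pi.mul_apply, h2]
  rw [eXG, integral_sub hi1 hi2] at key
  have hswap : ∫ s, (∫ u in (0 : ℝ)..t, g (m s, ω u.toNNReal s)) * G₀ s ∂Q
      = ∫ u in (0 : ℝ)..t, ∫ s, g (m s, ω u.toNNReal s) * G (m s, ω 0 s) ∂Q := by
    simp only [e1]
    rw [intervalIntegral.integral_of_le ht]
    exact (integral_integral_swap hp).symm
  rw [hswap] at key
  linarith

/-- Stationarity bounds the correlation of each monomial uniformly in time, from `|F G| ≤ F² + G²`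
and second moment at most `2`. -/
theorem abs_corr_realize_le (h : IsEquilibriumProcess ν lam γ Q ℱ m ω) (a : QuadSpace ν)
    {G : Disorder C × Config → ℝ} (hG : MemLp G 2 (annealed ν)) (hGm : Measurable G) (t : ℝ≥0) :
    |∫ s, realize a (m s, ω t s) * G (m s, ω 0 s) ∂Q|
      ≤ (2 + ∫ p, G p ^ 2 ∂annealed ν) * absNorm a := by
  have hq : ∀ i : ℤ × ℕ, MemLp (fun p : Disorder C × Config => quad i.1 i.2 p.2) 2 (annealed ν) :=
    fun i => (memLp_quad i.1 i.2).comp_measurePreserving measurePreserving_snd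
  have hqm : ∀ i : ℤ × ℕ, Measurable (fun p : Disorder C × Config => quad i.1 i.2 p.2) :=
    fun i => (measurable_quad i.1 i.2).comp measurable_snd
  have hq2 : ∀ i : ℤ × ℕ, ∫ p : Disorder C × Config, quad i.1 i.2 p.2 ^ 2 ∂annealed ν ≤ 2 :=
    fun i => by
      have h1 := integral_quad_mul_self i.1 i.2
      simp only [← sq] at h1
      have h2 : ∫ p : Disorder C × Config, quad i.1 i.2 p.2 ^ 2 ∂annealed ν
          = ∫ ω, quad i.1 i.2 ω ^ 2 ∂gibbs := by
        simpa [annealed] using integral_prod_mul (μ := disorderLaw ν) (ν := gibbs)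
          (fun _ => (1 : ℝ)) (fun ω : Config => quad i.1 i.2 ω ^ 2)
      rw [h2, h1]
      split_ifs <;> norm_num
  have hi : ∀ (i : ℤ × ℕ) (α : Coef ν),
      Integrable (fun s => mono i α (m s, ω t s) * G (m s, ω 0 s)) Q := fun i α =>
    h.integrable_mul t (mono i α).isLocal.memLp hG
  have hone : ∀ (i : ℤ × ℕ) (α : Coef ν),
      |∫ s, mono i α (m s, ω t s) * G (m s, ω 0 s) ∂Q|
        ≤ (2 + ∫ p, G p ^ 2 ∂annealed ν) * ‖α.toMap‖ := fun i α => by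
    rw [← Real.norm_eq_abs]
    refine (norm_integral_le_integral_norm _).trans ?_
    have h1 : ∫ s, ‖mono i α (m s, ω t s) * G (m s, ω 0 s)‖ ∂Q
        ≤ ∫ s, ‖α.toMap‖ * |quad i.1 i.2 (ω t s) * G (m s, ω 0 s)| ∂Q := by
      refine integral_mono (hi i α).norm ((h.integrable_mul t (hq i) hG).abs.const_mul _)
        fun s => ?_
      simp only [mono_apply, norm_mul, abs_mul, Real.norm_eq_abs, mul_assoc]
      exact mul_le_mul_of_nonneg_right (α.abs_apply_le _) (by positivity)
    refine h1.trans ?_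
    rw [integral_const_mul, mul_comm]
    exact mul_le_mul_of_nonneg_right ((h.integral_abs_mul_le t (hq i) hG (hqm i) hGm).trans
      (add_le_add_left (hq2 i) _)) (norm_nonneg _)
  have e : ∀ p, realize a p = ∑ i ∈ a.support, mono i (a i) p := fun p => by
    rw [← evalₗ_apply, realize, Finsupp.lsum_apply, Finsupp.sum, map_sum]
    rfl
  simp only [e, Finset.sum_mul]
  rw [integral_finsetSum _ fun i _ => hi i (a i)]
  refine (Finset.abs_sum_le_sum_abs _ _).trans ?_
  rw [show absNorm a = ∑ i ∈ a.support, ‖(a i).toMap‖ from rfl, Finset.mul_sum]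
  exact Finset.sum_le_sum fun i _ => hone i (a i)

end IsEquilibriumProcess

/-- The coefficients of `𝓛ⁿ j` for the current `j`. -/
def iterCurrent (ν : Measure (Set.Icc C⁻¹ C)) [IsProbabilityMeasure ν] (hC : 0 < C) (lam γ : ℝ)
    (n : ℕ) : QuadSpace ν := (genQuad hC lam γ)^[n] (currentQuad ν hC)

theorem iterCurrent_succ (hC : 0 < C) (lam γ : ℝ) (n : ℕ) :
    iterCurrent ν hC lam γ (n + 1) = genQuad hC lam γ (iterCurrent ν hC lam γ n) :=
  Function.iterate_succ_apply' _ _ _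

theorem absNorm_iterCurrent_le (hC : 0 < C) (hlam : 0 ≤ lam) (hγ : 0 ≤ γ) (n : ℕ) :
    absNorm (iterCurrent ν hC lam γ n)
      ≤ absNorm (currentQuad ν hC) * (4 * C + 4 * γ + 8 * lam) ^ n := by
  induction n with
  | zero => simp [iterCurrent]
  | succ n ih =>
    rw [iterCurrent_succ]
    refine (absNorm_genQuad_le hC hlam hγ _).trans ?_
    refine (mul_le_mul_of_nonneg_left ih (by positivity)).trans (le_of_eq ?_)
    ring

/-- The evolution equations for the iterates of the generator on the current form a Taylor
hierarchy, so the correlation is determined by the equilibrium law and is the same for every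
equilibrium process. -/
theorem hasSum_currentCorr (h : IsEquilibriumProcess ν lam γ Q ℱ m ω) (hC : 0 < C)
    (hlam : 0 ≤ lam) (hγ : 0 ≤ γ) (t : ℝ≥0) (x : ℤ) :
    HasSum (fun n : ℕ => (t : ℝ) ^ n / n.factorial * ∫ p, realize (iterCurrent ν hC lam γ n) p
      * current ν hC (shift x p) ∂annealed ν) (currentCorr Q m ω t x) := by
  set G : Disorder C × Config → ℝ := fun p => current ν hC (shift x p) with hG
  have hGL : MemLp G 2 (annealed ν) := (current ν hC).memLp_shift x
  have hGm : Measurable G :=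
    (current ν hC).isLocal.measurable.comp (measurePreserving_shift (ν := ν) x).measurable
  set φ : ℕ → ℝ → ℝ := fun n u => ∫ s, realize (iterCurrent ν hC lam γ n) (m s, ω u.toNNReal s)
    * G (m s, ω 0 s) ∂Q with hφ
  have hsum := hasSum_taylor (φ := φ)
    (K := (2 + ∫ p, G p ^ 2 ∂annealed ν) * absNorm (currentQuad ν hC))
    (M := 4 * C + 4 * γ + 8 * lam) ?_ ?_ ?_ t.coe_nonneg
  · have e : φ 0 t = currentCorr Q m ω t x := by
      simp only [hφ, currentCorr, Real.toNNReal_coe, iterCurrent, Function.iterate_zero, id,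
        realize_currentQuad]
      rfl
    rw [e] at hsum
    refine hsum.congr_fun ?_
    intro n
    simp only [hφ, Real.toNNReal_zero]
    rw [h.integral_comp 0 (F := fun p => realize (iterCurrent ν hC lam γ n) p * G p)
      ((realize _).isLocal.measurable.mul hGm)]
  · exact fun n u hu => h.intervalIntegrable_corr hu (realize _).isLocal.memLp hGL
      (realize _).isLocal.measurable hGm
  · intro n u hu
    have hg := isGen_realize hC lam γ (iterCurrent ν hC lam γ n)
    rw [← iterCurrent_succ] at hg
    simpa only [hφ, Real.toNNReal_zero] using h.corr_eq_add_integral hg hGL hGm hu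
  · intro n u _
    refine (h.abs_corr_realize_le _ hGL hGm _).trans ?_
    rw [mul_assoc]
    refine mul_le_mul_of_nonneg_left (absNorm_iterCurrent_le hC hlam hγ n) ?_
    exact add_nonneg zero_le_two (integral_nonneg fun p => sq_nonneg (G p))

theorem abs_inner_coef_le (a b : Coef ν) : |inner ℝ a b| ≤ ‖a.toMap‖ * ‖b.toMap‖ := by
  have h := norm_integral_le_of_norm_le_const (μ := disorderLaw ν) (f := fun m => a m * b m)
    (C := ‖a.toMap‖ * ‖b.toMap‖) (Eventually.of_forall fun m => by
      rw [norm_mul]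
      exact mul_le_mul (a.abs_apply_le m) (b.abs_apply_le m) (norm_nonneg _) (norm_nonneg _))
  rw [inner_coef]
  simpa using h

/-- By orthogonality the translated current detects a single coefficient of `a`, which makes the sum
over `x` converge. -/
theorem abs_integral_realize_mul_current_le (hC : 0 < C) (a : QuadSpace ν) (x : ℤ) :
    |∫ p, realize a p * current ν hC (shift x p) ∂annealed ν|
      ≤ absNorm (currentQuad ν hC) * ‖(a (x, 1)).toMap‖ := by
  obtain ⟨J, hJ⟩ : ∃ J : Coef ν, currentQuad ν hC = Finsupp.single (0, 1) J := ⟨_, rfl⟩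
  have hc : current ν hC = mono (0, 1) J := by rw [← realize_currentQuad, hJ, realize_single]
  have e : ∫ p, realize a p * current ν hC (shift x p) ∂annealed ν
      = inner ℝ (a (x, 1)) (transl x J) := by
    rw [hc]
    induction a using Finsupp.induction_linear with
    | zero => simp [show ∀ p : Disorder C × Config, (0 : LocalFun ν) p = 0 from fun _ => rfl]
    | add a b ha hb =>
      rw [Finsupp.add_apply, inner_add_left, ← ha, ← hb, map_add, ← integral_add
        (integrable_mul_shift_right _ _ x) (integrable_mul_shift_right _ _ x)]
      refine integral_congr_ae (Eventually.of_forall fun p => ?_)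
      exact add_mul (realize a p) (realize b p) _
    | single i α =>
      obtain ⟨y, k⟩ := i
      rw [realize_single, integral_mono_mul_mono_shift, add_zero]
      by_cases h : y = x ∧ k = 1
      · obtain ⟨rfl, rfl⟩ := h
        simp
      · have h' : ((x, 1) : ℤ × ℕ) ≠ (y, k) := fun e => h (by simp_all)
        rw [if_neg h, Finsupp.single_eq_of_ne h', inner_zero_left]
  rw [e, hJ, absNorm_single, mul_comm]
  exact (abs_inner_coef_le _ _).trans
    (mul_le_mul_of_nonneg_left (supNorm_transl_le x J) (norm_nonneg _))

theorem summable_norm_apply_one (a : QuadSpace ν) :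
    Summable (fun x : ℤ => ‖(a (x, 1)).toMap‖) ∧ ∑' x : ℤ, ‖(a (x, 1)).toMap‖ ≤ absNorm a := by
  classical
  have hx : ∀ x ∉ a.support.image Prod.fst, ‖(a (x, 1)).toMap‖ = 0 := fun x hx => by
    have : a (x, 1) = 0 := by
      by_contra h
      exact hx (Finset.mem_image_of_mem Prod.fst (Finsupp.mem_support_iff.2 h))
    rw [this, toMap_zero, norm_zero]
  refine ⟨summable_of_ne_finset_zero (s := a.support.image Prod.fst) hx, ?_⟩
  have hinj : Function.Injective fun x : ℤ => ((x, 1) : ℤ × ℕ) := fun x y h => (Prod.ext_iff.1 h).1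
  rw [tsum_eq_sum hx, absNorm_eq_sum (Finset.subset_union_left (s₁ := a.support)
    (s₂ := (a.support.image Prod.fst).image fun x : ℤ => ((x, 1) : ℤ × ℕ)))]
  rw [← Finset.sum_image (f := fun i => ‖(a i).toMap‖) (g := fun x : ℤ => ((x, 1) : ℤ × ℕ))
    hinj.injOn]
  exact Finset.sum_le_sum_of_subset_of_nonneg Finset.subset_union_right fun _ _ _ => norm_nonneg _

/-- The current correlations are summable in space, and their sum is the exponential series of
the generator applied to the current. -/
theorem hasSum_tsum_currentCorr (h : IsEquilibriumProcess ν lam γ Q ℱ m ω) (hC : 0 < C)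
    (hlam : 0 ≤ lam) (hγ : 0 ≤ γ) (t : ℝ≥0) :
    Summable (fun x : ℤ => currentCorr Q m ω t x) ∧
      HasSum (fun n : ℕ => (t : ℝ) ^ n / n.factorial
        * semiInner (realize (iterCurrent ν hC lam γ n)) (current ν hC))
        (∑' x : ℤ, currentCorr Q m ω t x) := by
  set A := absNorm (currentQuad ν hC) with hA
  have hA0 : 0 ≤ A := absNorm_nonneg _
  set M := 4 * C + 4 * γ + 8 * lam with hM
  obtain ⟨c, hc⟩ : ∃ c : ℕ → ℤ → ℝ, ∀ n x, c n x = ∫ p, realize (iterCurrent ν hC lam γ n) p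
      * current ν hC (shift x p) ∂annealed ν := ⟨_, fun _ _ => rfl⟩
  obtain ⟨w, hw⟩ : ∃ w : ℕ → ℤ → ℝ, ∀ n x, w n x = ‖(iterCurrent ν hC lam γ n (x, 1)).toMap‖ :=
    ⟨_, fun _ _ => rfl⟩
  obtain ⟨r, hr⟩ : ∃ r : ℕ → ℝ, ∀ n, r n = (t : ℝ) ^ n / n.factorial := ⟨_, fun _ => rfl⟩
  have hr0 : ∀ n, 0 ≤ r n := fun n => by rw [hr]; positivity
  have hw0 : ∀ n x, 0 ≤ w n x := fun n x => by rw [hw]; exact norm_nonneg _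
  have hws : ∀ n, Summable (w n) ∧ ∑' x, w n x ≤ A * M ^ n := fun n => by
    have h1 := summable_norm_apply_one (iterCurrent ν hC lam γ n)
    simp only [← hw] at h1
    exact ⟨h1.1, h1.2.trans (absNorm_iterCurrent_le hC hlam hγ n)⟩
  have hcw : ∀ n x, |c n x| ≤ A * w n x := fun n x => by
    rw [hc, hw]
    exact abs_integral_realize_mul_current_le hC _ _
  -- An absolutely summable majorant over Taylor order and site, which justifies exchanging the two
  -- sums.
  have hbs : Summable fun q : ℕ × ℤ => r q.1 * (A * w q.1 q.2) := by
    have hnn : ∀ q : ℕ × ℤ, 0 ≤ r q.1 * (A * w q.1 q.2) := fun q =>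
      mul_nonneg (hr0 _) (mul_nonneg hA0 (hw0 _ _))
    have hs : Summable fun n : ℕ => A * A * ((M * t) ^ n / n.factorial) :=
      (Real.summable_pow_div_factorial (M * t)).mul_left (A * A)
    refine (summable_prod_of_nonneg hnn).2
      ⟨fun n => ((hws n).1.mul_left A).mul_left (r n), ?_⟩
    refine Summable.of_nonneg_of_le (fun n => tsum_nonneg fun x => hnn (n, x)) (fun n => ?_) hs
    change ∑' x, r n * (A * w n x) ≤ _
    rw [tsum_mul_left, tsum_mul_left]
    calc r n * (A * ∑' x, w n x) ≤ r n * (A * (A * M ^ n)) :=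
          mul_le_mul_of_nonneg_left (mul_le_mul_of_nonneg_left (hws n).2 hA0) (hr0 n)
      _ = A * A * ((M * t) ^ n / n.factorial) := by rw [mul_pow, hr]; ring
  have hF : Summable (Function.uncurry fun (n : ℕ) (x : ℤ) => r n * c n x) := by
    refine Summable.of_norm_bounded hbs fun q => ?_
    rw [Function.uncurry, norm_mul, Real.norm_of_nonneg (hr0 _)]
    exact mul_le_mul_of_nonneg_left (hcw _ _) (hr0 _)
  have hx : ∀ x, ∑' n : ℕ, r n * c n x = currentCorr Q m ω t x := fun x => by
    simp only [hr, hc]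
    exact (hasSum_currentCorr h hC hlam hγ t x).tsum_eq
  have hn : ∀ n : ℕ, ∑' x, r n * c n x
      = r n * semiInner (realize (iterCurrent ν hC lam γ n)) (current ν hC) := fun n => by
    simp only [hc]
    exact tsum_mul_left
  simp only [← hr]
  constructor
  · have h1 := hF.prod_symm.prod
    simpa only [Prod.swap, Function.uncurry, hx] using h1
  · have h1 := hF.prod.hasSum
    simp only [Function.uncurry, hn] at h1
    have h2 := hF.tsum_comm
    simp only [hx, hn] at h2
    rwa [h2]

end Dynamics

end DisorderedChain

/-! ### From power series to Laplace transforms. -/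

section LaplaceSeries

variable {V : Type*} [NormedAddCommGroup V] [InnerProductSpace ℝ V] [CompleteSpace V]

theorem hasSum_inner_exp (L : V →L[ℝ] V) (g j : V) (t : ℝ) :
    HasSum (fun n : ℕ => t ^ n / n.factorial * inner ℝ g ((L ^ n) j))
      (inner ℝ g (NormedSpace.exp (t • L) j)) := by
  have h := ((innerSL ℝ g).comp (ContinuousLinearMap.apply ℝ V j)).hasSum
    (NormedSpace.exp_series_hasSum_exp' (𝕂 := ℝ) (t • L))
  refine h.congr_fun fun n => ?_
  have e : ((n.factorial : ℝ)⁻¹ • (t • L) ^ n) j = (t ^ n / n.factorial) • (L ^ n) j := by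
    rw [smul_pow, smul_smul, smul_apply, div_eq_inv_mul]
  change _ = inner ℝ g (((n.factorial : ℝ)⁻¹ • (t • L) ^ n) j)
  rw [e, real_inner_smul_right]

/-- A function with this power series is the semigroup matrix element, so the Laplace formula
transfers. -/
theorem laplace_of_hasSum (L : V →L[ℝ] V) (hL : ∀ u, inner ℝ (L u) u ≤ 0) {z : ℝ} (hz : 0 < z)
    {h j : V} (hh : z • h - L h = j) (g : V) {c : ℝ → ℝ}
    (hc : ∀ t, 0 < t → HasSum (fun n : ℕ => t ^ n / n.factorial * inner ℝ g ((L ^ n) j)) (c t)) :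
    IntegrableOn (fun t => Real.exp (-z * t) * c t) (Set.Ioi 0) ∧
      ∫ t in Set.Ioi (0 : ℝ), Real.exp (-z * t) * c t = inner ℝ g h := by
  obtain ⟨h1, h2⟩ := laplace_exp_smul L hL hz hh g
  have e : Set.EqOn (fun t => Real.exp (-z * t) * inner ℝ g (NormedSpace.exp (t • L) j))
      (fun t => Real.exp (-z * t) * c t) (Set.Ioi 0) := fun t ht => by
    beta_reduce
    rw [(hc t ht).unique (hasSum_inner_exp L g j t)]
  exact ⟨h1.congr_fun e measurableSet_Ioi, by
    rw [← h2]; exact (setIntegral_congr_fun measurableSet_Ioi e).symm⟩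

end LaplaceSeries

namespace DisorderedChain

variable {C : ℝ} {ν : Measure (Set.Icc C⁻¹ C)} [IsProbabilityMeasure ν] {lam γ : ℝ}

/-! ### Uniqueness for the resolvent equation in the full space. -/

section GraphUniqueness

theorem isGen_neg {f g : LocalFun ν} (h : IsGen ν lam γ f g) : IsGen ν lam γ (-f) (-g) := by
  have ef : (-f : LocalFun ν).toFun = fun p => -f p := rfl
  obtain ⟨Λ, hΛ⟩ := h.1
  refine ⟨⟨Λ, fun m => ?_⟩, fun p => ?_⟩
  · obtain ⟨F, hF, hFe⟩ := hΛ m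
    exact ⟨-F, hF.neg, fun ω => congrArg Neg.neg (hFe ω)⟩
  · have e : (-g : LocalFun ν) p = -g p := rfl
    have hsub : ∀ a b : ℝ, -a - -b = -(a - b) := fun a b => by ring
    rw [e, h.2, ef, gen, gen, genA, genA, genFlip, genFlip, genExch, genExch]
    simp only [deriv.fun_neg, mul_neg, hsub, finsum_neg_distrib]
    ring

theorem sub_mem_genGraph {q q' : L2star ν × L2star ν} (h : q ∈ genGraph ν lam γ)
    (h' : q' ∈ genGraph ν lam γ) : q - q' ∈ genGraph ν lam γ := by
  refine map_mem_closure₂ continuous_sub h h' ?_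
  rintro _ ⟨f, g, hfg, rfl⟩ _ ⟨f', g', hfg', rfl⟩
  refine ⟨f - f', g - g', ?_, ?_⟩
  · rw [sub_eq_add_neg, sub_eq_add_neg]
    exact isGen_add hfg (isGen_neg hfg')
  · rw [UniformSpace.Completion.coe_sub, UniformSpace.Completion.coe_sub]
    rfl

/-- The difference of two solutions lies with `z` times itself in the dissipative graph, so its norm
is zero. The solutions need not be limits of quadratic functions. -/
theorem isResolventSolution_unique (hC : 0 < C) (hlam : 0 ≤ lam) (hγ : 0 ≤ γ) {z : ℝ}
    (hz : 0 < z) {h h' : L2star ν} (hh : IsResolventSolution ν hC lam γ z h)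
    (hh' : IsResolventSolution ν hC lam γ z h') : h' = h := by
  have e := inner_nonpos_of_mem_genGraph hlam hγ (sub_mem_genGraph hh' hh)
  have e2 : (z • h' - (current ν hC : L2star ν)) - (z • h - (current ν hC : L2star ν))
      = z • (h' - h) := by
    rw [smul_sub]
    abel
  rw [Prod.snd_sub, Prod.fst_sub, e2, real_inner_smul_left, real_inner_self_eq_norm_sq] at e
  have h0 : ‖h' - h‖ ^ 2 ≤ 0 := nonpos_of_mul_nonpos_right e hz
  have h1 : ‖h' - h‖ = 0 := by nlinarith [norm_nonneg (h' - h), sq_nonneg ‖h' - h‖]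
  exact sub_eq_zero.1 (norm_eq_zero.1 h1)

end GraphUniqueness

/-! ### The bounded operator induced on the closed quadratic functions. -/

section BoundedGenerator

/-- Quadratic functions as elements of `𝐋²_⋆`. -/
def quadEmb (ν : Measure (Set.Icc C⁻¹ C)) [IsProbabilityMeasure ν] :
    QuadSpace ν →ₗ[ℝ] L2star ν :=
  (UniformSpace.Completion.toComplₗᵢ (𝕜 := ℝ) (E := LocalFun ν)).toLinearMap ∘ₗ realize

theorem quadEmb_apply (a : QuadSpace ν) : quadEmb ν a = (realize a : L2star ν) := rfl

theorem quadEmb_currentQuad (hC : 0 < C) :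
    quadEmb ν (currentQuad ν hC) = (current ν hC : L2star ν) := by
  rw [quadEmb_apply, realize_currentQuad]

theorem inner_quadEmb (a b : QuadSpace ν) :
    inner ℝ (quadEmb ν a) (quadEmb ν b) = semiInner (realize a) (realize b) :=
  inner_eq_semiInner _ _

theorem norm_quadEmb (a : QuadSpace ν) : ‖quadEmb ν a‖ = ‖realize a‖ :=
  UniformSpace.Completion.norm_coe _

/-- The generator on the closure of the quadratic functions. -/
theorem exists_bounded_generator (hC : 0 < C) (hlam : 0 < lam) (hγ : 0 < γ) :
    ∃ (L : L2star ν →L[ℝ] L2star ν) (K : ℝ), 0 ≤ K ∧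
      (∀ a, L (quadEmb ν a) = quadEmb ν (genQuad hC lam γ a)) ∧
      (∀ u, inner ℝ (L u) u ≤ 0) ∧
      (∀ u v, inner ℝ (L u) v ^ 2 ≤ K * (-inner ℝ (L u) u) * (-inner ℝ (L v) v)) ∧
      (∀ v, inner ℝ (current ν hC : L2star ν) v ^ 2 ≤ K * (-inner ℝ (L v) v)) ∧
      (∀ u, L u ∈ closure (Set.range (quadEmb ν))) ∧
      ∀ u ∈ closure (Set.range (quadEmb ν)), (u, L u) ∈ genGraph ν lam γ := by
  obtain ⟨M, K, hM, hK, hb⟩ := exists_sector_bounds (ν := ν) hC hlam hγ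
  -- Testing the bilinear bound against the image itself yields the operator bound.
  have hbd : ∀ a, ‖quadEmb ν (genQuad hC lam γ a)‖ ≤ M * ‖quadEmb ν a‖ := fun a => by
    have h1 := (hb a (genQuad hC lam γ a)).1
    rw [← inner_quadEmb, real_inner_self_eq_norm_sq, ← norm_quadEmb, ← norm_quadEmb,
      abs_of_nonneg (sq_nonneg _), sq] at h1
    rcases (norm_nonneg (quadEmb ν (genQuad hC lam γ a))).eq_or_lt with h0 | h0
    · rw [← h0]; positivity
    · exact le_of_mul_le_mul_right h1 h0
  obtain ⟨L, hL, hu⟩ := exists_bounded_extension (quadEmb ν) (genQuad hC lam γ) hbd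
  have hcd : ∀ u ∈ closure (Set.range (quadEmb ν)), inner ℝ (L u) u ≤ 0 := fun u hu => by
    refine closure_minimal (t := {u | inner ℝ (L u) u ≤ 0}) ?_
      (isClosed_le (by fun_prop) continuous_const) hu
    rintro _ ⟨a, rfl⟩
    rw [Set.mem_ofPred_eq, hL, inner_quadEmb]
    exact semiInner_nonpos_of_isGen hlam.le hγ.le (isGen_realize hC lam γ a)
  have hcs : ∀ u ∈ closure (Set.range (quadEmb ν)), ∀ v ∈ closure (Set.range (quadEmb ν)),
      inner ℝ (L u) v ^ 2 ≤ K * (-inner ℝ (L u) u) * (-inner ℝ (L v) v) := fun u hu v hv => by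
    refine closure_minimal
      (t := {u | inner ℝ (L u) v ^ 2 ≤ K * (-inner ℝ (L u) u) * (-inner ℝ (L v) v)}) ?_
      (isClosed_le (by fun_prop) (by fun_prop)) hu
    rintro _ ⟨a, rfl⟩
    refine closure_minimal (t := {v | inner ℝ (L (quadEmb ν a)) v ^ 2
      ≤ K * (-inner ℝ (L (quadEmb ν a)) (quadEmb ν a)) * (-inner ℝ (L v) v)}) ?_
      (isClosed_le (by fun_prop) (by fun_prop)) hv
    rintro _ ⟨b, rfl⟩
    simp only [Set.mem_ofPred_eq, hL, inner_quadEmb]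
    exact (hb a b).2.1
  have hcj : ∀ v ∈ closure (Set.range (quadEmb ν)),
      inner ℝ (current ν hC : L2star ν) v ^ 2 ≤ K * (-inner ℝ (L v) v) := fun v hv => by
    refine closure_minimal
      (t := {v | inner ℝ (current ν hC : L2star ν) v ^ 2 ≤ K * (-inner ℝ (L v) v)}) ?_
      (isClosed_le (by fun_prop) (by fun_prop)) hv
    rintro _ ⟨b, rfl⟩
    rw [Set.mem_ofPred_eq, hL, inner_quadEmb, ← quadEmb_currentQuad, inner_quadEmb,
      realize_currentQuad]
    exact (hb b b).2.2
  -- Vectors may be replaced by their projections: the operator ignores the complement, and both its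
  -- values and the current lie in the closed quadratic space.
  have hred : ∀ u v, ∃ u' ∈ closure (Set.range (quadEmb ν)),
      ∃ v' ∈ closure (Set.range (quadEmb ν)), inner ℝ (L u) v = inner ℝ (L u') v' ∧
        inner ℝ (L u) u = inner ℝ (L u') u' ∧ inner ℝ (L v) v = inner ℝ (L v') v' ∧
        inner ℝ (current ν hC : L2star ν) v = inner ℝ (current ν hC : L2star ν) v' := by
    intro u v
    obtain ⟨u', hu', hiu, hLu, hmu⟩ := hu u
    obtain ⟨v', hv', hiv, hLv, hmv⟩ := hu v
    have hj : (current ν hC : L2star ν) ∈ closure (Set.range (quadEmb ν)) :=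
      subset_closure ⟨_, quadEmb_currentQuad hC⟩
    refine ⟨u', hu', v', hv', ?_, ?_, ?_, ?_⟩
    · rw [hLu, real_inner_comm, hiv _ hmu, real_inner_comm]
    · rw [hLu, real_inner_comm, hiu _ hmu, real_inner_comm]
    · rw [hLv, real_inner_comm, hiv _ hmv, real_inner_comm]
    · rw [real_inner_comm, hiv _ hj, real_inner_comm]
  refine ⟨L, K, hK, hL, fun u => ?_, fun u v => ?_, fun v => ?_, fun u => ?_, fun u hu => ?_⟩
  · obtain ⟨u', hu', -, -, -, h, -, -⟩ := hred u u
    rw [h]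
    exact hcd u' hu'
  · obtain ⟨u', hu', v', hv', h1, h2, h3, -⟩ := hred u v
    rw [h1, h2, h3]
    exact hcs u' hu' v' hv'
  · obtain ⟨-, -, v', hv', -, -, h3, h4⟩ := hred v v
    rw [h3, h4]
    exact hcj v' hv'
  · obtain ⟨u', -, -, h, h'⟩ := hu u
    rw [h]
    exact h'
  · refine map_mem_closure (f := fun u => (u, L u)) (by fun_prop) hu ?_
    rintro _ ⟨a, rfl⟩
    exact ⟨_, _, isGen_realize hC lam γ a, Prod.ext rfl (hL a)⟩

theorem pow_apply_quadEmb_currentQuad (hC : 0 < C) {L : L2star ν →L[ℝ] L2star ν}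
    (hL : ∀ a, L (quadEmb ν a) = quadEmb ν (genQuad hC lam γ a)) (n : ℕ) :
    (L ^ n) (current ν hC : L2star ν) = quadEmb ν (iterCurrent ν hC lam γ n) := by
  induction n with
  | zero => exact (quadEmb_currentQuad hC).symm
  | succ n ih => rw [pow_succ', mul_apply_eq_comp, ih, hL, iterCurrent_succ]

theorem inner_current_pow_apply (hC : 0 < C) {L : L2star ν →L[ℝ] L2star ν}
    (hL : ∀ a, L (quadEmb ν a) = quadEmb ν (genQuad hC lam γ a)) (n : ℕ) :
    inner ℝ (current ν hC : L2star ν) ((L ^ n) (current ν hC : L2star ν))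
      = semiInner (realize (iterCurrent ν hC lam γ n)) (current ν hC) := by
  rw [pow_apply_quadEmb_currentQuad hC hL, real_inner_comm]
  exact inner_eq_semiInner _ _

end BoundedGenerator

end DisorderedChain

/-! ### The Green-Kubo formula and its limit. -/

theorem mainTheorem4 (C lam γ : ℝ) (hC : 0 < C) (hlam : 0 < lam) (hγ : 0 < γ)
    (ν : MeasureTheory.Measure (Set.Icc C⁻¹ C)) [MeasureTheory.IsProbabilityMeasure ν] :
    ∃ (h : ℝ → DisorderedChain.L2star ν) (D : ℝ),
      (∀ z : ℝ, 0 < z → DisorderedChain.IsResolventSolution ν hC lam γ z (h z) ∧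
        ∀ h' : DisorderedChain.L2star ν,
          DisorderedChain.IsResolventSolution ν hC lam γ z h' → h' = h z) ∧
      lam ≤ D ∧ 0 < D ∧
      Filter.Tendsto (fun z : ℝ =>
          lam + 1 / 2 * inner ℝ (DisorderedChain.current ν hC : DisorderedChain.L2star ν) (h z))
        (𝓝[>] 0) (𝓝 D) ∧
      ∀ {S : Type*} {mS : MeasurableSpace S} (Q : MeasureTheory.Measure S)
        (ℱ : MeasureTheory.Filtration ℝ≥0 mS) (m : S → DisorderedChain.Disorder C)
        (ω : ℝ≥0 → S → DisorderedChain.Config),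
        DisorderedChain.IsEquilibriumProcess ν lam γ Q ℱ m ω →
          (∀ t : ℝ≥0, Summable (fun x : ℤ => DisorderedChain.currentCorr Q m ω t x)) ∧
          (∀ z : ℝ, 0 < z →
            MeasureTheory.IntegrableOn (fun t : ℝ => Real.exp (-z * t)
              * ∑' x : ℤ, DisorderedChain.currentCorr Q m ω t.toNNReal x) (Set.Ioi 0) ∧
            DisorderedChain.greenKubo lam Q m ω z = lam
              + 1 / 2 * inner ℝ (DisorderedChain.current ν hC : DisorderedChain.L2star ν) (h z)) ∧
          Filter.Tendsto (DisorderedChain.greenKubo lam Q m ω) (𝓝[>] 0) (𝓝 D) := by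
  obtain ⟨L, K, hK, hLι, hLd, hLs, hLj, hLr, hLg⟩ :=
    DisorderedChain.exists_bounded_generator (ν := ν) hC hlam hγ
  have hex : ∀ z : ℝ, ∃ h : DisorderedChain.L2star ν,
      0 < z → z • h - L h = (DisorderedChain.current ν hC : DisorderedChain.L2star ν) := fun z => by
    by_cases hz : 0 < z
    · obtain ⟨h, hh⟩ := exists_resolvent L hLd hz
        (DisorderedChain.current ν hC : DisorderedChain.L2star ν)
      exact ⟨h, fun _ => hh⟩
    · exact ⟨0, fun h => absurd h hz⟩
  choose h hh using hex
  -- `L` is known to agree with the generator only on the closed quadratic space. The equation `h z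
  -- = z⁻¹ (j + L (h z))` places the solution there.
  have hmem : ∀ z : ℝ, 0 < z → h z ∈ closure (Set.range (DisorderedChain.quadEmb ν)) :=
      fun z hz => by
    have e : h z = z⁻¹ • ((DisorderedChain.current ν hC : DisorderedChain.L2star ν) + L (h z)) := by
      rw [← hh z hz, sub_add_cancel, smul_smul, inv_mul_cancel₀ hz.ne', one_smul]
    have hc : closure (Set.range (DisorderedChain.quadEmb ν))
        = ((LinearMap.range (DisorderedChain.quadEmb ν)).topologicalClosure : Set _) := rfl
    have hj : (DisorderedChain.current ν hC : DisorderedChain.L2star ν)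
        ∈ closure (Set.range (DisorderedChain.quadEmb ν)) :=
      subset_closure ⟨_, DisorderedChain.quadEmb_currentQuad hC⟩
    have hl := hLr (h z)
    rw [e, hc]
    rw [hc] at hj hl
    exact Submodule.smul_mem _ _ (Submodule.add_mem _ hj hl)
  have hsol : ∀ z : ℝ, 0 < z → DisorderedChain.IsResolventSolution ν hC lam γ z (h z) :=
      fun z hz => by
    have e := hLg _ (hmem z hz)
    rwa [show L (h z) = z • h z - (DisorderedChain.current ν hC : DisorderedChain.L2star ν) by
      rw [← hh z hz, sub_sub_cancel]] at e
  obtain ⟨D, hD, hlim⟩ := exists_tendsto_resolvent L hLd hK hLs hLj h hh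
  have hlim' := (hlim.const_mul (1 / 2)).const_add lam
  refine ⟨h, lam + 1 / 2 * D, fun z hz => ⟨hsol z hz, fun h' hh' =>
    DisorderedChain.isResolventSolution_unique hC hlam.le hγ.le hz (hsol z hz) hh'⟩,
    by linarith, by linarith, hlim', ?_⟩
  intro S mS Q ℱ m ω hQ
  -- The correlations of an arbitrary equilibrium process have the power series of `⟨j, e^{tL} j⟩`.
  have hcorr : ∀ t : ℝ, 0 < t → HasSum (fun n : ℕ => t ^ n / n.factorial
      * inner ℝ (DisorderedChain.current ν hC : DisorderedChain.L2star ν)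
        ((L ^ n) (DisorderedChain.current ν hC : DisorderedChain.L2star ν)))
      (∑' x : ℤ, DisorderedChain.currentCorr Q m ω t.toNNReal x) := fun t ht => by
    have h1 := (DisorderedChain.hasSum_tsum_currentCorr hQ hC hlam.le hγ.le t.toNNReal).2
    rw [Real.coe_toNNReal t ht.le] at h1
    simpa only [DisorderedChain.inner_current_pow_apply hC hLι] using h1
  have hGK : ∀ z : ℝ, 0 < z →
      MeasureTheory.IntegrableOn (fun t : ℝ => Real.exp (-z * t)
        * ∑' x : ℤ, DisorderedChain.currentCorr Q m ω t.toNNReal x) (Set.Ioi 0) ∧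
      DisorderedChain.greenKubo lam Q m ω z = lam
        + 1 / 2 * inner ℝ (DisorderedChain.current ν hC : DisorderedChain.L2star ν) (h z) :=
      fun z hz => by
    obtain ⟨h1, h2⟩ := laplace_of_hasSum L hLd hz (hh z hz)
      (DisorderedChain.current ν hC : DisorderedChain.L2star ν) hcorr
    exact ⟨h1, by rw [DisorderedChain.greenKubo, h2]⟩
  refine ⟨fun t => (DisorderedChain.hasSum_tsum_currentCorr hQ hC hlam.le hγ.le t).1, hGK,
    hlim'.congr' ?_⟩
  filter_upwards [self_mem_nhdsWithin] with z hz
  exact (hGK z hz).2.symm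

end
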